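/- **Setting.** Let $d\in\mathbb N$, $m_q,m_p\in\mathbb R$, $\varepsilon_0>0$, $\langle a\rangle=(1+|a|^2)^{1/2}$, and $a\cdot b=\sum_j a_jb_j$ (no conjugation) on $\mathbb C^d$; $A^\dagger$ is the transpose. For a positive function $w$ on $\mathbb R^{2d}$, write $u\in C(\mathbb R,S[w])$ for a family $u^\varepsilon(t,\cdot)\in C^\infty(\mathbb R^{2d},\mathbb C)$, $0<\varepsilon\le\varepsilon_0$, $t\in\mathbb R$ (possibly independent of $\varepsilon$), such that for every $k$ the derivatives of order $k$ in $(q,p)$ are bounded by $C_{k,T}\,w(q,p)$, uniformly in $\varepsilon$ and in $|t|\le T$, for every $T>0$, and are continuous in $(t,q,p)$, equicontinuously in $\varepsilon$. Let $w_0(q,p)=\langle q\rangle^{m_q}\langle p\rangle^{m_p}$; $S[w_0]$ is the symbol class $S[(m_q,m_p);(d,d)]$. A canonical transformation is a smooth diffeomorphism $\kappa=(X^\kappa,\Xi^\kappa)$ of $\mathbb R^d\times\mathbb R^d$ whose Jacobian matrix $F^\kappa$ is symplectic everywhere. A family $\kappa^t$, $t\in\mathbb R$, of canonical transformations is of class $\mathcal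 B$ if $\kappa^t$ and $F^{\kappa^t}$ are pointwise $C^1$ in $t$, $\frac{d}{dt}F^{\kappa^t}$ is smooth in $(q,p)$, and all $(q,p)$-derivatives of every order $k\ge0$ of $F^{\kappa^t}$ and of $\frac{d}{dt}F^{\kappa^t}$ are bounded, uniformly in $|t|\le T$, for every $T>0$. An action associated to $\kappa$ is a real differentiable function $S^\kappa$ with $S^\kappa_q=-p+X^\kappa_q\Xi^\kappa$, $S^\kappa_p=X^\kappa_p\Xi^\kappa$, where $(G_q)_{jk}=\partial_{q_j}G_k$, and likewise for $p$. For complex symmetric $d\times d$ matrices $\Theta^x,\Theta^y$ with positive definite real part, let $$\Phi^\kappa(x,y,q,p)=S^\kappa(q,p)-p\cdot(y-q)+\Xi^\kappa\cdot(x-X^\kappa)+\tfrac i2(y-q)\cdot\Theta^y(y-q)+\tfrac i2(x-X^\kappa)\cdot\Theta^x(x-X^\kappa),$$ $$[\mathcal I^\varepsilon(\kappa;u;\Theta^x,\Theta^y)\varphi](x)=\frac1{(2\pi\varepsilon)^{3d/2}}\int_{\mathbb R^{3d}}e^{\frac i\varepsilon\Phi^\kappa}(L_y^\dagger)^n[u\varphi(y)]\,dq\,dp\,dy,\qquad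 \varphi\in\mathcal S(\mathbb R^d,\mathbb C),$$ where $L_y=(1+|\nabla_y\Phi^\kappa|^2)^{-1}[1-i\varepsilon\nabla_y\overline{\Phi^\kappa}\cdot\nabla_y]$, $L_y^\dagger$ is its transpose with respect to $\int vw\,dy$, and $n\in\mathbb N$ is larger than $d$ plus the order of $u$ in $p$. Let $\partial_z=(\Theta^y)^{-1}\partial_q-i\partial_p$, $(G_z)_{jk}=\partial_{z_j}G_k$, $\operatorname{div}V=\sum_j\partial_{z_j}V_j$ and $\mathcal Z=X^\kappa_z\Theta^x+i\,\Xi^\kappa_z$. **Proposition.** Let $u\in C(\mathbb R,S[w_0])$ be such that $u^\varepsilon(\cdot,q,p)\in C^1(\mathbb R,\mathbb C)$ for all $\varepsilon,q,p$, and $\frac{d}{dt}u\in C(\mathbb R,S[w_0])$. Let $\kappa^t$ be a family of canonical transformations of class $\mathcal B$, $S^{\kappa^t}$ an action associated to $\kappa^t$ that is pointwise $C^1$ in $t$, $\Theta^x\in C^1(\mathbb R,\mathbb C^{d\times d})$ a family of complex symmetric matrices with positive definite real part, and $\Theta^y$ complex symmetric with positive definite real part. Then $\mathcal Z(t,q,p)$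 is invertible for all $(t,q,p)$. With $$v_0=u\Big(-\tfrac{d}{dt}S^{\kappa^t}+\tfrac{d}{dt}X^{\kappa^t}\cdot\Xi^{\kappa^t}\Big),$$ $$v_1=i\tfrac{d}{dt}u+\operatorname{div}\Big(\big(\tfrac{d}{dt}\Xi^{\kappa^t}-i\Theta^x(t)\tfrac{d}{dt}X^{\kappa^t}\big)^\dagger\mathcal Z^{-1}u\Big)-\tfrac i2\,u\,\mathrm{tr}\Big(\mathcal Z^{-1}X^{\kappa^t}_z\tfrac{d}{dt}\Theta^x(t)\Big),$$ $$v_2=-\tfrac i2\sum_{k=1}^d\operatorname{div}\Big(\big(\partial_{z_k}\big(\tfrac{d}{dt}\Theta^x(t)\,\mathcal Z^{-1}e_k\,u\big)\big)^\dagger\mathcal Z^{-1}\Big),$$ one has $v_0\in C(\mathbb R,S[\langle(q,p)\rangle^2w_0])$, $v_1\in C(\mathbb R,S[\langle(q,p)\rangle w_0])$, $v_2\in C(\mathbb R,S[w_0])$. For every $\varepsilon\in(0,\varepsilon_0]$ and $t\in\mathbb R$, the operators $\mathcal I^\varepsilon(\kappa^t;u;\Theta^x(t),\Theta^y)$ and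 $\mathcal I^\varepsilon(\kappa^t;v_0+\varepsilon v_1+\varepsilon^2v_2;\Theta^x(t),\Theta^y)$ map $\mathcal S(\mathbb R^d,\mathbb C)$ into itself and are given by absolutely convergent integrals that do not depend on the choice of $n$ (with $n>m_p+d$ and $n>m_p+2+d$, respectively). On $\mathcal S(\mathbb R^d,\mathbb C)$, $$i\varepsilon\frac{d}{dt}\,\mathcal I^\varepsilon\big(\kappa^t;u;\Theta^x(t),\Theta^y\big)=\mathcal I^\varepsilon\big(\kappa^t;v_0+\varepsilon v_1+\varepsilon^2v_2;\Theta^x(t),\Theta^y\big),$$ where, for each $\varphi\in\mathcal S(\mathbb R^d,\mathbb C)$, the derivative of $t\mapsto\mathcal I^\varepsilon(\kappa^t;u;\Theta^x(t),\Theta^y)\varphi$ is taken in the topology of $\mathcal S(\mathbb R^d,\mathbb C)$. -/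

import Mathlib

open MeasureTheory Filter Topology
open scoped ContDiff SchwartzMap

namespace HermanKluk

/-- Configuration space `ℝ^d` with the Euclidean norm. -/
abbrev Conf (d : ℕ) : Type := EuclideanSpace ℝ (Fin d)

/-- Phase space `T^*ℝ^d = ℝ^d × ℝ^d`, with points `z = (q, p)`. -/
abbrev Phase (d : ℕ) : Type := Conf d × Conf d

/-- The canonical basis vector `e_j` of `ℝ^d`. -/
noncomputable def basisVec {d : ℕ} (j : Fin d) : Conf d := EuclideanSpace.single j 1

/-- A real vector seen as a vector of `ℂ^d`. -/
def toC {d : ℕ} (a : Conf d) : Fin d → ℂ := fun j => ((a j : ℝ) : ℂ)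

/-! ### Symbols -/

/-- The order function `⟨q⟩^mq ⟨p⟩^mp` of the class `S[(mq, mp); (d, d)]`, where
`⟨a⟩ = (1 + |a|²)^(1/2)`. -/
noncomputable def orderFun {d : ℕ} (mq mp : ℝ) (z : Phase d) : ℝ :=
  (1 + ‖z.1‖ ^ 2) ^ (mq / 2) * (1 + ‖z.2‖ ^ 2) ^ (mp / 2)

/-- `⟨(q, p)⟩ = (1 + |q|² + |p|²)^(1/2)`. -/
noncomputable def phaseBracket {d : ℕ} (z : Phase d) : ℝ :=
  Real.sqrt (1 + ‖z.1‖ ^ 2 + ‖z.2‖ ^ 2)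

/-- A continuous family `t ↦ u(t)`, `t ∈ ℝ`, of (possibly `ε`-dependent) symbols with order
function `w`: every `u^ε(t, ·)`, `0 < ε ≤ ε₀`, is smooth on phase space, each derivative of order
`k` in `(q, p)` is bounded by a multiple of `w`, uniformly in `ε` and in `t ∈ [-T, T]` for every
`T`, and it depends continuously on `(t, q, p)`, equicontinuously in `ε`.
For `w = orderFun mq mp` this is `u ∈ C(ℝ, S[(mq, mp); (d, d)])`; a symbol that does not depend on
`ε` is the case of a constant function of `ε`. -/
structure IsSymbolFamily {d : ℕ} (ε₀ : ℝ) (w : Phase d → ℝ) (u : ℝ → ℝ → Phase d → ℂ) : Prop where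
  smooth : ∀ ε ∈ Set.Ioc 0 ε₀, ∀ t : ℝ, ContDiff ℝ ∞ (u ε t)
  bounded : ∀ (k : ℕ) (T : ℝ), ∃ C : ℝ, ∀ ε ∈ Set.Ioc 0 ε₀, ∀ t ∈ Set.Icc (-T) T, ∀ z : Phase d,
    ‖iteratedFDeriv ℝ k (u ε t) z‖ ≤ C * w z
  continuous : ∀ k : ℕ, Equicontinuous
    (fun (ε : Set.Ioc 0 ε₀) (tz : ℝ × Phase d) => iteratedFDeriv ℝ k (u ε tz.1) tz.2)

/-! ### Canonical transformations and actions -/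

/-- The Jacobian matrix `F^κ` of `κ = (X, Ξ)`, with blocks `∂_q X`, `∂_p X`, `∂_q Ξ`, `∂_p Ξ`
(row index: component of `κ`, column index: variable). -/
noncomputable def jacobian {d : ℕ} (κ : Phase d → Phase d) (z : Phase d) :
    Matrix (Fin d ⊕ Fin d) (Fin d ⊕ Fin d) ℝ :=
  Matrix.fromBlocks
    (Matrix.of fun j k => (fderiv ℝ κ z (basisVec k, 0)).1 j)
    (Matrix.of fun j k => (fderiv ℝ κ z (0, basisVec k)).1 j)
    (Matrix.of fun j k => (fderiv ℝ κ z (basisVec k, 0)).2 j)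
    (Matrix.of fun j k => (fderiv ℝ κ z (0, basisVec k)).2 j)

/-- The matrix `J` of the standard symplectic form. -/
def sympJ (d : ℕ) : Matrix (Fin d ⊕ Fin d) (Fin d ⊕ Fin d) ℝ :=
  Matrix.fromBlocks 0 1 (-1) 0

/-- A canonical transformation: a diffeomorphism of phase space with symplectic Jacobian. -/
structure IsCanonical {d : ℕ} (κ : Phase d → Phase d) : Prop where
  smooth : ContDiff ℝ ∞ κ
  smooth_inverse : ∃ g : Phase d → Phase d,
    ContDiff ℝ ∞ g ∧ Function.LeftInverse g κ ∧ Function.RightInverse g κ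
  symplectic : ∀ z, (jacobian κ z).transpose * sympJ d * jacobian κ z = sympJ d

/-- A time-dependent family of canonical transformations, of class `𝓑` in `[-T, T]` for every
`T`: it is pointwise `C¹` in time, and all derivatives in `(q, p)` of the entries of `F^{κ^t}` and
of `d/dt F^{κ^t}` are bounded, uniformly for `t ∈ [-T, T]`. -/
structure IsClassBFamily {d : ℕ} (κ : ℝ → Phase d → Phase d) : Prop where
  canonical : ∀ t, IsCanonical (κ t)
  time_C1 : ∀ z, ContDiff ℝ 1 (fun t => κ t z)
  jacobian_time_C1 : ∀ z i j, ContDiff ℝ 1 (fun t => jacobian (κ t) z i j)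
  deriv_smooth : ∀ t i j, ContDiff ℝ ∞ (fun z => deriv (fun s => jacobian (κ s) z i j) t)
  bounded : ∀ (k : ℕ) (T : ℝ), ∃ C : ℝ, ∀ t ∈ Set.Icc (-T) T, ∀ z i j,
    ‖iteratedFDeriv ℝ k (fun z' => jacobian (κ t) z' i j) z‖ ≤ C
  deriv_bounded : ∀ (k : ℕ) (T : ℝ), ∃ C : ℝ, ∀ t ∈ Set.Icc (-T) T, ∀ z i j,
    ‖iteratedFDeriv ℝ k (fun z' => deriv (fun s => jacobian (κ s) z' i j) t) z‖ ≤ C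

/-- `S` is an action associated to `κ = (X, Ξ)`:
`∂_q S = -p + X_q Ξ` and `∂_p S = X_p Ξ`, where `(X_q)_{jk} = ∂_{q_j} X_k`. -/
structure IsAction {d : ℕ} (κ : Phase d → Phase d) (S : Phase d → ℝ) : Prop where
  differentiable : Differentiable ℝ S
  grad_q : ∀ z j, fderiv ℝ S z (basisVec j, 0) =
    -(z.2 j) + ∑ k, (fderiv ℝ κ z (basisVec j, 0)).1 k * (κ z).2 k
  grad_p : ∀ z j, fderiv ℝ S z (0, basisVec j) =
    ∑ k, (fderiv ℝ κ z (0, basisVec j)).1 k * (κ z).2 k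

/-- A complex symmetric matrix with positive definite real part. -/
structure IsWidth {d : ℕ} (Θ : Matrix (Fin d) (Fin d) ℂ) : Prop where
  symm : Θ.IsSymm
  posDef : (Θ.map Complex.re).PosDef

/-! ### Fourier Integral Operators -/

/-- The phase function `Φ^κ(x, y, q, p; Θx, Θy)`. -/
noncomputable def phase {d : ℕ} (κ : Phase d → Phase d) (S : Phase d → ℝ)
    (Θx Θy : Matrix (Fin d) (Fin d) ℂ) (x y q p : Conf d) : ℂ :=
  (S (q, p) : ℂ) - toC p ⬝ᵥ toC (y - q)
    + toC (κ (q, p)).2 ⬝ᵥ toC (x - (κ (q, p)).1)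
    + Complex.I / 2 * (toC (y - q) ⬝ᵥ Θy.mulVec (toC (y - q)))
    + Complex.I / 2 * (toC (x - (κ (q, p)).1) ⬝ᵥ Θx.mulVec (toC (x - (κ (q, p)).1)))

/-- The partial derivative `∂_{y_j} f`. -/
noncomputable def pderiv {d : ℕ} (j : Fin d) (f : Conf d → ℂ) (y : Conf d) : ℂ :=
  fderiv ℝ f y (basisVec j)

/-- `1 + |∇_y Φ|²`, for `Φ` regarded as a function of `y`. -/
noncomputable def gradWeight {d : ℕ} (Φ : Conf d → ℂ) (y : Conf d) : ℂ :=
  ((1 + ∑ j, ‖pderiv j Φ y‖ ^ 2 : ℝ) : ℂ)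

/-- The transpose `L_y^†` (with respect to `∫ v w dy`) of the differential operator
`L_y = (1 + |∇_y Φ|²)⁻¹ (1 - i ε ∇_y Φ̄ · ∇_y)`, that is
`L_y^† v = (1 + |∇_y Φ|²)⁻¹ v + i ε ∑_j ∂_{y_j} ((1 + |∇_y Φ|²)⁻¹ (∂_{y_j} Φ̄) v)`. -/
noncomputable def transposeL {d : ℕ} (ε : ℝ) (Φ : Conf d → ℂ) (v : Conf d → ℂ) (y : Conf d) : ℂ :=
  v y / gradWeight Φ y + Complex.I * (ε : ℂ) *
    ∑ j, pderiv j (fun y' => pderiv j (fun y'' => star (Φ y'')) y' * v y' / gradWeight Φ y') y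

/-- The integrand `e^{iΦ/ε} (L_y^†)^n [u(x, y, q, p) φ(y)]` of a Fourier Integral Operator with
symbol `u`, as a function of `(q, p, y)`. -/
noncomputable def fioIntegrand {d : ℕ} (n : ℕ) (ε : ℝ) (κ : Phase d → Phase d) (S : Phase d → ℝ)
    (u : Conf d → Conf d → Conf d → Conf d → ℂ) (Θx Θy : Matrix (Fin d) (Fin d) ℂ)
    (φ : Conf d → ℂ) (x : Conf d) (w : Conf d × Conf d × Conf d) : ℂ :=
  Complex.exp (Complex.I / (ε : ℂ) * phase κ S Θx Θy x w.2.2 w.1 w.2.1) *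
    (transposeL ε (fun y => phase κ S Θx Θy x y w.1 w.2.1))^[n]
      (fun y => u x y w.1 w.2.1 * φ y) w.2.2

/-- The Fourier Integral Operator `[𝓘^ε(κ; u; Θx, Θy) φ](x)`, regularised with `n` powers of
`L_y^†`. For a symbol of order `mp` in `p`, the admissible `n` are those with `n > mp + d`. -/
noncomputable def fio {d : ℕ} (n : ℕ) (ε : ℝ) (κ : Phase d → Phase d) (S : Phase d → ℝ)
    (u : Conf d → Conf d → Conf d → Conf d → ℂ) (Θx Θy : Matrix (Fin d) (Fin d) ℂ)
    (φ : Conf d → ℂ) (x : Conf d) : ℂ :=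
  (((2 * Real.pi * ε) ^ (3 * (d : ℝ) / 2) : ℝ) : ℂ)⁻¹ *
    ∫ w : Conf d × Conf d × Conf d, fioIntegrand n ε κ S u Θx Θy φ x w

/-- A function of `(q, p)` as an `(x, y)`-independent symbol. -/
def lift {d : ℕ} (u : Phase d → ℂ) : Conf d → Conf d → Conf d → Conf d → ℂ :=
  fun _ _ q p => u (q, p)

/-! ### The operators `∂_z` and `div`, and the matrix `𝒵` -/

/-- `∂_{z_k} f`, the `k`-th component of `∂_z f = (Θy)⁻¹ ∂_q f - i ∂_p f`. -/
noncomputable def dz {d : ℕ} (Θy : Matrix (Fin d) (Fin d) ℂ) (k : Fin d) (f : Phase d → ℂ)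
    (z : Phase d) : ℂ :=
  ∑ j, Θy⁻¹ k j * fderiv ℝ f z (basisVec j, 0) - Complex.I * fderiv ℝ f z (0, basisVec k)

/-- `div V = ∑_j ∂_{z_j} V_j`. -/
noncomputable def zdiv {d : ℕ} (Θy : Matrix (Fin d) (Fin d) ℂ) (V : Phase d → Fin d → ℂ)
    (z : Phase d) : ℂ :=
  ∑ j, dz Θy j (fun z' => V z' j) z

/-- The matrix `G_z`, with entries `(G_z)_{jk} = ∂_{z_j} G_k`. -/
noncomputable def zgrad {d : ℕ} (Θy : Matrix (Fin d) (Fin d) ℂ) (G : Phase d → Fin d → ℂ)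
    (z : Phase d) : Matrix (Fin d) (Fin d) ℂ :=
  Matrix.of fun j k => dz Θy j (fun z' => G z' k) z

/-- The matrix `X^κ_z`. -/
noncomputable def Xz {d : ℕ} (Θy : Matrix (Fin d) (Fin d) ℂ) (κ : Phase d → Phase d) (z : Phase d) :
    Matrix (Fin d) (Fin d) ℂ :=
  zgrad Θy (fun z' => toC (κ z').1) z

/-- The matrix `𝒵 = Z^κ_z (Θx)^{1/2} = X^κ_z Θx + i Ξ^κ_z`, where
`Z^κ = (Θx)^{1/2} X^κ + i (Θx)^{-1/2} Ξ^κ`. -/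
noncomputable def Zmat {d : ℕ} (Θx Θy : Matrix (Fin d) (Fin d) ℂ) (κ : Phase d → Phase d)
    (z : Phase d) : Matrix (Fin d) (Fin d) ℂ :=
  Xz Θy κ z * Θx + Complex.I • zgrad Θy (fun z' => toC (κ z').2) z

/-! ### The symbols of the time derivative -/

/-- The entrywise time derivative `d/dt Θx(t)`. -/
noncomputable def dtMat {d : ℕ} (Θx : ℝ → Matrix (Fin d) (Fin d) ℂ) (t : ℝ) :
    Matrix (Fin d) (Fin d) ℂ :=
  Matrix.of fun i j => deriv (fun s => Θx s i j) t

/-- `d/dt X^{κ^t}(z)`. -/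
noncomputable def dtX {d : ℕ} (κ : ℝ → Phase d → Phase d) (t : ℝ) (z : Phase d) : Conf d :=
  deriv (fun s => (κ s z).1) t

/-- `d/dt Ξ^{κ^t}(z)`. -/
noncomputable def dtXi {d : ℕ} (κ : ℝ → Phase d → Phase d) (t : ℝ) (z : Phase d) : Conf d :=
  deriv (fun s => (κ s z).2) t

/-- `v₀ = u (- d/dt S + (d/dt X) · Ξ)`. -/
noncomputable def v0 {d : ℕ} (κ : ℝ → Phase d → Phase d) (S : ℝ → Phase d → ℝ)
    (u : ℝ → Phase d → ℂ) (t : ℝ) (z : Phase d) : ℂ :=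
  u t z * (-((deriv (fun s => S s z) t : ℝ) : ℂ) + toC (dtX κ t z) ⬝ᵥ toC (κ t z).2)

/-- `v₁ = i d/dt u + div ((d/dt Ξ - i Θx d/dt X)^† 𝒵⁻¹ u) - (i/2) u tr (𝒵⁻¹ X_z d/dt Θx)`. -/
noncomputable def v1 {d : ℕ} (κ : ℝ → Phase d → Phase d)
    (Θx : ℝ → Matrix (Fin d) (Fin d) ℂ) (Θy : Matrix (Fin d) (Fin d) ℂ)
    (u : ℝ → Phase d → ℂ) (t : ℝ) (z : Phase d) : ℂ :=
  Complex.I * deriv (fun s => u s z) t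
    + zdiv Θy (fun z' => u t z' •
        Matrix.vecMul (toC (dtXi κ t z') - Complex.I • (Θx t).mulVec (toC (dtX κ t z')))
          (Zmat (Θx t) Θy (κ t) z')⁻¹) z
    - Complex.I / 2 * u t z *
        ((Zmat (Θx t) Θy (κ t) z)⁻¹ * Xz Θy (κ t) z * dtMat Θx t).trace

/-- `v₂ = -(i/2) ∑_k div ((∂_{z_k} (d/dt Θx 𝒵⁻¹ e_k u))^† 𝒵⁻¹)`. -/
noncomputable def v2 {d : ℕ} (κ : ℝ → Phase d → Phase d)
    (Θx : ℝ → Matrix (Fin d) (Fin d) ℂ) (Θy : Matrix (Fin d) (Fin d) ℂ)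
    (u : ℝ → Phase d → ℂ) (t : ℝ) (z : Phase d) : ℂ :=
  -(Complex.I / 2) * ∑ k, zdiv Θy (fun z' =>
      Matrix.vecMul
        (fun l => dz Θy k
          (fun z'' => (dtMat Θx t * (Zmat (Θx t) Θy (κ t) z'')⁻¹) l k * u t z'') z')
        (Zmat (Θx t) Θy (κ t) z')⁻¹) z

end HermanKluk

/-! Separation of variables. No term of Φ involves both x and y, so e^{iΦ/ε} is the product of an
x-dependent factor K(x,z) (`kernel`) and a y-dependent Gaussian factor. Let W(z) be the y-integral
of the Gaussian factor against φ (`gaussTransform`). Since L_y^† only encodes an integration by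
parts against that factor, Fubini turns the operator into a constant times ∫ u W K dz for every
admissible n (`fio_lift_eq`). The powers of L_y^† serve absolute convergence alone: each gains a
factor (1+|∇_yΦ|²)^{-1/2}, and this square root dominates |p| up to powers of y-q, which the
Gaussian absorbs (`exists_gaussFactor_decay`). As the number of powers is arbitrary, W decays
rapidly. Hence symbols of polynomial growth are integrable against W K, and the integrals are
Schwartz functions of x (`KernelFamily.exists_schwartz`).

The integration by parts. The time derivative of the exponent of K is i/ε times S' - X'·Ξ + (Ξ' -
iΘx X')·(x-X) + (i/2)(x-X)·Θx'(x-X). The first two terms give v₀; the others still contain x, which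
has to be removed. In z, the equations for the action leave the differential -p·dq in the exponent
of K, while W contributes +p·dq together with multiples of dp_j + i(Θy dq)_j. The operator ∂_z is
chosen to annihilate the latter forms, and the p·dq terms cancel in the product. What remains is
∂_z(W K) = ε⁻¹ 𝒵(x-X) W K, so that a pairing a·(x-X) under the integral may be replaced by -ε
div(a^† 𝒵⁻¹) (`integral_dotProduct`). The linear term needs this once and gives the divergence in
v₁. The quadratic term needs it twice: in the first use ∂_z may hit the remaining x-X, which gives
the trace in v₁; otherwise a linear term is left, and the second use gives v₂ (`integral_dtSymbol`).

Invertibility of 𝒵. A real symplectic matrix preserves the sesquilinear extension of the symplectic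
form. A null vector of 𝒵 would make this form equal to a nonnegative quantity on one side and a
nonpositive one on the other, because Θx and Θy have positive real part (`isUnit_det_zmatOf`).
Compactness of bounded sets of symplectic matrices makes the determinant bounded below uniformly, so
𝒵⁻¹ is a symbol of order zero.

Symbol classes. Class 𝓑 bounds only F and its time derivative. Integration in z yields linear growth
for κ and its time derivative and quadratic growth for S and its time derivative
(`TimeFam.primitive`), whence the powers of ⟨(q,p)⟩ for v₀ and v₁. Equicontinuity has to be checked
for values only: with all derivatives bounded, interpolation passes it on to the derivatives
(`tendsto_iteratedFDeriv_zero`).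

Topology. The time derivative is first taken for each x, by dominated convergence. Seminorms of
difference quotients are bounded by the mean value inequality, and bounded, pointwise convergent
families in Schwartz space converge (`tendsto_schwartz_slope`). -/

namespace HermanKluk



/-! ### Algebra of uniformly bounded symbol families -/

section SymbolClasses

variable {ι κ : Type*} {D E F G H : Type}
  [NormedAddCommGroup D] [NormedSpace ℝ D]
  [NormedAddCommGroup E] [NormedSpace ℝ E] [NormedAddCommGroup F] [NormedSpace ℝ F]
  [NormedAddCommGroup G] [NormedSpace ℝ G] [NormedAddCommGroup H] [NormedSpace ℝ H]

/-- The derivatives of order `k` of the functions `a i` are bounded by multiples of `w`, uniformly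
in `i`. -/
def DerivBound (k : ℕ) (w : E → ℝ) (a : ι → E → F) : Prop :=
  ∃ C : ℝ, 0 ≤ C ∧ ∀ i z, ‖iteratedFDeriv ℝ k (a i) z‖ ≤ C * w z

/-- A uniformly bounded family of symbols with order function `w`. -/
structure SymbFam (w : E → ℝ) (a : ι → E → F) : Prop where
  smooth : ∀ i, ContDiff ℝ ∞ (a i)
  bounded : ∀ k : ℕ, DerivBound k w a

/-- The Leibniz rule. The hypotheses stop at order `k`, because the strong induction in
`SymbFam.inv` has bounds for lower orders only. -/
theorem DerivBound.bilin {k : ℕ} {w₁ w₂ : E → ℝ} {a : ι → E → F} {b : ι → E → G}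
    (B : F →L[ℝ] G →L[ℝ] H) (ha : ∀ i, ContDiff ℝ ∞ (a i)) (hb : ∀ i, ContDiff ℝ ∞ (b i))
    (hab : ∀ j ≤ k, DerivBound j w₁ a) (hbb : ∀ j ≤ k, DerivBound j w₂ b)
    (hw₁ : ∀ z, 0 ≤ w₁ z) :
    DerivBound k (fun z => w₁ z * w₂ z) (fun i z => B (a i z) (b i z)) := by
  -- The constants are extended by zero beyond `k`, so that they can be chosen for all orders at
  -- once.
  have ha' : ∀ j : ℕ, ∃ C : ℝ, 0 ≤ C ∧
      (j ≤ k → ∀ i z, ‖iteratedFDeriv ℝ j (a i) z‖ ≤ C * w₁ z) := by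
    intro j
    by_cases hj : j ≤ k
    · obtain ⟨C, h0, h⟩ := hab j hj
      exact ⟨C, h0, fun _ => h⟩
    · exact ⟨0, le_rfl, fun h => absurd h hj⟩
  have hb' : ∀ j : ℕ, ∃ C : ℝ, 0 ≤ C ∧
      (j ≤ k → ∀ i z, ‖iteratedFDeriv ℝ j (b i) z‖ ≤ C * w₂ z) := by
    intro j
    by_cases hj : j ≤ k
    · obtain ⟨C, h0, h⟩ := hbb j hj
      exact ⟨C, h0, fun _ => h⟩
    · exact ⟨0, le_rfl, fun h => absurd h hj⟩
  choose C hC0 hC using ha'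
  choose C' hC0' hC' using hb'
  refine ⟨‖B‖ * ∑ j ∈ Finset.range (k + 1), (k.choose j : ℝ) * C j * C' (k - j),
    mul_nonneg (norm_nonneg B) (Finset.sum_nonneg fun j _ =>
      mul_nonneg (mul_nonneg (Nat.cast_nonneg _) (hC0 _)) (hC0' _)), fun i z => ?_⟩
  refine (B.norm_iteratedFDeriv_le_of_bilinear (ha i) (hb i) z (n := k)
    (by exact_mod_cast le_top)).trans ?_
  rw [mul_assoc, Finset.sum_mul]
  refine mul_le_mul_of_nonneg_left (Finset.sum_le_sum fun j hj => ?_) (norm_nonneg B)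
  have hjk : j ≤ k := Nat.lt_succ_iff.1 (Finset.mem_range.1 hj)
  have h1 := hC j hjk i z
  have h2 := hC' (k - j) (Nat.sub_le _ _) i z
  calc (k.choose j : ℝ) * ‖iteratedFDeriv ℝ j (a i) z‖ * ‖iteratedFDeriv ℝ (k - j) (b i) z‖
      ≤ (k.choose j : ℝ) * (C j * w₁ z) * (C' (k - j) * w₂ z) := by
        refine mul_le_mul (mul_le_mul_of_nonneg_left h1 (Nat.cast_nonneg _)) h2 (norm_nonneg _) ?_
        exact mul_nonneg (Nat.cast_nonneg _) (mul_nonneg (hC0 _) (hw₁ z))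
    _ = _ := by ring

namespace SymbFam

variable {w w₁ w₂ : E → ℝ} {a b : ι → E → F}

theorem differentiable (h : SymbFam w a) (i : ι) : Differentiable ℝ (a i) :=
  (h.smooth i).differentiable (by simp)

theorem mono (h : SymbFam w₁ a) (c : ℝ) (hc : 0 ≤ c) (hw : ∀ z, w₁ z ≤ c * w₂ z) :
    SymbFam w₂ a := by
  refine ⟨h.smooth, fun k => ?_⟩
  obtain ⟨C, hC, hb⟩ := h.bounded k
  refine ⟨C * c, by positivity, fun i z => (hb i z).trans ?_⟩
  rw [mul_assoc]
  exact mul_le_mul_of_nonneg_left (hw z) hC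

theorem const (c : ι → F) {M : ℝ} (hM : ∀ i, ‖c i‖ ≤ M) (hw : ∀ z, 1 ≤ w z) :
    SymbFam w (fun i (_ : E) => c i) := by
  refine ⟨fun i => contDiff_const, fun k => ?_⟩
  rcases Nat.eq_zero_or_pos k with rfl | hk
  · refine ⟨max M 0, le_max_right _ _, fun i z => ?_⟩
    rw [norm_iteratedFDeriv_zero]
    exact ((hM i).trans (le_max_left _ _)).trans (le_mul_of_one_le_right (le_max_right _ _) (hw z))
  · refine ⟨0, le_rfl, fun i z => ?_⟩
    rw [iteratedFDeriv_const_of_ne hk.ne']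
    simp

theorem zero (hw : ∀ z, 0 ≤ w z) : SymbFam w (fun (_ : ι) (_ : E) => (0 : F)) := by
  refine ⟨fun i => contDiff_const, fun k => ⟨1, zero_le_one, fun i z => ?_⟩⟩
  have : iteratedFDeriv ℝ k (fun _ : E => (0 : F)) = 0 := iteratedFDeriv_fun_zero
  rw [this]
  simpa using hw z

theorem add (ha : SymbFam w a) (hb : SymbFam w b) : SymbFam w (fun i z => a i z + b i z) := by
  refine ⟨fun i => (ha.smooth i).add (hb.smooth i), fun k => ?_⟩
  obtain ⟨C, hC, h1⟩ := ha.bounded k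
  obtain ⟨C', hC', h2⟩ := hb.bounded k
  refine ⟨C + C', add_nonneg hC hC', fun i z => ?_⟩
  have := iteratedFDeriv_add_apply (x := z) (i := k)
    ((ha.smooth i).of_le (by exact_mod_cast le_top)).contDiffAt
    ((hb.smooth i).of_le (by exact_mod_cast le_top)).contDiffAt
  change ‖iteratedFDeriv ℝ k (a i + b i) z‖ ≤ _
  rw [this, add_mul]
  exact (norm_add_le _ _).trans (add_le_add (h1 i z) (h2 i z))

theorem clm (ha : SymbFam w a) (L : F →L[ℝ] G) : SymbFam w (fun i z => L (a i z)) := by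
  refine ⟨fun i => L.contDiff.comp (ha.smooth i), fun k => ?_⟩
  obtain ⟨C, hC, h1⟩ := ha.bounded k
  refine ⟨‖L‖ * C, by positivity, fun i z => ?_⟩
  refine (L.norm_iteratedFDeriv_comp_left (ha.smooth i).contDiffAt (n := k)
    (by exact_mod_cast le_top)).trans ?_
  rw [mul_assoc]
  exact mul_le_mul_of_nonneg_left (h1 i z) (norm_nonneg _)

theorem sum {s : Finset κ} {a : κ → ι → E → F} (hw : ∀ z, 0 ≤ w z)
    (ha : ∀ j ∈ s, SymbFam w (a j)) : SymbFam w (fun i z => ∑ j ∈ s, a j i z) := by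
  classical
  induction s using Finset.induction_on with
  | empty => simpa using zero hw
  | insert j s hj ih =>
    simp only [Finset.sum_insert hj]
    exact (ha j (Finset.mem_insert_self _ _)).add
      (ih fun k hk => ha k (Finset.mem_insert_of_mem hk))

theorem bilin {b : ι → E → G} (B : F →L[ℝ] G →L[ℝ] H) (ha : SymbFam w₁ a) (hb : SymbFam w₂ b)
    (hw₁ : ∀ z, 0 ≤ w₁ z) :
    SymbFam (fun z => w₁ z * w₂ z) (fun i z => B (a i z) (b i z)) :=
  ⟨fun i => B.isBoundedBilinearMap.contDiff.comp₂ (ha.smooth i) (hb.smooth i), fun _ =>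
    DerivBound.bilin B ha.smooth hb.smooth (fun _ _ => ha.bounded _) (fun _ _ => hb.bounded _) hw₁⟩

theorem fderiv (ha : SymbFam w a) : SymbFam w (fun i => fderiv ℝ (a i)) := by
  refine ⟨fun i => (ha.smooth i).fderiv_right (by simp), fun k => ?_⟩
  obtain ⟨C, hC, h1⟩ := ha.bounded (k + 1)
  refine ⟨C, hC, fun i z => ?_⟩
  rw [norm_iteratedFDeriv_fderiv]
  exact h1 i z

theorem of_fderiv (hd : ∀ i, Differentiable ℝ (a i)) {C : ℝ} (hC : 0 ≤ C)
    (h0 : ∀ i z, ‖a i z‖ ≤ C * w z) (h1 : SymbFam w (fun i => _root_.fderiv ℝ (a i))) :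
    SymbFam w a := by
  refine ⟨fun i => ?_, fun k => ?_⟩
  · exact contDiff_infty_iff_fderiv.2 ⟨hd i, h1.smooth i⟩
  · cases k with
    | zero => exact ⟨C, hC, fun i z => by rw [norm_iteratedFDeriv_zero]; exact h0 i z⟩
    | succ k =>
      obtain ⟨C, hC, h⟩ := h1.bounded k
      refine ⟨C, hC, fun i z => ?_⟩
      rw [← norm_iteratedFDeriv_fderiv]
      exact h i z

theorem norm_le (ha : SymbFam w a) : ∃ C : ℝ, 0 ≤ C ∧ ∀ i z, ‖a i z‖ ≤ C * w z := by
  obtain ⟨C, hC, h⟩ := ha.bounded 0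
  exact ⟨C, hC, fun i z => by simpa using h i z⟩

theorem comp_clm (ha : SymbFam w a) (L : D →L[ℝ] E) :
    SymbFam (fun z => w (L z)) (fun i z => a i (L z)) := by
  refine ⟨fun i => (ha.smooth i).comp L.contDiff, fun k => ?_⟩
  obtain ⟨C, hC, h1⟩ := ha.bounded k
  refine ⟨C * ‖L‖ ^ k, by positivity, fun i z => ?_⟩
  have := L.iteratedFDeriv_comp_right (ha.smooth i) z (i := k) (by exact_mod_cast le_top)
  change ‖iteratedFDeriv ℝ k (a i ∘ L) z‖ ≤ _
  rw [this]
  refine (ContinuousMultilinearMap.norm_compContinuousLinearMap_le _ _).trans ?_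
  simp only [Finset.prod_const, Finset.card_univ, Fintype.card_fin]
  calc _ ≤ C * w (L z) * ‖L‖ ^ k := mul_le_mul_of_nonneg_right (h1 i _) (by positivity)
    _ = _ := by ring

theorem mul {a b : ι → E → ℂ} (ha : SymbFam w₁ a) (hb : SymbFam w₂ b) (hw₁ : ∀ z, 0 ≤ w₁ z) :
    SymbFam (fun z => w₁ z * w₂ z) (fun i z => a i z * b i z) :=
  ha.bilin (ContinuousLinearMap.mul ℝ ℂ) hb hw₁

/-- The differential of 1/a is -(1/a)² da, of weight w⁻² w = w⁻¹. Its derivatives of order `k`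
involve those of 1/a up to order `k` only, so strong induction applies. -/
theorem inv {a : ι → E → ℂ} (ha : SymbFam w a) (hw : ∀ z, 0 < w z) {c : ℝ} (hc : 0 < c)
    (hac : ∀ i z, c * w z ≤ ‖a i z‖) : SymbFam (fun z => (w z)⁻¹) (fun i z => (a i z)⁻¹) := by
  have hne : ∀ i z, a i z ≠ 0 := fun i z h => by
    have := hac i z
    rw [h, norm_zero] at this
    exact absurd this (not_le.2 (mul_pos hc (hw z)))
  have hs : ∀ i, ContDiff ℝ ∞ (fun z => (a i z)⁻¹) := fun i => (ha.smooth i).inv (hne i)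
  have hw' : ∀ z, 0 ≤ (w z)⁻¹ := fun z => (inv_pos.2 (hw z)).le
  refine ⟨hs, fun k => ?_⟩
  induction k using Nat.strong_induction_on with
  | _ k ih =>
    cases k with
    | zero =>
      refine ⟨c⁻¹, (inv_pos.2 hc).le, fun i z => ?_⟩
      rw [norm_iteratedFDeriv_zero, norm_inv, ← mul_inv]
      exact inv_anti₀ (mul_pos hc (hw z)) (hac i z)
    | succ k =>
      have hsq : ∀ j ≤ k, DerivBound j (fun z => (w z)⁻¹ * (w z)⁻¹)
          (fun i z => (a i z)⁻¹ * (a i z)⁻¹) := fun j hj =>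
        DerivBound.bilin (ContinuousLinearMap.mul ℝ ℂ) hs hs (fun l hl => ih l (by omega))
          (fun l hl => ih l (by omega)) hw'
      have key := DerivBound.bilin (k := k) (ContinuousLinearMap.lsmul ℝ ℂ)
        (fun i => (hs i).mul (hs i)) ha.fderiv.smooth hsq (fun l hl => ha.fderiv.bounded l)
        (fun z => mul_nonneg (hw' z) (hw' z))
      obtain ⟨C, hC, hb⟩ := key
      refine ⟨C, hC, fun i z => ?_⟩
      have hfd : _root_.fderiv ℝ (fun z => (a i z)⁻¹) =
          -(fun z => ContinuousLinearMap.lsmul ℝ ℂ ((a i z)⁻¹ * (a i z)⁻¹)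
            (_root_.fderiv ℝ (a i) z)) := by
        funext z
        have h1 := HasFDerivAt.comp z (hasFDerivAt_inv' (𝕜 := ℝ) (hne i z))
          (ha.differentiable i z).hasFDerivAt
        have h2 := h1.fderiv
        change _root_.fderiv ℝ (fun z => (a i z)⁻¹) z = _ at h2
        rw [h2]
        ext v
        simp
        ring
      rw [← norm_iteratedFDeriv_fderiv, hfd, iteratedFDeriv_neg_apply, norm_neg]
      refine (hb i z).trans_eq ?_
      have := (hw z).ne'
      field_simp

end SymbFam

end SymbolClasses

/-! ### Interpolation: from convergence of values to convergence of derivatives -/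

section Interpolation

variable {H : Type*} {E F : Type} [NormedAddCommGroup E] [NormedSpace ℝ E]
  [NormedAddCommGroup F] [NormedSpace ℝ F]

/-- Pointwise bounds on the second derivative control the first-order Taylor remainder. -/
theorem norm_taylor_le {f : E → F} {z v : E} {C : ℝ} (hf : ContDiff ℝ 2 f)
    (hC : ∀ z' ∈ Metric.ball z 1, ‖iteratedFDeriv ℝ 2 f z'‖ ≤ C) (hv : ‖v‖ < 1) :
    ‖f (z + v) - f z - fderiv ℝ f z v‖ ≤ C * ‖v‖ * ‖v‖ := by
  have hC0 : 0 ≤ C := (norm_nonneg _).trans (hC z (Metric.mem_ball_self one_pos))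
  have hd : Differentiable ℝ (fderiv ℝ f) :=
    (hf.fderiv_right (m := 1) (by norm_num)).differentiable (by norm_num)
  have h1 : ∀ x ∈ Metric.ball z 1, ‖fderiv ℝ f x - fderiv ℝ f z‖ ≤ C * ‖x - z‖ := by
    intro x hx
    refine (convex_ball z 1).norm_image_sub_le_of_norm_fderiv_le (𝕜 := ℝ) (fun y _ => hd y)
      (fun y hy => ?_) (Metric.mem_ball_self one_pos) hx
    have := hC y hy
    rwa [show (2 : ℕ) = 1 + 1 from rfl, ← norm_iteratedFDeriv_fderiv,
      show (1 : ℕ) = 0 + 1 from rfl, ← norm_iteratedFDeriv_fderiv, norm_iteratedFDeriv_zero] at this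
  have h2 := (convex_closedBall z ‖v‖).norm_image_sub_le_of_norm_fderiv_le' (𝕜 := ℝ) (f := f)
    (φ := fderiv ℝ f z) (C := C * ‖v‖) (x := z) (y := z + v)
    (fun y _ => hf.differentiable (by norm_num) y)
    (fun y hy => by
      have hy' : ‖y - z‖ ≤ ‖v‖ := by simpa [dist_eq_norm] using hy
      refine (h1 y ?_).trans (mul_le_mul_of_nonneg_left hy' hC0)
      rw [Metric.mem_ball, dist_eq_norm]
      exact hy'.trans_lt hv)
    (Metric.mem_closedBall_self (norm_nonneg _)) (by simp)
  simpa using h2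

/-- A linear map on a finite-dimensional space is small if it is small on each vector. -/
theorem tendsto_clm_zero [FiniteDimensional ℝ E] {l : Filter H} {L : H → E →L[ℝ] F}
    (h : ∀ v, Tendsto (fun η => L η v) l (𝓝 0)) : Tendsto L l (𝓝 0) := by
  let b := Module.finBasis ℝ E
  obtain ⟨C, hC, hb⟩ := b.exists_opNorm_le (F := F)
  have hs : Tendsto (fun η => C * ∑ i, ‖L η (b i)‖) l (𝓝 0) := by
    have : Tendsto (fun η => C * ∑ i, ‖L η (b i)‖) l
        (𝓝 (C * ∑ i : Fin (Module.finrank ℝ E), (0 : ℝ))) :=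
      tendsto_const_nhds.mul (tendsto_finsetSum _ fun i _ => by simpa using (h (b i)).norm)
    simpa using this
  refine squeeze_zero_norm (fun η => ?_) hs
  exact hb (Finset.sum_nonneg fun i _ => norm_nonneg _) fun i =>
    Finset.single_le_sum (f := fun i => ‖L η (b i)‖) (fun i _ => norm_nonneg _) (Finset.mem_univ i)

/-- Pointwise convergence to zero passes to the first derivative if the second derivatives are
bounded. -/
theorem tendsto_fderiv_zero [FiniteDimensional ℝ E] {l : Filter H} {f : H → E → F} {z : E} {C : ℝ}
    (hf : ∀ᶠ η in l, ContDiff ℝ 2 (f η))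
    (hC : ∀ᶠ η in l, ∀ z' ∈ Metric.ball z 1, ‖iteratedFDeriv ℝ 2 (f η) z'‖ ≤ C)
    (h0 : ∀ z', Tendsto (fun η => f η z') l (𝓝 0)) :
    Tendsto (fun η => fderiv ℝ (f η) z) l (𝓝 0) := by
  refine tendsto_clm_zero fun v => ?_
  rw [Metric.tendsto_nhds]
  intro δ hδ
  -- By Taylor's formula s·f'(z)v is a difference of two values of f up to C s²‖v‖². The step `s` is
  -- fixed first, to make C s‖v‖² < δ/2; the two values then become smaller than sδ/4 each, and
  -- division by `s` gives δ.
  obtain ⟨s, hs0, hs1, hs2⟩ : ∃ s : ℝ, 0 < s ∧ ‖s • v‖ < 1 ∧ C * (s * ‖v‖ * ‖v‖) < δ / 2 := by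
    have c1 : Tendsto (fun s : ℝ => ‖s • v‖) (𝓝[>] 0) (𝓝 0) := by
      have : Continuous fun s : ℝ => ‖s • v‖ := by fun_prop
      simpa using (this.tendsto 0).mono_left nhdsWithin_le_nhds
    have c2 : Tendsto (fun s : ℝ => C * (s * ‖v‖ * ‖v‖)) (𝓝[>] 0) (𝓝 0) := by
      have : Continuous fun s : ℝ => C * (s * ‖v‖ * ‖v‖) := by fun_prop
      simpa using (this.tendsto 0).mono_left nhdsWithin_le_nhds
    have hpos : ∀ᶠ s : ℝ in 𝓝[>] 0, 0 < s := self_mem_nhdsWithin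
    obtain ⟨s, h1, h2, h3⟩ := (hpos.and ((c1.eventually (gt_mem_nhds one_pos)).and
      (c2.eventually (gt_mem_nhds (half_pos hδ))))).exists
    exact ⟨s, h1, h2, h3⟩
  have e1 := Metric.tendsto_nhds.1 (h0 (z + s • v)) (s * δ / 4) (by positivity)
  have e2 := Metric.tendsto_nhds.1 (h0 z) (s * δ / 4) (by positivity)
  filter_upwards [hf, hC, e1, e2] with η h1 h2 h3 h4
  rw [dist_zero_right] at h3 h4 ⊢
  have h5 := norm_taylor_le h1 h2 hs1
  rw [map_smul, norm_smul, Real.norm_of_nonneg hs0.le] at h5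
  have h6 : s * ‖fderiv ℝ (f η) z v‖ ≤ ‖f η (z + s • v)‖ + ‖f η z‖
      + ‖f η (z + s • v) - f η z - s • fderiv ℝ (f η) z v‖ := by
    rw [← Real.norm_of_nonneg hs0.le, ← norm_smul, Real.norm_of_nonneg hs0.le]
    calc ‖s • fderiv ℝ (f η) z v‖ = ‖f η (z + s • v) - f η z
          - (f η (z + s • v) - f η z - s • fderiv ℝ (f η) z v)‖ := by congr 1; abel
      _ ≤ _ := (norm_sub_le _ _).trans (by gcongr; exact norm_sub_le _ _)
  have h7 : s * ‖fderiv ℝ (f η) z v‖ < s * δ := by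
    have := mul_lt_mul_of_pos_left hs2 hs0
    nlinarith
  exact lt_of_mul_lt_mul_left h7 hs0.le

/-- Pointwise convergence to zero passes to all derivatives if the derivatives of each order are
locally bounded. -/
theorem tendsto_iteratedFDeriv_zero [FiniteDimensional ℝ E] {l : Filter H} (k : ℕ) :
    ∀ {F : Type} [NormedAddCommGroup F] [NormedSpace ℝ F] {f : H → E → F},
    (∀ᶠ η in l, ContDiff ℝ ∞ (f η)) →
    (∀ (k : ℕ) (z : E), ∃ C : ℝ, ∀ᶠ η in l, ∀ z' ∈ Metric.ball z 1,
      ‖iteratedFDeriv ℝ k (f η) z'‖ ≤ C) →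
    (∀ z, Tendsto (fun η => f η z) l (𝓝 0)) →
    ∀ z, Tendsto (fun η => iteratedFDeriv ℝ k (f η) z) l (𝓝 0) := by
  -- The codomain is quantified inside the statement, since the induction step passes from f to its
  -- differential, with values in `E →L[ℝ] F`.
  induction k with
  | zero =>
    intro F _ _ f hf hC h0 z
    rw [tendsto_zero_iff_norm_tendsto_zero]
    simpa using (h0 z).norm
  | succ k ih =>
    intro F _ _ f hf hC h0 z
    rw [tendsto_zero_iff_norm_tendsto_zero]
    simp only [← norm_iteratedFDeriv_fderiv]
    rw [← tendsto_zero_iff_norm_tendsto_zero]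
    refine ih (f := fun η => fderiv ℝ (f η)) ?_ ?_ ?_ z
    · filter_upwards [hf] with η h
      exact h.fderiv_right (by simp)
    · intro k z
      simp only [norm_iteratedFDeriv_fderiv]
      exact hC (k + 1) z
    · intro z
      obtain ⟨C, hC⟩ := hC 2 z
      exact tendsto_fderiv_zero (hf.mono fun η h => contDiff_infty.1 h 2) hC h0

end Interpolation

/-! ### Time-dependent symbol families, uniformly in ε -/

section TimeFamilies

variable {E F G H : Type}
  [NormedAddCommGroup E] [NormedSpace ℝ E] [NormedAddCommGroup F] [NormedSpace ℝ F]
  [NormedAddCommGroup G] [NormedSpace ℝ G] [NormedAddCommGroup H] [NormedSpace ℝ H]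

/-- A time-dependent symbol family, `ε` ranging over `(0, ε₀]`: the symbol estimates hold uniformly
in `ε` and locally uniformly in time, and the values at each point are continuous in time,
equicontinuously in `ε`. -/
structure TimeFam (ε₀ : ℝ) (w : E → ℝ) (u : ℝ → ℝ → E → F) : Prop where
  weight_cont : Continuous w
  weight_pos : ∀ z, 0 < w z
  symb : ∀ T : ℝ, SymbFam w (fun i : Set.Ioc 0 ε₀ × Set.Icc (-T) T => u i.1 i.2)
  time : ∀ z t₀, Tendsto (fun p : ℝ × Set.Ioc 0 ε₀ => u p.2 p.1 z - u p.2 t₀ z) (𝓝 t₀ ×ˢ ⊤) (𝓝 0)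

theorem eventually_mem_Icc (t₀ : ℝ) : ∀ᶠ t in 𝓝 t₀, t ∈ Set.Icc (-(|t₀| + 1)) (|t₀| + 1) := by
  refine Icc_mem_nhds ?_ ?_
  · linarith [neg_abs_le t₀]
  · linarith [le_abs_self t₀]

theorem mem_Icc_abs (t₀ : ℝ) : t₀ ∈ Set.Icc (-(|t₀| + 1)) (|t₀| + 1) :=
  mem_of_mem_nhds (eventually_mem_Icc t₀)

namespace TimeFam

variable {ε₀ : ℝ} {w w₁ w₂ : E → ℝ} {u : ℝ → ℝ → E → F}

theorem smooth (h : TimeFam ε₀ w u) (ε : Set.Ioc 0 ε₀) (t : ℝ) : ContDiff ℝ ∞ (u ε t) :=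
  (h.symb (|t| + 1)).smooth (ε, ⟨t, mem_Icc_abs t⟩)

theorem differentiable (h : TimeFam ε₀ w u) (ε : Set.Ioc 0 ε₀) (t : ℝ) :
    Differentiable ℝ (u ε t) :=
  (h.smooth ε t).differentiable (by simp)

theorem norm_le (h : TimeFam ε₀ w u) (T : ℝ) : ∃ C : ℝ, 0 ≤ C ∧ ∀ (ε : Set.Ioc 0 ε₀),
    ∀ t ∈ Set.Icc (-T) T, ∀ z, ‖u ε t z‖ ≤ C * w z := by
  obtain ⟨C, hC, hb⟩ := (h.symb T).norm_le
  exact ⟨C, hC, fun ε t ht z => hb (ε, ⟨t, ht⟩) z⟩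

theorem mono (h : TimeFam ε₀ w₁ u) (hw₂ : Continuous w₂) (hpos : ∀ z, 0 < w₂ z) (c : ℝ)
    (hc : 0 ≤ c) (hw : ∀ z, w₁ z ≤ c * w₂ z) : TimeFam ε₀ w₂ u :=
  ⟨hw₂, hpos, fun T => (h.symb T).mono c hc hw, h.time⟩

theorem congr_weight (h : TimeFam ε₀ w₁ u) (hw : ∀ z, w₁ z = w₂ z) : TimeFam ε₀ w₂ u := by
  rwa [← funext hw]

theorem eventually_norm_le (h : TimeFam ε₀ w u) (z : E) (t₀ : ℝ) : ∃ C : ℝ,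
    ∀ᶠ p : ℝ × Set.Ioc 0 ε₀ in 𝓝 t₀ ×ˢ ⊤, ‖u p.2 p.1 z‖ ≤ C ∧ ‖u p.2 t₀ z‖ ≤ C := by
  obtain ⟨C, -, hb⟩ := h.norm_le (|t₀| + 1)
  refine ⟨C * w z, ?_⟩
  filter_upwards [tendsto_fst.eventually (eventually_mem_Icc t₀)] with p hp
  exact ⟨hb _ _ hp _, hb _ _ (mem_Icc_abs t₀) _⟩

/-- Families that do not depend on `ε`. -/
theorem of_indep {a : ℝ → E → F} (hw : Continuous w) (hpos : ∀ z, 0 < w z)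
    (hs : ∀ t, ContDiff ℝ ∞ (a t))
    (hb : ∀ (k : ℕ) (T : ℝ), ∃ C : ℝ, ∀ t ∈ Set.Icc (-T) T, ∀ z,
      ‖iteratedFDeriv ℝ k (a t) z‖ ≤ C * w z)
    (hc : ∀ z, Continuous fun t => a t z) : TimeFam ε₀ w (fun _ => a) := by
  refine ⟨hw, hpos, fun T => ⟨fun i => hs _, fun k => ?_⟩, fun z t₀ => ?_⟩
  · obtain ⟨C, hC⟩ := hb k T
    refine ⟨max C 0, le_max_right _ _, fun i z => (hC _ i.2.2 z).trans ?_⟩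
    exact mul_le_mul_of_nonneg_right (le_max_left _ _) (hpos z).le
  · have : Tendsto (fun t => a t z - a t₀ z) (𝓝 t₀) (𝓝 0) := by
      have h : Tendsto (fun t => a t z - a t₀ z) (𝓝 t₀) (𝓝 (a t₀ z - a t₀ z)) :=
        ((hc z).sub continuous_const).tendsto t₀
      rwa [sub_self] at h
    exact this.comp tendsto_fst

/-- Functions of time only. -/
theorem const {c : ℝ → F} (hc : Continuous c) :
    TimeFam ε₀ (fun _ : E => 1) (fun _ t _ => c t) := by
  refine of_indep continuous_const (fun _ => one_pos) (fun t => contDiff_const) (fun k T => ?_)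
    fun z => hc
  obtain ⟨C, hC⟩ := isCompact_Icc.exists_bound_of_continuousOn (s := Set.Icc (-T) T) hc.continuousOn
  obtain ⟨C', -, h⟩ := (SymbFam.const (E := E) (w := fun _ => 1)
    (fun t : Set.Icc (-T) T => c t) (fun i => hC i i.2) (fun _ => le_rfl)).bounded k
  exact ⟨C', fun t ht z => h ⟨t, ht⟩ z⟩

theorem add {u' : ℝ → ℝ → E → F} (h : TimeFam ε₀ w u) (h' : TimeFam ε₀ w u') :
    TimeFam ε₀ w (fun ε t z => u ε t z + u' ε t z) := by
  refine ⟨h.weight_cont, h.weight_pos, fun T => (h.symb T).add (h'.symb T), fun z t₀ => ?_⟩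
  have := (h.time z t₀).add (h'.time z t₀)
  rw [add_zero] at this
  refine this.congr fun p => ?_
  abel

theorem clm (h : TimeFam ε₀ w u) (L : F →L[ℝ] G) : TimeFam ε₀ w (fun ε t z => L (u ε t z)) := by
  refine ⟨h.weight_cont, h.weight_pos, fun T => (h.symb T).clm L, fun z t₀ => ?_⟩
  have := (L.continuous.tendsto 0).comp (h.time z t₀)
  rw [map_zero] at this
  refine this.congr fun p => ?_
  simp

theorem sum {κ : Type*} {s : Finset κ} {u : κ → ℝ → ℝ → E → F} (hw : Continuous w)
    (hpos : ∀ z, 0 < w z) (h : ∀ j ∈ s, TimeFam ε₀ w (u j)) :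
    TimeFam ε₀ w (fun ε t z => ∑ j ∈ s, u j ε t z) := by
  refine ⟨hw, hpos, fun T => SymbFam.sum (fun z => (hpos z).le) fun j hj => (h j hj).symb T,
    fun z t₀ => ?_⟩
  have := tendsto_finsetSum s fun j hj => (h j hj).time z t₀
  simpa using this

theorem bilin {b : ℝ → ℝ → E → G} (B : F →L[ℝ] G →L[ℝ] H) (ha : TimeFam ε₀ w₁ u)
    (hb : TimeFam ε₀ w₂ b) :
    TimeFam ε₀ (fun z => w₁ z * w₂ z) (fun ε t z => B (u ε t z) (b ε t z)) := by
  refine ⟨ha.weight_cont.mul hb.weight_cont, fun z => mul_pos (ha.weight_pos z) (hb.weight_pos z),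
    fun T => (ha.symb T).bilin B (hb.symb T) fun z => (ha.weight_pos z).le, fun z t₀ => ?_⟩
  obtain ⟨C, hC⟩ := ha.eventually_norm_le z t₀
  obtain ⟨C', hC'⟩ := hb.eventually_norm_le z t₀
  have hlim := ((ha.time z t₀).norm.mul_const (‖B‖ * C')).add
    ((hb.time z t₀).norm.mul_const (‖B‖ * C))
  rw [norm_zero, norm_zero, zero_mul, zero_mul, add_zero] at hlim
  refine squeeze_zero_norm' ?_ hlim
  filter_upwards [hC, hC'] with p h1 h2
  have heq : B (u p.2 p.1 z) (b p.2 p.1 z) - B (u p.2 t₀ z) (b p.2 t₀ z) =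
      B (u p.2 p.1 z - u p.2 t₀ z) (b p.2 p.1 z) + B (u p.2 t₀ z) (b p.2 p.1 z - b p.2 t₀ z) := by
    simp
  rw [heq]
  refine (norm_add_le _ _).trans (add_le_add ?_ ?_)
  · refine (B.le_opNorm₂ _ _).trans ?_
    calc ‖B‖ * ‖u p.2 p.1 z - u p.2 t₀ z‖ * ‖b p.2 p.1 z‖
        ≤ ‖B‖ * ‖u p.2 p.1 z - u p.2 t₀ z‖ * C' := by gcongr; exact h2.1
      _ = _ := by ring
  · refine (B.le_opNorm₂ _ _).trans ?_
    calc ‖B‖ * ‖u p.2 t₀ z‖ * ‖b p.2 p.1 z - b p.2 t₀ z‖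
        ≤ ‖B‖ * C * ‖b p.2 p.1 z - b p.2 t₀ z‖ := by gcongr; exact h1.2
      _ = _ := by ring

theorem mul {a b : ℝ → ℝ → E → ℂ} (ha : TimeFam ε₀ w₁ a) (hb : TimeFam ε₀ w₂ b) :
    TimeFam ε₀ (fun z => w₁ z * w₂ z) (fun ε t z => a ε t z * b ε t z) :=
  ha.bilin (ContinuousLinearMap.mul ℝ ℂ) hb

theorem inv {a : ℝ → ℝ → E → ℂ} (ha : TimeFam ε₀ w a)
    (hac : ∀ T : ℝ, ∃ c : ℝ, 0 < c ∧ ∀ (ε : Set.Ioc 0 ε₀), ∀ t ∈ Set.Icc (-T) T, ∀ z,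
      c * w z ≤ ‖a ε t z‖) :
    TimeFam ε₀ (fun z => (w z)⁻¹) (fun ε t z => (a ε t z)⁻¹) := by
  refine ⟨ha.weight_cont.inv₀ fun z => (ha.weight_pos z).ne', fun z => inv_pos.2 (ha.weight_pos z),
    fun T => ?_, fun z t₀ => ?_⟩
  · obtain ⟨c, hc, h⟩ := hac T
    exact (ha.symb T).inv ha.weight_pos hc fun i z => h _ _ i.2.2 z
  · obtain ⟨c, hc, h⟩ := hac (|t₀| + 1)
    have hcw : 0 < c * w z := mul_pos hc (ha.weight_pos z)
    have hlim := (ha.time z t₀).norm.mul_const ((c * w z)⁻¹ * (c * w z)⁻¹)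
    rw [norm_zero, zero_mul] at hlim
    refine squeeze_zero_norm' ?_ hlim
    filter_upwards [tendsto_fst.eventually (eventually_mem_Icc t₀)] with p hp
    have h1 := h p.2 p.1 hp z
    have h2 := h p.2 t₀ (mem_Icc_abs t₀) z
    have n1 : a p.2 p.1 z ≠ 0 := norm_pos_iff.1 (hcw.trans_le h1)
    have n2 : a p.2 t₀ z ≠ 0 := norm_pos_iff.1 (hcw.trans_le h2)
    rw [inv_sub_inv n1 n2, norm_div, norm_mul, norm_sub_rev, div_eq_mul_inv, mul_inv]
    gcongr

/-- The symbol estimates bound every derivative of the difference on unit balls, so interpolation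
applies. The factor `⊤` of the filter makes the limit uniform in ε. -/
theorem tendsto_iteratedFDeriv_sub [FiniteDimensional ℝ E] (h : TimeFam ε₀ w u) (k : ℕ) (z : E)
    (t₀ : ℝ) : Tendsto (fun p : ℝ × Set.Ioc 0 ε₀ =>
      iteratedFDeriv ℝ k (fun z => u p.2 p.1 z - u p.2 t₀ z) z) (𝓝 t₀ ×ˢ ⊤) (𝓝 0) := by
  refine tendsto_iteratedFDeriv_zero (l := 𝓝 t₀ ×ˢ (⊤ : Filter (Set.Ioc 0 ε₀))) k
    (f := fun p z => u p.2 p.1 z - u p.2 t₀ z)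
    (Eventually.of_forall fun p => (h.smooth _ _).sub (h.smooth _ _)) (fun k z => ?_)
    (fun z => h.time z t₀) z
  obtain ⟨C, hC, hb⟩ := (h.symb (|t₀| + 1)).bounded k
  obtain ⟨M, hM⟩ := (isCompact_closedBall z 1).exists_bound_of_continuousOn
    h.weight_cont.continuousOn
  refine ⟨C * M + C * M, ?_⟩
  filter_upwards [tendsto_fst.eventually (eventually_mem_Icc t₀)] with p hp z' hz'
  have hw : w z' ≤ M := (le_abs_self _).trans (hM z' (Metric.ball_subset_closedBall hz'))
  have e := iteratedFDeriv_sub_apply (x := z') (i := k)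
    (contDiff_infty.1 (h.smooth p.2 p.1) k).contDiffAt
    (contDiff_infty.1 (h.smooth p.2 t₀) k).contDiffAt
  change ‖iteratedFDeriv ℝ k (u p.2 p.1 - u p.2 t₀) z'‖ ≤ _
  rw [e]
  refine (norm_sub_le _ _).trans (add_le_add ?_ ?_)
  · exact (hb (p.2, ⟨p.1, hp⟩) z').trans (mul_le_mul_of_nonneg_left hw hC)
  · exact (hb (p.2, ⟨t₀, mem_Icc_abs t₀⟩) z').trans (mul_le_mul_of_nonneg_left hw hC)

theorem fderiv [FiniteDimensional ℝ E] (h : TimeFam ε₀ w u) :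
    TimeFam ε₀ w (fun ε t => fderiv ℝ (u ε t)) := by
  refine ⟨h.weight_cont, h.weight_pos, fun T => (h.symb T).fderiv, fun z t₀ => ?_⟩
  have key := h.tendsto_iteratedFDeriv_sub 1 z t₀
  rw [tendsto_zero_iff_norm_tendsto_zero] at key ⊢
  refine key.congr fun p => ?_
  rw [show (1 : ℕ) = 0 + 1 from rfl, ← norm_iteratedFDeriv_fderiv, norm_iteratedFDeriv_zero,
    fderiv_fun_sub (h.differentiable _ _ _) (h.differentiable _ _ _)]

theorem of_fderiv (hd : ∀ (ε : Set.Ioc 0 ε₀) t, Differentiable ℝ (u ε t))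
    (hb : ∀ T : ℝ, ∃ C : ℝ, 0 ≤ C ∧ ∀ (ε : Set.Ioc 0 ε₀), ∀ t ∈ Set.Icc (-T) T, ∀ z,
      ‖u ε t z‖ ≤ C * w z)
    (ht : ∀ z t₀, Tendsto (fun p : ℝ × Set.Ioc 0 ε₀ => u p.2 p.1 z - u p.2 t₀ z)
      (𝓝 t₀ ×ˢ ⊤) (𝓝 0))
    (h : TimeFam ε₀ w (fun ε t => _root_.fderiv ℝ (u ε t))) : TimeFam ε₀ w u := by
  refine ⟨h.weight_cont, h.weight_pos, fun T => ?_, ht⟩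
  obtain ⟨C, hC, hb⟩ := hb T
  exact SymbFam.of_fderiv (fun i => hd _ _) hC (fun i z => hb _ _ i.2.2 z) (h.symb T)

theorem iteratedFDeriv_time [FiniteDimensional ℝ E] (h : TimeFam ε₀ w u) (k : ℕ) (z : E) (t₀ : ℝ) :
    Tendsto (fun p : ℝ × Set.Ioc 0 ε₀ =>
      iteratedFDeriv ℝ k (u p.2 p.1) z - iteratedFDeriv ℝ k (u p.2 t₀) z) (𝓝 t₀ ×ˢ ⊤) (𝓝 0) :=
  (h.tendsto_iteratedFDeriv_sub k z t₀).congr fun p =>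
    iteratedFDeriv_sub_apply (contDiff_infty.1 (h.smooth p.2 p.1) k).contDiffAt
      (contDiff_infty.1 (h.smooth p.2 t₀) k).contDiffAt

/-- Of the equicontinuity hypothesis only order zero, at fixed z, is retained;
`equicontinuous_iteratedFDeriv` recovers the rest. -/
theorem of_isSymbolFamily {d : ℕ} {w : Phase d → ℝ} (hw : Continuous w) (hpos : ∀ z, 0 < w z)
    {u : ℝ → ℝ → Phase d → ℂ} (h : IsSymbolFamily ε₀ w u) : TimeFam ε₀ w u := by
  refine ⟨hw, hpos, fun T => ⟨fun i => h.smooth _ i.1.2 _, fun k => ?_⟩, fun z t₀ => ?_⟩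
  · obtain ⟨C, hC⟩ := h.bounded k T
    refine ⟨max C 0, le_max_right _ _, fun i z => (hC _ i.1.2 _ i.2.2 z).trans ?_⟩
    exact mul_le_mul_of_nonneg_right (le_max_left _ _) (hpos z).le
  · rw [Metric.tendsto_nhds]
    intro δ hδ
    have h1 := Metric.equicontinuousAt_iff_right.1 (h.continuous 0 (t₀, z)) δ hδ
    have hc : Tendsto (fun t : ℝ => (t, z)) (𝓝 t₀) (𝓝 (t₀, z)) :=
      (Continuous.prodMk_left z).tendsto t₀
    have h2 := hc.eventually h1
    have : {p : ℝ × Set.Ioc 0 ε₀ | dist (u p.2 p.1 z - u p.2 t₀ z) 0 < δ} ∈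
        𝓝 t₀ ×ˢ (⊤ : Filter (Set.Ioc 0 ε₀)) := by
      rw [mem_prod_top]
      filter_upwards [h2] with t ht ε
      have := ht ε
      simp only [iteratedFDeriv_zero_eq_comp, Function.comp_apply,
        LinearIsometryEquiv.dist_map] at this
      rwa [dist_zero_right, ← dist_eq_norm, dist_comm]
    exact this

/-- The increment is split at (t, z₀): in space the mean value inequality with the bound of order `k
+ 1` applies, uniformly in time; in time only the fixed point z₀ matters. -/
theorem equicontinuous_iteratedFDeriv [FiniteDimensional ℝ E] (h : TimeFam ε₀ w u) (k : ℕ) :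
    Equicontinuous (fun (ε : Set.Ioc 0 ε₀) (tz : ℝ × E) => iteratedFDeriv ℝ k (u ε tz.1) tz.2) := by
  rintro ⟨t₀, z₀⟩
  rw [Metric.equicontinuousAt_iff_right]
  intro δ hδ
  obtain ⟨C, hC, hb⟩ := (h.symb (|t₀| + 1)).bounded (k + 1)
  obtain ⟨M, hM⟩ := (isCompact_closedBall z₀ 1).exists_bound_of_continuousOn
    h.weight_cont.continuousOn
  have h1 := (Metric.tendsto_nhds.1 (h.iteratedFDeriv_time k z₀ t₀)) (δ / 2) (by positivity)
  have h1' := mem_prod_top.1 h1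
  have hz : ∀ᶠ z in 𝓝 z₀, C * M * ‖z - z₀‖ < δ / 2 := by
    have : Continuous fun z => C * M * ‖z - z₀‖ := by fun_prop
    have := this.tendsto z₀
    rw [sub_self, norm_zero, mul_zero] at this
    exact this.eventually (gt_mem_nhds (by positivity))
  have hz' := hz.and (Metric.ball_mem_nhds z₀ one_pos)
  rw [nhds_prod_eq]
  filter_upwards [prod_mem_prod (inter_mem h1' (eventually_mem_Icc t₀)) hz'] with p hp ε
  obtain ⟨⟨h3, h4⟩, h5, h6⟩ := hp
  have h7 : ‖iteratedFDeriv ℝ k (u ε p.1) p.2 - iteratedFDeriv ℝ k (u ε p.1) z₀‖ ≤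
      C * M * ‖p.2 - z₀‖ := by
    refine (convex_ball z₀ 1).norm_image_sub_le_of_norm_fderiv_le (𝕜 := ℝ)
      (fun y _ => ((h.smooth ε p.1).differentiable_iteratedFDeriv
        (by exact_mod_cast WithTop.coe_lt_top _)) y) (fun y hy => ?_)
      (Metric.mem_ball_self one_pos) h6
    rw [norm_fderiv_iteratedFDeriv]
    refine (hb (ε, ⟨p.1, h4⟩) y).trans (mul_le_mul_of_nonneg_left ?_ hC)
    exact (le_abs_self _).trans (hM y (Metric.ball_subset_closedBall hy))
  have h8 : ‖iteratedFDeriv ℝ k (u ε p.1) z₀ - iteratedFDeriv ℝ k (u ε t₀) z₀‖ < δ / 2 := by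
    have := h3 ε
    simpa using this
  rw [dist_comm, dist_eq_norm]
  calc _ = ‖(iteratedFDeriv ℝ k (u ε p.1) p.2 - iteratedFDeriv ℝ k (u ε p.1) z₀) +
        (iteratedFDeriv ℝ k (u ε p.1) z₀ - iteratedFDeriv ℝ k (u ε t₀) z₀)‖ := by
          congr 1; abel
    _ ≤ _ := norm_add_le _ _
    _ < δ := by linarith

theorem continuous_uncurry [FiniteDimensional ℝ E] (h : TimeFam ε₀ w u) (ε : Set.Ioc 0 ε₀) :
    Continuous fun p : ℝ × E => u ε p.1 p.2 := by
  have := (h.equicontinuous_iteratedFDeriv 0).continuous ε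
  simp only [iteratedFDeriv_zero_eq_comp] at this
  have h2 := (continuousMultilinearCurryFin0 ℝ E F).continuous.comp this
  exact h2.congr fun p => (continuousMultilinearCurryFin0 ℝ E F).apply_symm_apply _

theorem isSymbolFamily {d : ℕ} {w : Phase d → ℝ} {u : ℝ → ℝ → Phase d → ℂ}
    (h : TimeFam ε₀ w u) : IsSymbolFamily ε₀ w u := by
  refine ⟨fun ε hε t => h.smooth ⟨ε, hε⟩ t, fun k T => ?_, h.equicontinuous_iteratedFDeriv⟩
  obtain ⟨C, -, hC⟩ := (h.symb T).bounded k
  exact ⟨C, fun ε hε t ht z => hC (⟨ε, hε⟩, ⟨t, ht⟩) z⟩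

end TimeFam

end TimeFamilies

theorem continuous_one_add_norm_pow {E : Type} [NormedAddCommGroup E] (n : ℕ) :
    Continuous fun z : E => (1 + ‖z‖) ^ n := by
  fun_prop

theorem one_add_norm_pow_pos {E : Type} [NormedAddCommGroup E] (n : ℕ) (z : E) :
    0 < (1 + ‖z‖) ^ n := by
  positivity

/-! ### Recovering a family from its spatial derivative -/

section Primitives

variable {E F : Type} [NormedAddCommGroup E] [NormedSpace ℝ E]
  [NormedAddCommGroup F] [NormedSpace ℝ F]

/-- If the spatial derivative of a family is `C¹` in time, then the spatial derivative of the time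
derivative exists and is the time derivative of the spatial derivative. -/
theorem hasFDerivAt_of_hasDerivAt_fderiv {f f' : ℝ → E → F} {P : ℝ → E → E →L[ℝ] F}
    (h1 : ∀ z t, HasDerivAt (fun s => f s z) (f' t z) t) (hd : ∀ t, Differentiable ℝ (f t))
    (h2 : ∀ z t, HasDerivAt (fun s => fderiv ℝ (f s) z) (P t z) t)
    (hP : Continuous fun p : ℝ × E => P p.1 p.2) (t : ℝ) (z : E) :
    HasFDerivAt (f' t) (P t z) z := by
  -- The time difference quotients are differentiable in z and converge pointwise. If their
  -- differentials converge uniformly near z, the limit may be differentiated.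
  refine hasFDerivAt_of_tendstoUniformlyOnFilter (𝕜 := ℝ) (l := 𝓝[≠] (0 : ℝ))
    (f := fun h z => h⁻¹ • (f (t + h) z - f t z))
    (f' := fun h z => h⁻¹ • (fderiv ℝ (f (t + h)) z - fderiv ℝ (f t) z)) (g' := P t) ?_ ?_ ?_
  · rw [Metric.tendstoUniformlyOnFilter_iff]
    intro δ hδ
    have hc := Metric.tendsto_nhds.1 (hP.tendsto (t, z)) (δ / 4) (by positivity)
    obtain ⟨r, hr, hball⟩ := Metric.eventually_nhds_iff_ball.1 hc
    have e1 : ∀ᶠ h in 𝓝[≠] (0 : ℝ), |h| < r ∧ h ≠ 0 := by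
      have h0 : ∀ᶠ h in 𝓝 (0 : ℝ), |h| < r := by
        have := Metric.ball_mem_nhds (0 : ℝ) hr
        filter_upwards [this] with h hh
        simpa using hh
      exact (h0.filter_mono nhdsWithin_le_nhds).and self_mem_nhdsWithin
    have e2 : ∀ᶠ z' in 𝓝 z, z' ∈ Metric.ball z r := Metric.ball_mem_nhds z hr
    filter_upwards [e1.prod_mk e2] with p hp
    obtain ⟨⟨hp1, hp0⟩, hp2⟩ := hp
    have hmem : ∀ s ∈ Metric.ball t r, (s, p.2) ∈ Metric.ball (t, z) r := fun s hs => by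
      rw [Metric.mem_ball, Prod.dist_eq]
      exact max_lt hs hp2
    have ht : t ∈ Metric.ball t r := Metric.mem_ball_self hr
    -- Mean value inequality in time for D f(s) - (s-t) P(t), whose time derivative P(s) - P(t) is
    -- at most δ/2 near (t, z) by joint continuity of P.
    have hb := (convex_ball t r).norm_image_sub_le_of_norm_hasDerivWithin_le
      (f := fun s => fderiv ℝ (f s) p.2 - (s - t) • P t p.2)
      (f' := fun s => P s p.2 - P t p.2) (C := δ / 2) (x := t) (y := t + p.1)
      (fun s _ => by
        have h3 := ((hasDerivAt_id s).sub_const t).smul_const (P t p.2)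
        rw [one_smul] at h3
        exact ((h2 p.2 s).sub h3).hasDerivWithinAt)
      (fun s hs => by
        have h4 := hball _ (hmem s hs)
        have h5 := hball _ (hmem t ht)
        rw [← dist_eq_norm]
        refine (dist_triangle_right _ _ (P t z)).trans ?_
        linarith)
      ht (by simpa [Metric.mem_ball, dist_eq_norm] using hp1)
    rw [dist_eq_norm, norm_sub_rev]
    have hpos : 0 < |p.1| := abs_pos.2 hp0
    have heq : p.1⁻¹ • (fderiv ℝ (f (t + p.1)) p.2 - fderiv ℝ (f t) p.2) - P t p.2 =
        p.1⁻¹ • (fderiv ℝ (f (t + p.1)) p.2 - (t + p.1 - t) • P t p.2 -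
          (fderiv ℝ (f t) p.2 - (t - t) • P t p.2)) := by
      rw [sub_self, zero_smul, sub_zero, add_sub_cancel_left, sub_right_comm,
        smul_sub _ _ (p.1 • P t p.2), smul_smul, inv_mul_cancel₀ hp0, one_smul]
    rw [heq, norm_smul, norm_inv, Real.norm_eq_abs]
    calc |p.1|⁻¹ * _ ≤ |p.1|⁻¹ * (δ / 2 * ‖t + p.1 - t‖) := by gcongr
      _ = δ / 2 := by
        rw [add_sub_cancel_left, Real.norm_eq_abs]
        field_simp
      _ < δ := by linarith
  · exact Eventually.of_forall fun n =>
      ((hd (t + n.1) n.2).hasFDerivAt.sub (hd t n.2).hasFDerivAt).const_smul _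
  · exact Eventually.of_forall fun y => (h1 y t).tendsto_slope_zero

/-- Integration of a time-dependent symbol raises the order in `⟨z⟩` by one. -/
theorem TimeFam.primitive {ε₀ : ℝ} {f : ℝ → E → F} {n : ℕ}
    (hd : ∀ t, Differentiable ℝ (f t)) (hc : ∀ z, Continuous fun t => f t z)
    (h : TimeFam ε₀ (fun z => (1 + ‖z‖) ^ n) (fun _ t => _root_.fderiv ℝ (f t))) :
    TimeFam ε₀ (fun z => (1 + ‖z‖) ^ (n + 1)) (fun _ => f) := by
  have hmono := h.mono (continuous_one_add_norm_pow (n + 1)) (one_add_norm_pow_pos (n + 1)) 1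
    zero_le_one (fun z => by
      rw [one_mul]
      exact pow_le_pow_right₀ (by linarith [norm_nonneg z]) n.le_succ)
  refine TimeFam.of_fderiv (fun _ => hd) (fun T => ?_) (fun z t₀ => ?_) hmono
  · obtain ⟨C, hC, hb⟩ := h.norm_le T
    obtain ⟨M, hM⟩ := isCompact_Icc.exists_bound_of_continuousOn (s := Set.Icc (-T) T)
      (hc 0).continuousOn
    refine ⟨|M| + C, by positivity, fun ε t ht z => ?_⟩
    -- On the ball of radius ‖z‖ the weight of the differential is at most its value at z; the
    -- factor ‖z‖ of the mean value inequality is the additional order.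
    have h1 : ‖f t z - f t 0‖ ≤ C * (1 + ‖z‖) ^ n * ‖z - 0‖ := by
      refine (convex_closedBall (0 : E) ‖z‖).norm_image_sub_le_of_norm_fderiv_le (𝕜 := ℝ)
        (fun y _ => hd t y) (fun y hy => (hb ε t ht y).trans ?_)
        (Metric.mem_closedBall_self (norm_nonneg _)) (by simp)
      have : ‖y‖ ≤ ‖z‖ := by simpa using hy
      gcongr
    rw [sub_zero] at h1
    have h2 : ‖f t z‖ ≤ ‖f t z - f t 0‖ + ‖f t 0‖ := by
      simpa using norm_add_le (f t z - f t 0) (f t 0)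
    have h3 := (hM t ht).trans (le_abs_self M)
    have h4 : 1 ≤ (1 + ‖z‖) ^ (n + 1) := one_le_pow₀ (by linarith [norm_nonneg z])
    have h5 : (1 + ‖z‖) ^ n * ‖z‖ ≤ (1 + ‖z‖) ^ (n + 1) := by
      rw [pow_succ]
      gcongr
      linarith
    calc ‖f t z‖ ≤ C * ((1 + ‖z‖) ^ n * ‖z‖) + |M| * 1 := by rw [← mul_assoc]; linarith
      _ ≤ C * (1 + ‖z‖) ^ (n + 1) + |M| * (1 + ‖z‖) ^ (n + 1) := by gcongr
      _ = _ := by ring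
  · have h1 : Tendsto (fun t => f t z - f t₀ z) (𝓝 t₀) (𝓝 (f t₀ z - f t₀ z)) :=
      ((hc z).sub continuous_const).tendsto t₀
    rw [sub_self] at h1
    exact h1.comp tendsto_fst

end Primitives

/-! ### Coordinates on phase space -/

section PhaseSpace

variable {d : ℕ}

theorem conf_eq_sum (a : Conf d) : a = ∑ j, a j • basisVec j := by
  ext i
  simp [basisVec, Pi.single_apply]

theorem phase_eq_sum (v : Phase d) :
    v = ∑ j, v.1 j • ((basisVec j, 0) : Phase d) + ∑ j, v.2 j • ((0, basisVec j) : Phase d) := by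
  ext1
  · simp only [Prod.fst_add, Prod.fst_sum, Prod.smul_fst, smul_zero,
      Finset.sum_const_zero, add_zero]
    exact conf_eq_sum v.1
  · simp only [Prod.snd_add, Prod.snd_sum, Prod.smul_snd, smul_zero,
      Finset.sum_const_zero, zero_add]
    exact conf_eq_sum v.2

theorem clm_phase_apply {F : Type} [NormedAddCommGroup F] [NormedSpace ℝ F] (L : Phase d →L[ℝ] F)
    (v : Phase d) :
    L v = ∑ j, v.1 j • L (basisVec j, 0) + ∑ j, v.2 j • L (0, basisVec j) := by
  conv_lhs => rw [phase_eq_sum v]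
  simp only [map_add, map_sum, map_smul]

/-- The basis vectors of phase space. -/
noncomputable def phaseBasis : Fin d ⊕ Fin d → Phase d :=
  Sum.elim (fun j => (basisVec j, 0)) (fun j => (0, basisVec j))

/-- The coordinate functionals of phase space. -/
noncomputable def phaseCoord : Fin d ⊕ Fin d → Phase d →L[ℝ] ℝ :=
  Sum.elim (fun j => (EuclideanSpace.proj j).comp (ContinuousLinearMap.fst ℝ (Conf d) (Conf d)))
    (fun j => (EuclideanSpace.proj j).comp (ContinuousLinearMap.snd ℝ (Conf d) (Conf d)))

theorem phaseCoord_sum (v : Phase d) : v = ∑ i, phaseCoord i v • phaseBasis i := by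
  rw [Fintype.sum_sum_type]
  exact phase_eq_sum v

theorem jacobian_eq (κ : Phase d → Phase d) (z : Phase d) (i j : Fin d ⊕ Fin d) :
    jacobian κ z i j = phaseCoord i (fderiv ℝ κ z (phaseBasis j)) := by
  rcases i with i | i <;> rcases j with j | j <;> rfl

/-- The elementary endomorphisms of phase space. -/
noncomputable def phaseUnit (i j : Fin d ⊕ Fin d) : Phase d →L[ℝ] Phase d :=
  (phaseCoord j).smulRight (phaseBasis i)

/-- Class 𝓑 is formulated for matrix entries; through this expansion the bounds and time derivatives
of the entries become statements on differentials. -/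
theorem fderiv_eq_sum_jacobian (κ : Phase d → Phase d) (z : Phase d) :
    fderiv ℝ κ z = ∑ i, ∑ j, jacobian κ z i j • phaseUnit i j := by
  refine ContinuousLinearMap.ext fun v => ?_
  have h1 : fderiv ℝ κ z v = ∑ j, phaseCoord j v • fderiv ℝ κ z (phaseBasis j) := by
    conv_lhs => rw [phaseCoord_sum v]
    simp
  rw [h1, sum_apply]
  simp only [sum_apply, smul_apply, phaseUnit,
    ContinuousLinearMap.smulRight_apply]
  rw [Finset.sum_comm]
  refine Finset.sum_congr rfl fun j _ => ?_
  conv_lhs => rw [phaseCoord_sum (fderiv ℝ κ z (phaseBasis j)), Finset.smul_sum]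
  refine Finset.sum_congr rfl fun i _ => ?_
  rw [jacobian_eq, smul_smul, smul_smul, mul_comm]

end PhaseSpace

/-! ### Growth and regularity of the flow and of the action -/

section ClassB

variable {d : ℕ} {κ : ℝ → Phase d → Phase d}

theorem contDiff_jacobian {κ : Phase d → Phase d} (h : ContDiff ℝ ∞ κ) (i j : Fin d ⊕ Fin d) :
    ContDiff ℝ ∞ fun z => jacobian κ z i j := by
  simp only [jacobian_eq]
  exact (phaseCoord i).contDiff.comp ((h.fderiv_right (m := ∞) (by simp)).clm_apply contDiff_const)

/-- The time derivative of the Jacobian matrix, as a linear map. -/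
noncomputable def dtFDeriv (κ : ℝ → Phase d → Phase d) (t : ℝ) (z : Phase d) :
    Phase d →L[ℝ] Phase d :=
  ∑ i, ∑ j, deriv (fun s => jacobian (κ s) z i j) t • phaseUnit i j

/-- The time derivative of a family of maps of phase space. -/
noncomputable def dtMap (κ : ℝ → Phase d → Phase d) (t : ℝ) (z : Phase d) : Phase d :=
  deriv (fun s => κ s z) t

namespace IsClassBFamily

theorem jacobian_timeFam (hκ : IsClassBFamily κ) (ε₀ : ℝ) (i j : Fin d ⊕ Fin d) :
    TimeFam ε₀ (fun _ => 1) (fun _ t z => jacobian (κ t) z i j) := by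
  refine TimeFam.of_indep continuous_const (fun _ => one_pos)
    (fun t => contDiff_jacobian (hκ.canonical t).smooth i j) (fun k T => ?_)
    (fun z => (hκ.jacobian_time_C1 z i j).continuous)
  obtain ⟨C, hC⟩ := hκ.bounded k T
  exact ⟨C, fun t ht z => by simpa using hC t ht z i j⟩

theorem dt_jacobian_timeFam (hκ : IsClassBFamily κ) (ε₀ : ℝ) (i j : Fin d ⊕ Fin d) :
    TimeFam ε₀ (fun _ => 1) (fun _ t z => deriv (fun s => jacobian (κ s) z i j) t) := by
  refine TimeFam.of_indep continuous_const (fun _ => one_pos)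
    (fun t => hκ.deriv_smooth t i j) (fun k T => ?_)
    (fun z => (hκ.jacobian_time_C1 z i j).continuous_deriv le_rfl)
  obtain ⟨C, hC⟩ := hκ.deriv_bounded k T
  exact ⟨C, fun t ht z => by simpa using hC t ht z i j⟩

theorem fderiv_timeFam (hκ : IsClassBFamily κ) (ε₀ : ℝ) :
    TimeFam ε₀ (fun _ => 1) (fun _ t z => fderiv ℝ (κ t) z) := by
  simp only [fderiv_eq_sum_jacobian]
  exact TimeFam.sum continuous_const (fun _ => one_pos) fun i _ =>
    TimeFam.sum continuous_const (fun _ => one_pos) fun j _ =>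
      (hκ.jacobian_timeFam ε₀ i j).clm (ContinuousLinearMap.toSpanSingleton ℝ (phaseUnit i j))

theorem dtFDeriv_timeFam (hκ : IsClassBFamily κ) (ε₀ : ℝ) :
    TimeFam ε₀ (fun _ => 1) (fun _ t z => dtFDeriv κ t z) :=
  TimeFam.sum continuous_const (fun _ => one_pos) fun i _ =>
    TimeFam.sum continuous_const (fun _ => one_pos) fun j _ =>
      (hκ.dt_jacobian_timeFam ε₀ i j).clm (ContinuousLinearMap.toSpanSingleton ℝ (phaseUnit i j))

theorem hasDerivAt_fderiv (hκ : IsClassBFamily κ) (z : Phase d) (t : ℝ) :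
    HasDerivAt (fun s => fderiv ℝ (κ s) z) (dtFDeriv κ t z) t := by
  simp only [fderiv_eq_sum_jacobian, dtFDeriv]
  refine HasDerivAt.fun_sum fun i _ => HasDerivAt.fun_sum fun j _ => ?_
  have h := (((hκ.jacobian_time_C1 z i j).differentiable one_ne_zero) t).hasDerivAt
  exact h.smul_const (phaseUnit i j)

theorem hasDerivAt (hκ : IsClassBFamily κ) (z : Phase d) (t : ℝ) :
    HasDerivAt (fun s => κ s z) (dtMap κ t z) t :=
  (((hκ.time_C1 z).differentiable one_ne_zero) t).hasDerivAt

theorem differentiable (hκ : IsClassBFamily κ) (t : ℝ) : Differentiable ℝ (κ t) :=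
  (hκ.canonical t).smooth.differentiable (by simp)

/-- Nothing is assumed on the growth of κ itself. Linear growth comes from integrating the bounded
Jacobian. -/
theorem timeFam (hκ : IsClassBFamily κ) (ε₀ : ℝ) :
    TimeFam ε₀ (fun z => (1 + ‖z‖) ^ 1) (fun _ => κ) :=
  TimeFam.primitive (n := 0) hκ.differentiable (fun z => (hκ.time_C1 z).continuous)
    ((hκ.fderiv_timeFam ε₀).congr_weight fun _ => (pow_zero _).symm)

/-- Differentiability of the velocity in z is not part of class 𝓑; it follows by exchanging the
derivatives, because the time derivative of the Jacobian is jointly continuous. -/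
theorem hasFDerivAt_dtMap (hκ : IsClassBFamily κ) (t : ℝ) (z : Phase d) :
    HasFDerivAt (dtMap κ t) (dtFDeriv κ t z) z :=
  hasFDerivAt_of_hasDerivAt_fderiv hκ.hasDerivAt hκ.differentiable hκ.hasDerivAt_fderiv
    ((hκ.dtFDeriv_timeFam 1).continuous_uncurry ⟨1, one_pos, le_rfl⟩) t z

theorem dtMap_timeFam (hκ : IsClassBFamily κ) (ε₀ : ℝ) :
    TimeFam ε₀ (fun z => (1 + ‖z‖) ^ 1) (fun _ => dtMap κ) := by
  refine TimeFam.primitive (n := 0) (fun t z => (hκ.hasFDerivAt_dtMap t z).differentiableAt)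
    (fun z => (hκ.time_C1 z).continuous_deriv le_rfl) ?_
  have h : ∀ t, fderiv ℝ (dtMap κ t) = dtFDeriv κ t :=
    fun t => funext fun z => (hκ.hasFDerivAt_dtMap t z).fderiv
  simp only [h]
  exact (hκ.dtFDeriv_timeFam ε₀).congr_weight fun _ => (pow_zero _).symm

end IsClassBFamily

/-! ### The action -/

/-- The `k`-th position functional. -/
noncomputable def posCoord (k : Fin d) : Phase d →L[ℝ] ℝ := phaseCoord (Sum.inl k)

/-- The `k`-th momentum functional. -/
noncomputable def momCoord (k : Fin d) : Phase d →L[ℝ] ℝ := phaseCoord (Sum.inr k)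

theorem posCoord_apply (k : Fin d) (z : Phase d) : posCoord k z = z.1 k := rfl

theorem momCoord_apply (k : Fin d) (z : Phase d) : momCoord k z = z.2 k := rfl

/-- Expresses dS through κ alone, so that growth, smoothness and time derivative of dS are inherited
from κ and plain differentiability of S in z suffices. -/
theorem IsAction.fderiv_eq {κ : Phase d → Phase d} {S : Phase d → ℝ} (hS : IsAction κ S)
    (z : Phase d) : fderiv ℝ S z = (-∑ k, momCoord k z • posCoord k) +
      ∑ k, momCoord k (κ z) • (posCoord k).comp (fderiv ℝ κ z) := by
  refine ContinuousLinearMap.ext fun v => ?_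
  rw [clm_phase_apply, clm_phase_apply _ v]
  congr 1
  · refine Finset.sum_congr rfl fun j _ => ?_
    congr 1
    rw [hS.grad_q]
    simp [posCoord_apply, momCoord_apply, basisVec, mul_comm]
  · refine Finset.sum_congr rfl fun j _ => ?_
    congr 1
    rw [hS.grad_p]
    simp [posCoord_apply, momCoord_apply, mul_comm]

theorem TimeFam.linear {F : Type} [NormedAddCommGroup F] [NormedSpace ℝ F] (ε₀ : ℝ)
    (L : Phase d →L[ℝ] F) : TimeFam ε₀ (fun z : Phase d => (1 + ‖z‖) ^ 1) (fun _ _ z => L z) := by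
  refine TimeFam.primitive (n := 0) (fun t => L.differentiable) (fun z => continuous_const) ?_
  have h : _root_.fderiv ℝ (fun z => L z) = fun _ => L := funext fun z => L.fderiv
  simp only [h]
  exact (TimeFam.const (c := fun _ => L) continuous_const).congr_weight fun _ => (pow_zero _).symm

/-- The time derivative of the differential of the action. -/
noncomputable def dtFDerivAction (κ : ℝ → Phase d → Phase d) (t : ℝ) (z : Phase d) :
    Phase d →L[ℝ] ℝ :=
  ∑ k, (momCoord k (κ t z) • (posCoord k).comp (dtFDeriv κ t z) +
    momCoord k (dtMap κ t z) • (posCoord k).comp (fderiv ℝ (κ t) z))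

variable {S : ℝ → Phase d → ℝ}

theorem action_fderiv_timeFam (hκ : IsClassBFamily κ) (hS : ∀ t, IsAction (κ t) (S t)) (ε₀ : ℝ) :
    TimeFam ε₀ (fun z => (1 + ‖z‖) ^ 1) (fun _ t => fderiv ℝ (S t)) := by
  have h : ∀ t, fderiv ℝ (S t) = fun z => (-∑ k, momCoord k z • posCoord k) +
      ∑ k, momCoord k (κ t z) • (posCoord k).comp (fderiv ℝ (κ t) z) :=
    fun t => funext fun z => (hS t).fderiv_eq z
  simp only [h]
  refine TimeFam.add ?_ (TimeFam.sum (continuous_one_add_norm_pow 1) (one_add_norm_pow_pos 1)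
    fun k _ => ?_)
  · have := TimeFam.linear ε₀ (-∑ k, (momCoord (d := d) k).smulRight (posCoord k))
    simpa [sum_apply] using this
  · exact (((hκ.timeFam ε₀).clm (momCoord k)).bilin (ContinuousLinearMap.lsmul ℝ ℝ)
      ((hκ.fderiv_timeFam ε₀).clm (ContinuousLinearMap.compL ℝ _ _ _ (posCoord k)))).congr_weight
        fun z => mul_one _

theorem dtFDerivAction_timeFam (hκ : IsClassBFamily κ) (ε₀ : ℝ) :
    TimeFam ε₀ (fun z => (1 + ‖z‖) ^ 1) (fun _ t => dtFDerivAction κ t) := by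
  refine TimeFam.sum (continuous_one_add_norm_pow 1) (one_add_norm_pow_pos 1)
    fun k _ => TimeFam.add ?_ ?_
  · exact (((hκ.timeFam ε₀).clm (momCoord k)).bilin (ContinuousLinearMap.lsmul ℝ ℝ)
      ((hκ.dtFDeriv_timeFam ε₀).clm (ContinuousLinearMap.compL ℝ _ _ _ (posCoord k)))).congr_weight
        fun z => mul_one _
  · exact (((hκ.dtMap_timeFam ε₀).clm (momCoord k)).bilin (ContinuousLinearMap.lsmul ℝ ℝ)
      ((hκ.fderiv_timeFam ε₀).clm (ContinuousLinearMap.compL ℝ _ _ _ (posCoord k)))).congr_weight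
        fun z => mul_one _

theorem hasDerivAt_action_fderiv (hκ : IsClassBFamily κ) (hS : ∀ t, IsAction (κ t) (S t))
    (z : Phase d) (t : ℝ) :
    HasDerivAt (fun s => fderiv ℝ (S s) z) (dtFDerivAction κ t z) t := by
  simp only [fun s => (hS s).fderiv_eq z]
  refine HasDerivAt.const_add _ (HasDerivAt.fun_sum fun k _ => ?_)
  have h1 : HasDerivAt (fun s => momCoord k (κ s z)) (momCoord k (dtMap κ t z)) t :=
    (momCoord k).hasFDerivAt.comp_hasDerivAt t (hκ.hasDerivAt z t)
  have h2 : HasDerivAt (fun s => (posCoord k).comp (fderiv ℝ (κ s) z))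
      ((posCoord k).comp (dtFDeriv κ t z)) t :=
    (ContinuousLinearMap.compL ℝ (Phase d) (Phase d) ℝ (posCoord k)).hasFDerivAt.comp_hasDerivAt t
      (hκ.hasDerivAt_fderiv z t)
  exact h1.smul h2

theorem action_timeFam (hκ : IsClassBFamily κ) (hS : ∀ t, IsAction (κ t) (S t))
    (hS1 : ∀ z, ContDiff ℝ 1 (fun t => S t z)) (ε₀ : ℝ) :
    TimeFam ε₀ (fun z => (1 + ‖z‖) ^ 2) (fun _ => S) :=
  TimeFam.primitive (n := 1) (fun t => (hS t).differentiable) (fun z => (hS1 z).continuous)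
    (action_fderiv_timeFam hκ hS ε₀)

theorem hasFDerivAt_dt_action (hκ : IsClassBFamily κ) (hS : ∀ t, IsAction (κ t) (S t))
    (hS1 : ∀ z, ContDiff ℝ 1 (fun t => S t z)) (t : ℝ) (z : Phase d) :
    HasFDerivAt (fun z => deriv (fun s => S s z) t) (dtFDerivAction κ t z) z :=
  hasFDerivAt_of_hasDerivAt_fderiv (f' := fun t z => deriv (fun s => S s z) t)
    (fun z t => (((hS1 z).differentiable one_ne_zero) t).hasDerivAt)
    (fun t => (hS t).differentiable)
    (hasDerivAt_action_fderiv hκ hS)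
    ((dtFDerivAction_timeFam hκ 1).continuous_uncurry ⟨1, one_pos, le_rfl⟩) t z

theorem dt_action_timeFam (hκ : IsClassBFamily κ) (hS : ∀ t, IsAction (κ t) (S t))
    (hS1 : ∀ z, ContDiff ℝ 1 (fun t => S t z)) (ε₀ : ℝ) :
    TimeFam ε₀ (fun z => (1 + ‖z‖) ^ 2) (fun _ t z => deriv (fun s => S s z) t) := by
  refine TimeFam.primitive (n := 1)
    (fun t z => (hasFDerivAt_dt_action hκ hS hS1 t z).differentiableAt)
    (fun z => (hS1 z).continuous_deriv le_rfl) ?_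
  have h : ∀ t, fderiv ℝ (fun z => deriv (fun s => S s z) t) = dtFDerivAction κ t :=
    fun t => funext fun z => (hasFDerivAt_dt_action hκ hS hS1 t z).fderiv
  simp only [h]
  exact dtFDerivAction_timeFam hκ ε₀

end ClassB

/-! ### Invertibility of 𝒵 and a uniform lower bound for its determinant -/

section Widths

open Matrix

variable {d : ℕ}

theorem IsWidth.re_star_dotProduct {Θ : Matrix (Fin d) (Fin d) ℂ} (hΘ : IsWidth Θ)
    (a : Fin d → ℂ) : (star a ⬝ᵥ Θ *ᵥ a).re =
      (fun j => (a j).re) ⬝ᵥ Θ.map Complex.re *ᵥ (fun j => (a j).re) +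
      (fun j => (a j).im) ⬝ᵥ Θ.map Complex.re *ᵥ (fun j => (a j).im) := by
  have hs : ∀ j k, Θ j k = Θ k j := fun j k => (hΘ.symm.apply k j)
  -- The imaginary part of Θ is symmetric and is paired with an expression antisymmetric in the
  -- indices, so it drops out.
  have h0 : ∑ j, ∑ k, (Θ j k).im * ((a j).re * (a k).im - (a j).im * (a k).re) = 0 := by
    have h : ∑ j, ∑ k, (Θ j k).im * ((a j).re * (a k).im - (a j).im * (a k).re) =
        -∑ j, ∑ k, (Θ j k).im * ((a j).re * (a k).im - (a j).im * (a k).re) := by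
      conv_lhs => rw [Finset.sum_comm]
      simp only [← Finset.sum_neg_distrib]
      refine Finset.sum_congr rfl fun j _ => Finset.sum_congr rfl fun k _ => ?_
      rw [hs j k]
      ring
    linarith
  simp only [dotProduct, mulVec, Finset.mul_sum, Complex.re_sum, map_apply]
  rw [← Finset.sum_add_distrib, ← add_zero (∑ i, _), ← h0, ← Finset.sum_add_distrib]
  refine Finset.sum_congr rfl fun j _ => ?_
  rw [← Finset.sum_add_distrib, ← Finset.sum_add_distrib]
  refine Finset.sum_congr rfl fun k _ => ?_
  simp
  ring

theorem IsWidth.re_star_dotProduct_nonneg {Θ : Matrix (Fin d) (Fin d) ℂ} (hΘ : IsWidth Θ)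
    (a : Fin d → ℂ) : 0 ≤ (star a ⬝ᵥ Θ *ᵥ a).re := by
  rw [hΘ.re_star_dotProduct]
  have h1 := hΘ.posDef.posSemidef.dotProduct_mulVec_nonneg (fun j => (a j).re)
  have h2 := hΘ.posDef.posSemidef.dotProduct_mulVec_nonneg (fun j => (a j).im)
  simp only [star_trivial] at h1 h2
  exact add_nonneg h1 h2

theorem IsWidth.eq_zero_of_re {Θ : Matrix (Fin d) (Fin d) ℂ} (hΘ : IsWidth Θ)
    {a : Fin d → ℂ} (h : (star a ⬝ᵥ Θ *ᵥ a).re = 0) : a = 0 := by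
  rw [hΘ.re_star_dotProduct] at h
  have h1 := hΘ.posDef.posSemidef.dotProduct_mulVec_nonneg (fun j => (a j).re)
  have h2 := hΘ.posDef.posSemidef.dotProduct_mulVec_nonneg (fun j => (a j).im)
  simp only [star_trivial] at h1 h2
  have hpos : ∀ x : Fin d → ℝ, x ⬝ᵥ Θ.map Complex.re *ᵥ x = 0 → x = 0 := by
    intro x hx
    by_contra hne
    have := hΘ.posDef.dotProduct_mulVec_pos hne
    simp only [star_trivial] at this
    linarith
  have e1 := hpos _
    (by linarith : (fun j => (a j).re) ⬝ᵥ Θ.map Complex.re *ᵥ (fun j => (a j).re) = 0)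
  have e2 := hpos _
    (by linarith : (fun j => (a j).im) ⬝ᵥ Θ.map Complex.re *ᵥ (fun j => (a j).im) = 0)
  funext j
  exact Complex.ext (congrFun e1 j) (congrFun e2 j)

theorem IsWidth.isUnit_det {Θ : Matrix (Fin d) (Fin d) ℂ} (hΘ : IsWidth Θ) : IsUnit Θ.det := by
  rw [isUnit_iff_ne_zero]
  intro h
  obtain ⟨v, hv, h0⟩ := Matrix.exists_mulVec_eq_zero_iff.2 h
  exact hv (hΘ.eq_zero_of_re (by simp [h0]))

/-- The matrix `𝒵` in terms of the Jacobian matrix. -/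
noncomputable def zmatOf (F : Matrix (Fin d ⊕ Fin d) (Fin d ⊕ Fin d) ℝ)
    (Θx Θy : Matrix (Fin d) (Fin d) ℂ) : Matrix (Fin d) (Fin d) ℂ :=
  (Θy⁻¹ * (F.toBlocks₁₁.map Complex.ofReal)ᵀ - Complex.I • (F.toBlocks₁₂.map Complex.ofReal)ᵀ) * Θx
    + Complex.I • (Θy⁻¹ * (F.toBlocks₂₁.map Complex.ofReal)ᵀ -
      Complex.I • (F.toBlocks₂₂.map Complex.ofReal)ᵀ)

/-- F is real, so its conjugate transpose is its transpose and the symplectic relation extends to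
the sesquilinear form. -/
theorem symplectic_star_dotProduct {F : Matrix (Fin d ⊕ Fin d) (Fin d ⊕ Fin d) ℝ}
    (hF : Fᵀ * sympJ d * F = sympJ d) (v : Fin d ⊕ Fin d → ℂ) :
    star (F.map Complex.ofReal *ᵥ v) ⬝ᵥ (sympJ d).map Complex.ofReal *ᵥ (F.map Complex.ofReal *ᵥ v)
      = star v ⬝ᵥ (sympJ d).map Complex.ofReal *ᵥ v := by
  have h : (F.map Complex.ofReal)ᴴ * (sympJ d).map Complex.ofReal * F.map Complex.ofReal =
      (sympJ d).map Complex.ofReal := by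
    have h1 := congrArg (fun M => M.map (Complex.ofRealHom : ℝ →+* ℂ)) hF
    simp only [Matrix.map_mul] at h1
    have h2 : (F.map Complex.ofReal)ᴴ = Fᵀ.map Complex.ofRealHom := by
      ext i j
      simp
    rw [h2]
    exact h1
  rw [star_mulVec, ← dotProduct_mulVec, mulVec_mulVec, mulVec_mulVec, h]

theorem star_dotProduct_sympJ (a b : Fin d → ℂ) :
    star (Sum.elim a b) ⬝ᵥ (sympJ d).map Complex.ofReal *ᵥ Sum.elim a b =
      star a ⬝ᵥ b - star b ⬝ᵥ a := by
  have h : (sympJ d).map Complex.ofReal = Matrix.fromBlocks 0 1 (-1) 0 := by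
    ext i j
    rcases i with i | i <;> rcases j with j | j <;>
      simp [sympJ, Matrix.one_apply, apply_ite Complex.ofReal]
  rw [h, Matrix.fromBlocks_mulVec]
  simp [dotProduct, Fintype.sum_sum_type, sub_eq_add_neg, Matrix.neg_mulVec]

/-- If ξ^†𝒵 = 0, put a = Θy⁻¹ξ, b = -iΘy a and (α, β) = F(a, b). The null equation says β = iΘx α,
so the sesquilinear symplectic form is 2i Re⟨α, Θx α⟩ at (α, β) and -2i Re⟨a, Θy a⟩ at (a, b). These
agree, and both real parts are nonnegative; hence a = 0 and ξ = Θy a = 0. -/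
theorem isUnit_det_zmatOf {F : Matrix (Fin d ⊕ Fin d) (Fin d ⊕ Fin d) ℝ}
    {Θx Θy : Matrix (Fin d) (Fin d) ℂ} (hF : Fᵀ * sympJ d * F = sympJ d) (hΘx : IsWidth Θx)
    (hΘy : IsWidth Θy) : (zmatOf F Θx Θy).det ≠ 0 := by
  intro hdet
  obtain ⟨ξ, hξ, h0⟩ := Matrix.exists_vecMul_eq_zero_iff.2 hdet
  set a : Fin d → ℂ := ξ ᵥ* Θy⁻¹ with ha
  set b : Fin d → ℂ := -(Complex.I • ξ) with hb
  set α : Fin d → ℂ := F.toBlocks₁₁.map Complex.ofReal *ᵥ a + F.toBlocks₁₂.map Complex.ofReal *ᵥ b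
    with hα
  set β : Fin d → ℂ := F.toBlocks₂₁.map Complex.ofReal *ᵥ a + F.toBlocks₂₂.map Complex.ofReal *ᵥ b
    with hβ
  have hξa : Θy *ᵥ a = ξ := by
    rw [← Matrix.vecMul_transpose, hΘy.symm.eq, ha, Matrix.vecMul_vecMul,
      Matrix.nonsing_inv_mul _ hΘy.isUnit_det, Matrix.vecMul_one]
  have hz : Θx *ᵥ α + Complex.I • β = 0 := by
    rw [← h0, zmatOf, Matrix.vecMul_add, ← Matrix.vecMul_vecMul, Matrix.vecMul_smul,
      Matrix.vecMul_sub, Matrix.vecMul_sub, ← Matrix.vecMul_vecMul, ← Matrix.vecMul_vecMul,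
      Matrix.vecMul_smul, Matrix.vecMul_smul, Matrix.vecMul_transpose, Matrix.vecMul_transpose,
      Matrix.vecMul_transpose, Matrix.vecMul_transpose, ← ha, hα, hβ, hb, Matrix.mulVec_neg,
      Matrix.mulVec_neg, Matrix.mulVec_smul, Matrix.mulVec_smul, ← sub_eq_add_neg,
      ← sub_eq_add_neg, ← Matrix.vecMul_transpose Θx, hΘx.symm.eq]
  have hβ' : β = Complex.I • Θx *ᵥ α := by
    have : Complex.I • (Θx *ᵥ α + Complex.I • β) = 0 := by rw [hz, smul_zero]
    rw [smul_add, smul_smul, Complex.I_mul_I, neg_one_smul] at this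
    exact (eq_of_sub_eq_zero (by rw [← this]; abel)).symm
  have hFv : F.map Complex.ofReal *ᵥ Sum.elim a b = Sum.elim α β := by
    have : F.map Complex.ofReal = Matrix.fromBlocks (F.toBlocks₁₁.map Complex.ofReal)
        (F.toBlocks₁₂.map Complex.ofReal) (F.toBlocks₂₁.map Complex.ofReal)
        (F.toBlocks₂₂.map Complex.ofReal) := by
      rw [← Matrix.fromBlocks_map, Matrix.fromBlocks_toBlocks]
    rw [this, Matrix.fromBlocks_mulVec]
    simp [hα, hβ, Function.comp_def]
  have key := symplectic_star_dotProduct hF (Sum.elim a b)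
  rw [hFv, star_dotProduct_sympJ, star_dotProduct_sympJ, hβ', hb, ← hξa] at key
  have hconj : ∀ (Θ : Matrix (Fin d) (Fin d) ℂ) (c : Fin d → ℂ),
      star (Θ *ᵥ c) ⬝ᵥ c = star (star c ⬝ᵥ Θ *ᵥ c) := fun Θ c => by
    rw [Matrix.star_dotProduct]
  simp only [dotProduct_smul, star_smul, smul_dotProduct, hconj, dotProduct_neg, star_neg,
    neg_dotProduct, smul_eq_mul] at key
  -- The imaginary part of the identity says that the two real parts are opposite to each other.
  have key2 := congrArg Complex.im key
  simp at key2
  have p1 := hΘx.re_star_dotProduct_nonneg α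
  have p2 := hΘy.re_star_dotProduct_nonneg a
  have ha0 : a = 0 := hΘy.eq_zero_of_re (by linarith)
  exact hξ (by rw [← hξa, ha0, Matrix.mulVec_zero])

theorem dz_ofReal_clm {κ : Phase d → Phase d} (Θy : Matrix (Fin d) (Fin d) ℂ) (j : Fin d)
    (ℓ : Phase d →L[ℝ] ℝ) {z : Phase d} (hκ : DifferentiableAt ℝ κ z) :
    dz Θy j (fun z' => ((ℓ (κ z') : ℝ) : ℂ)) z =
      ∑ i, Θy⁻¹ j i * ((ℓ (fderiv ℝ κ z (basisVec i, 0)) : ℝ) : ℂ) -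
        Complex.I * ((ℓ (fderiv ℝ κ z (0, basisVec j)) : ℝ) : ℂ) := by
  have h : ∀ v, fderiv ℝ (fun z' => ((ℓ (κ z') : ℝ) : ℂ)) z v = ((ℓ (fderiv ℝ κ z v) : ℝ) : ℂ) := by
    intro v
    have := (Complex.ofRealCLM.hasFDerivAt.comp z (ℓ.hasFDerivAt.comp z hκ.hasFDerivAt)).fderiv
    exact congrArg (fun L => L v) this
  simp only [dz, h]

theorem Xz_apply {κ : Phase d → Phase d} (Θy : Matrix (Fin d) (Fin d) ℂ) {z : Phase d}
    (hκ : DifferentiableAt ℝ κ z) (j k : Fin d) : Xz Θy κ z j k =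
      ∑ i, Θy⁻¹ j i * ((jacobian κ z (Sum.inl k) (Sum.inl i) : ℝ) : ℂ) -
        Complex.I * ((jacobian κ z (Sum.inl k) (Sum.inr j) : ℝ) : ℂ) :=
  dz_ofReal_clm Θy j (posCoord k) hκ

theorem zgrad_mom_apply {κ : Phase d → Phase d} (Θy : Matrix (Fin d) (Fin d) ℂ) {z : Phase d}
    (hκ : DifferentiableAt ℝ κ z) (j k : Fin d) : zgrad Θy (fun z' => toC (κ z').2) z j k =
      ∑ i, Θy⁻¹ j i * ((jacobian κ z (Sum.inr k) (Sum.inl i) : ℝ) : ℂ) -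
        Complex.I * ((jacobian κ z (Sum.inr k) (Sum.inr j) : ℝ) : ℂ) :=
  dz_ofReal_clm Θy j (momCoord k) hκ

theorem Zmat_eq {κ : Phase d → Phase d} (Θx Θy : Matrix (Fin d) (Fin d) ℂ) {z : Phase d}
    (hκ : DifferentiableAt ℝ κ z) : Zmat Θx Θy κ z = zmatOf (jacobian κ z) Θx Θy := by
  have h1 : Xz Θy κ z = Θy⁻¹ * ((jacobian κ z).toBlocks₁₁.map Complex.ofReal)ᵀ -
      Complex.I • ((jacobian κ z).toBlocks₁₂.map Complex.ofReal)ᵀ := by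
    ext j k
    rw [Xz_apply Θy hκ]
    simp [Matrix.mul_apply, Matrix.toBlocks₁₁, Matrix.toBlocks₁₂]
  have h2 : zgrad Θy (fun z' => toC (κ z').2) z =
      Θy⁻¹ * ((jacobian κ z).toBlocks₂₁.map Complex.ofReal)ᵀ -
      Complex.I • ((jacobian κ z).toBlocks₂₂.map Complex.ofReal)ᵀ := by
    ext j k
    rw [zgrad_mom_apply Θy hκ]
    simp [Matrix.mul_apply, Matrix.toBlocks₂₁, Matrix.toBlocks₂₂]
  rw [Zmat, h1, h2, zmatOf]

theorem isUnit_det_Zmat {κ : Phase d → Phase d} (hκ : IsCanonical κ)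
    {Θx Θy : Matrix (Fin d) (Fin d) ℂ} (hΘx : IsWidth Θx) (hΘy : IsWidth Θy) (z : Phase d) :
    IsUnit (Zmat Θx Θy κ z).det := by
  rw [Zmat_eq Θx Θy (hκ.smooth.differentiable (by simp) z), isUnit_iff_ne_zero]
  exact isUnit_det_zmatOf (hκ.symplectic z) hΘx hΘy

theorem exists_pos_le_of_isCompact {X : Type*} [TopologicalSpace X] {K : Set X} (hK : IsCompact K)
    {f : X → ℝ} (hf : ContinuousOn f K) (hpos : ∀ x ∈ K, 0 < f x) :
    ∃ c : ℝ, 0 < c ∧ ∀ x ∈ K, c ≤ f x := by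
  rcases K.eq_empty_or_nonempty with rfl | hne
  · exact ⟨1, one_pos, fun x hx => absurd hx (Set.notMem_empty x)⟩
  · obtain ⟨x, hx, hmin⟩ := hK.exists_isMinOn hne hf
    exact ⟨f x, hpos x hx, fun y hy => hmin hy⟩

theorem continuous_zmatOf (Θy : Matrix (Fin d) (Fin d) ℂ) :
    Continuous fun p : Matrix (Fin d ⊕ Fin d) (Fin d ⊕ Fin d) ℝ × Matrix (Fin d) (Fin d) ℂ =>
      zmatOf p.1 p.2 Θy := by
  have hblock : ∀ f g : Fin d → Fin d ⊕ Fin d,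
      Continuous fun p : Matrix (Fin d ⊕ Fin d) (Fin d ⊕ Fin d) ℝ × Matrix (Fin d) (Fin d) ℂ =>
        (Matrix.of fun i j => ((p.1 (f i) (g j) : ℝ) : ℂ))ᵀ := by
    intro f g
    refine continuous_matrix fun i j => ?_
    simp only [transpose_apply, of_apply]
    exact Complex.continuous_ofReal.comp (continuous_fst.matrix_elem _ _)
  unfold zmatOf
  refine Continuous.add (Continuous.mul (Continuous.sub ?_ ?_) continuous_snd) ?_
  · exact continuous_const.mul (hblock Sum.inl Sum.inl)
  · exact Continuous.const_smul (hblock Sum.inl Sum.inr) Complex.I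
  · refine Continuous.const_smul (Continuous.sub ?_ ?_) Complex.I
    · exact continuous_const.mul (hblock Sum.inr Sum.inl)
    · exact Continuous.const_smul (hblock Sum.inr Sum.inr) Complex.I

/-- The determinant of `𝒵` is bounded away from zero, locally uniformly in time. -/
theorem exists_le_norm_det_Zmat {κ : ℝ → Phase d → Phase d} (hκ : IsClassBFamily κ)
    {Θx : ℝ → Matrix (Fin d) (Fin d) ℂ} (hΘx : ∀ t, IsWidth (Θx t)) (hΘxc : Continuous Θx)
    {Θy : Matrix (Fin d) (Fin d) ℂ} (hΘy : IsWidth Θy) (T : ℝ) :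
    ∃ c : ℝ, 0 < c ∧ ∀ t ∈ Set.Icc (-T) T, ∀ z, c ≤ ‖(Zmat (Θx t) Θy (κ t) z).det‖ := by
  obtain ⟨C, hC⟩ := hκ.bounded 0 T
  -- 𝒵 depends on z only through F, and continuously on F and Θx. Symplectic matrices with entries
  -- bounded by `C` form a compact set, on which the modulus of the determinant has a positive lower
  -- bound together with t in the compact interval.
  let K₀ : Set (Matrix (Fin d ⊕ Fin d) (Fin d ⊕ Fin d) ℝ) :=
    (Set.pi Set.univ fun _ => Set.pi Set.univ fun _ => Set.Icc (-C) C) ∩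
      {F | Fᵀ * sympJ d * F = sympJ d}
  have hK₀ : IsCompact K₀ := by
    refine IsCompact.inter_right ?_ (isClosed_eq ?_ continuous_const)
    · exact isCompact_univ_pi fun _ => isCompact_univ_pi fun _ => isCompact_Icc
    · exact (Continuous.mul (continuous_id.matrix_transpose.mul continuous_const) continuous_id)
  obtain ⟨c, hc, h⟩ := exists_pos_le_of_isCompact (hK₀.prod (isCompact_Icc (a := -T) (b := T)))
    (f := fun p => ‖(zmatOf p.1 (Θx p.2) Θy).det‖)
    (Continuous.continuousOn (((continuous_zmatOf Θy).comp
      (continuous_fst.prodMk (hΘxc.comp continuous_snd))).matrix_det.norm))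
    (fun p hp => norm_pos_iff.2 (isUnit_det_zmatOf hp.1.2 (hΘx _) hΘy))
  refine ⟨c, hc, fun t ht z => ?_⟩
  rw [Zmat_eq _ _ (hκ.differentiable t z)]
  refine h (jacobian (κ t) z, t) ⟨⟨fun i _ j _ => ?_, (hκ.canonical t).symplectic z⟩, ht⟩
  have := hC t ht z i j
  rw [norm_iteratedFDeriv_zero, Real.norm_eq_abs] at this
  exact abs_le.1 this

end Widths

/-! ### Symbols of order zero and the symbol classes of v₀, v₁, v₂ -/

section ZeroOrder

variable {d : ℕ} {ε₀ : ℝ} {w : Phase d → ℝ}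

namespace TimeFam

theorem const_mul {a : ℝ → ℝ → Phase d → ℂ} (ha : TimeFam ε₀ w a) (c : ℂ) :
    TimeFam ε₀ w (fun ε t z => c * a ε t z) :=
  ha.clm (ContinuousLinearMap.mul ℝ ℂ c)

theorem neg {a : ℝ → ℝ → Phase d → ℂ} (ha : TimeFam ε₀ w a) :
    TimeFam ε₀ w (fun ε t z => -a ε t z) := by
  simpa using ha.const_mul (-1)

theorem sub {a b : ℝ → ℝ → Phase d → ℂ} (ha : TimeFam ε₀ w a) (hb : TimeFam ε₀ w b) :
    TimeFam ε₀ w (fun ε t z => a ε t z - b ε t z) := by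
  simpa [sub_eq_add_neg] using ha.add hb.neg

theorem mul_zeroOrder {a b : ℝ → ℝ → Phase d → ℂ} (ha : TimeFam ε₀ w a)
    (hb : TimeFam ε₀ (fun _ => 1) b) : TimeFam ε₀ w (fun ε t z => a ε t z * b ε t z) :=
  (ha.mul hb).congr_weight fun _ => mul_one _

theorem ofReal {a : ℝ → ℝ → Phase d → ℝ} (ha : TimeFam ε₀ w a) :
    TimeFam ε₀ w (fun ε t z => ((a ε t z : ℝ) : ℂ)) :=
  ha.clm Complex.ofRealCLM

theorem prod_zeroOrder {κ : Type*} {s : Finset κ} {a : κ → ℝ → ℝ → Phase d → ℂ}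
    (h : ∀ j ∈ s, TimeFam ε₀ (fun _ => 1) (a j)) :
    TimeFam ε₀ (fun _ => 1) (fun ε t z => ∏ j ∈ s, a j ε t z) := by
  classical
  induction s using Finset.induction_on with
  | empty => simpa using TimeFam.const (c := fun _ => (1 : ℂ)) continuous_const
  | insert j s hj ih =>
    simp only [Finset.prod_insert hj]
    exact (h j (Finset.mem_insert_self _ _)).mul_zeroOrder
      (ih fun k hk => h k (Finset.mem_insert_of_mem hk))

theorem det {M : ℝ → ℝ → Phase d → Matrix (Fin d) (Fin d) ℂ}
    (h : ∀ i j, TimeFam ε₀ (fun _ => 1) (fun ε t z => M ε t z i j)) :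
    TimeFam ε₀ (fun _ => 1) (fun ε t z => (M ε t z).det) := by
  simp only [Matrix.det_apply']
  exact TimeFam.sum continuous_const (fun _ => one_pos) fun σ _ =>
    (prod_zeroOrder fun i _ => h (σ i) i).const_mul _

/-- Cramer's rule: the adjugate is polynomial in the entries, and the determinant is a symbol of
order zero bounded away from zero. -/
theorem matrix_inv {M : ℝ → ℝ → Phase d → Matrix (Fin d) (Fin d) ℂ}
    (h : ∀ i j, TimeFam ε₀ (fun _ => 1) (fun ε t z => M ε t z i j))
    (hdet : ∀ T : ℝ, ∃ c : ℝ, 0 < c ∧ ∀ (ε : Set.Ioc 0 ε₀), ∀ t ∈ Set.Icc (-T) T, ∀ z,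
      c ≤ ‖(M ε t z).det‖) (i j : Fin d) :
    TimeFam ε₀ (fun _ => 1) (fun ε t z => (M ε t z)⁻¹ i j) := by
  simp only [Matrix.inv_def, Ring.inverse_eq_inv', Matrix.smul_apply, smul_eq_mul]
  refine TimeFam.mul_zeroOrder (((TimeFam.det h).inv fun T => ?_).congr_weight fun _ => inv_one) ?_
  · obtain ⟨c, hc, hb⟩ := hdet T
    exact ⟨c, hc, fun ε t ht z => by simpa using hb ε t ht z⟩
  · simp only [Matrix.adjugate_apply]
    refine TimeFam.det fun k l => ?_
    simp only [Matrix.updateRow_apply]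
    split_ifs
    · exact TimeFam.const continuous_const
    · exact h k l

end TimeFam

/-- The value of `∂_{z_j} f` as a function of the differential of `f`. -/
noncomputable def dzCLM (Θy : Matrix (Fin d) (Fin d) ℂ) (j : Fin d) :
    (Phase d →L[ℝ] ℂ) →L[ℝ] ℂ :=
  ∑ i, Θy⁻¹ j i • ContinuousLinearMap.apply ℝ ℂ ((basisVec i, 0) : Phase d) -
    Complex.I • ContinuousLinearMap.apply ℝ ℂ ((0, basisVec j) : Phase d)

theorem dz_eq (Θy : Matrix (Fin d) (Fin d) ℂ) (j : Fin d) (f : Phase d → ℂ) (z : Phase d) :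
    dz Θy j f z = dzCLM Θy j (fderiv ℝ f z) := by
  simp [dz, dzCLM, sum_apply]

theorem TimeFam.dz {a : ℝ → ℝ → Phase d → ℂ} (ha : TimeFam ε₀ w a)
    (Θy : Matrix (Fin d) (Fin d) ℂ) (j : Fin d) :
    TimeFam ε₀ w (fun ε t z => dz Θy j (a ε t) z) := by
  simp only [dz_eq]
  exact ha.fderiv.clm (dzCLM Θy j)

variable {κ : ℝ → Phase d → Phase d} {Θx : ℝ → Matrix (Fin d) (Fin d) ℂ}
  {Θy : Matrix (Fin d) (Fin d) ℂ}

theorem Xz_timeFam (hκ : IsClassBFamily κ) (ε₀ : ℝ) (Θy : Matrix (Fin d) (Fin d) ℂ) (i j : Fin d) :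
    TimeFam ε₀ (fun _ => 1) (fun _ t z => Xz Θy (κ t) z i j) := by
  simp only [fun t z => Xz_apply Θy (hκ.differentiable t z)]
  exact (TimeFam.sum continuous_const (fun _ => one_pos) fun k _ =>
    (hκ.jacobian_timeFam ε₀ _ _).ofReal.const_mul _).sub
      ((hκ.jacobian_timeFam ε₀ _ _).ofReal.const_mul _)

theorem zgrad_mom_timeFam (hκ : IsClassBFamily κ) (ε₀ : ℝ) (Θy : Matrix (Fin d) (Fin d) ℂ)
    (i j : Fin d) : TimeFam ε₀ (fun _ => 1)
      (fun _ t z => zgrad Θy (fun z' => toC (κ t z').2) z i j) := by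
  simp only [fun t z => zgrad_mom_apply Θy (hκ.differentiable t z)]
  exact (TimeFam.sum continuous_const (fun _ => one_pos) fun k _ =>
    (hκ.jacobian_timeFam ε₀ _ _).ofReal.const_mul _).sub
      ((hκ.jacobian_timeFam ε₀ _ _).ofReal.const_mul _)

theorem Zmat_timeFam (hκ : IsClassBFamily κ) (hΘxc : ∀ i j, Continuous fun t => Θx t i j) (ε₀ : ℝ)
    (Θy : Matrix (Fin d) (Fin d) ℂ) (i j : Fin d) :
    TimeFam ε₀ (fun _ => 1) (fun _ t z => Zmat (Θx t) Θy (κ t) z i j) := by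
  simp only [Zmat, Matrix.add_apply, Matrix.mul_apply, Matrix.smul_apply, smul_eq_mul]
  exact (TimeFam.sum continuous_const (fun _ => one_pos) fun k _ =>
    (Xz_timeFam hκ ε₀ Θy i k).mul_zeroOrder (TimeFam.const (hΘxc k j))).add
      ((zgrad_mom_timeFam hκ ε₀ Θy i j).const_mul _)

theorem Zinv_timeFam (hκ : IsClassBFamily κ) (hΘx : ∀ t, IsWidth (Θx t))
    (hΘxc : ∀ i j, Continuous fun t => Θx t i j) (hΘy : IsWidth Θy) (ε₀ : ℝ) (i j : Fin d) :
    TimeFam ε₀ (fun _ => 1) (fun _ t z => (Zmat (Θx t) Θy (κ t) z)⁻¹ i j) := by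
  refine TimeFam.matrix_inv (Zmat_timeFam hκ hΘxc ε₀ Θy) (fun T => ?_) i j
  obtain ⟨c, hc, h⟩ := exists_le_norm_det_Zmat hκ hΘx (continuous_matrix hΘxc) hΘy T
  exact ⟨c, hc, fun _ => h⟩

theorem IsClassBFamily.dtX_eq (hκ : IsClassBFamily κ) (t : ℝ) (z : Phase d) :
    dtX κ t z = (dtMap κ t z).1 :=
  ((ContinuousLinearMap.fst ℝ (Conf d) (Conf d)).hasFDerivAt.comp_hasDerivAt t
    (hκ.hasDerivAt z t)).deriv

theorem IsClassBFamily.dtXi_eq (hκ : IsClassBFamily κ) (t : ℝ) (z : Phase d) :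
    dtXi κ t z = (dtMap κ t z).2 :=
  ((ContinuousLinearMap.snd ℝ (Conf d) (Conf d)).hasFDerivAt.comp_hasDerivAt t
    (hκ.hasDerivAt z t)).deriv

theorem dtX_timeFam (hκ : IsClassBFamily κ) (ε₀ : ℝ) (j : Fin d) :
    TimeFam ε₀ (fun z => (1 + ‖z‖) ^ 1) (fun _ t z => toC (dtX κ t z) j) := by
  simp only [hκ.dtX_eq]
  exact ((hκ.dtMap_timeFam ε₀).clm (posCoord j)).ofReal

theorem dtXi_timeFam (hκ : IsClassBFamily κ) (ε₀ : ℝ) (j : Fin d) :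
    TimeFam ε₀ (fun z => (1 + ‖z‖) ^ 1) (fun _ t z => toC (dtXi κ t z) j) := by
  simp only [hκ.dtXi_eq]
  exact ((hκ.dtMap_timeFam ε₀).clm (momCoord j)).ofReal

/-! ### The symbols of the time derivative -/

theorem continuous_orderFun (mq mp : ℝ) : Continuous (orderFun (d := d) mq mp) := by
  unfold orderFun
  refine Continuous.mul ?_ ?_
  · exact (by fun_prop : Continuous fun z : Phase d => 1 + ‖z.1‖ ^ 2).rpow_const
      fun z => Or.inl (by positivity)
  · exact (by fun_prop : Continuous fun z : Phase d => 1 + ‖z.2‖ ^ 2).rpow_const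
      fun z => Or.inl (by positivity)

theorem orderFun_pos (mq mp : ℝ) (z : Phase d) : 0 < orderFun mq mp z := by
  unfold orderFun
  positivity

theorem phaseBracket_pos (z : Phase d) : 0 < phaseBracket z := by
  unfold phaseBracket
  positivity

theorem continuous_phaseBracket : Continuous (phaseBracket (d := d)) := by
  unfold phaseBracket
  fun_prop

/-- The norm on a product is the maximum of the two norms, hence at most the Euclidean bracket.
Growth in `1 + ‖z‖` thus turns into powers of ⟨(q,p)⟩. -/
theorem one_add_norm_le_phaseBracket (z : Phase d) : 1 + ‖z‖ ≤ 2 * phaseBracket z := by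
  have h1 : 1 ≤ phaseBracket z := by
    unfold phaseBracket
    exact Real.one_le_sqrt.2 (by nlinarith [sq_nonneg ‖z.1‖, sq_nonneg ‖z.2‖])
  have h2 : ‖z‖ ≤ phaseBracket z := by
    unfold phaseBracket
    refine Real.le_sqrt_of_sq_le ?_
    rw [Prod.norm_def]
    rcases max_cases ‖z.1‖ ‖z.2‖ with h | h <;> rw [h.1] <;>
      nlinarith [sq_nonneg ‖z.1‖, sq_nonneg ‖z.2‖]
  linarith

theorem TimeFam.mono_phaseBracket {a : ℝ → ℝ → Phase d → ℂ} {n : ℕ} (hw : Continuous w)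
    (hpos : ∀ z, 0 < w z) (h : TimeFam ε₀ (fun z => w z * (1 + ‖z‖) ^ n) a) :
    TimeFam ε₀ (fun z => phaseBracket z ^ n * w z) a := by
  refine h.mono ((continuous_phaseBracket.pow n).mul hw)
    (fun z => mul_pos (pow_pos (phaseBracket_pos z) n) (hpos z)) (2 ^ n) (by positivity) fun z => ?_
  rw [mul_comm (w z), ← mul_assoc, ← mul_pow]
  exact mul_le_mul_of_nonneg_right
    (pow_le_pow_left₀ (by positivity) (one_add_norm_le_phaseBracket z) n) (hpos z).le

variable {S : ℝ → Phase d → ℝ} {u : ℝ → ℝ → Phase d → ℂ}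

/-- The time derivative of S has order two, and X'·Ξ is a product of two factors of order one. -/
theorem v0_timeFam (hκ : IsClassBFamily κ) (hS : ∀ t, IsAction (κ t) (S t))
    (hS1 : ∀ z, ContDiff ℝ 1 (fun t => S t z)) (hu : TimeFam ε₀ w u) :
    TimeFam ε₀ (fun z => w z * (1 + ‖z‖) ^ 2) (fun ε => v0 κ S (u ε)) := by
  refine hu.mul (TimeFam.add (dt_action_timeFam hκ hS hS1 ε₀).ofReal.neg ?_)
  refine TimeFam.sum (continuous_one_add_norm_pow 2) (one_add_norm_pow_pos 2) fun j _ => ?_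
  exact ((dtX_timeFam hκ ε₀ j).mul ((hκ.timeFam ε₀).clm (momCoord j)).ofReal).congr_weight
    fun z => by ring

/-- Only the divergence term exceeds the order of u, by the linear growth of the velocities; 𝒵⁻¹ and
X_z have order zero and ∂_z does not change the order. -/
theorem v1_timeFam (hκ : IsClassBFamily κ) (hΘx : ∀ t, IsWidth (Θx t))
    (hΘx1 : ∀ i j, ContDiff ℝ 1 fun t => Θx t i j) (hΘy : IsWidth Θy) (hu : TimeFam ε₀ w u)
    (hu' : TimeFam ε₀ w (fun ε t z => deriv (fun s => u ε s z) t)) :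
    TimeFam ε₀ (fun z => w z * (1 + ‖z‖) ^ 1) (fun ε => v1 κ Θx Θy (u ε)) := by
  have hΘxc := fun i j => (hΘx1 i j).continuous
  have hwc : Continuous fun z : Phase d => w z * (1 + ‖z‖) ^ 1 :=
    hu.weight_cont.mul (continuous_one_add_norm_pow 1)
  have hwp : ∀ z : Phase d, 0 < w z * (1 + ‖z‖) ^ 1 :=
    fun z => mul_pos (hu.weight_pos z) (one_add_norm_pow_pos 1 z)
  have hwle : ∀ z : Phase d, w z ≤ 1 * (w z * (1 + ‖z‖) ^ 1) := fun z => by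
    rw [one_mul, pow_one]
    exact le_mul_of_one_le_right (hu.weight_pos z).le (by linarith [norm_nonneg z])
  refine TimeFam.sub (TimeFam.add ((hu'.const_mul _).mono hwc hwp 1 zero_le_one hwle) ?_)
    (TimeFam.mono ((hu.const_mul _).mul_zeroOrder ?_) hwc hwp 1 zero_le_one hwle)
  · refine TimeFam.sum hwc hwp fun j _ => TimeFam.dz ?_ Θy j
    refine hu.mul ?_
    simp only [Matrix.vecMul, dotProduct, Pi.sub_apply, Pi.smul_apply, smul_eq_mul, Matrix.mulVec]
    refine TimeFam.sum (continuous_one_add_norm_pow 1) (one_add_norm_pow_pos 1)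
      fun l _ => TimeFam.mul_zeroOrder (TimeFam.sub (dtXi_timeFam hκ ε₀ l) ?_)
        (Zinv_timeFam hκ hΘx hΘxc hΘy ε₀ l j)
    refine TimeFam.const_mul (TimeFam.sum (continuous_one_add_norm_pow 1) (one_add_norm_pow_pos 1)
      fun m _ => ?_) _
    exact ((TimeFam.const (hΘxc l m)).mul (dtX_timeFam hκ ε₀ m)).congr_weight fun z => one_mul _
  · simp only [Matrix.trace, Matrix.diag_apply, Matrix.mul_apply]
    refine TimeFam.sum continuous_const (fun _ => one_pos) fun i _ =>
      TimeFam.sum continuous_const (fun _ => one_pos) fun j _ => TimeFam.mul_zeroOrder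
        (TimeFam.sum continuous_const (fun _ => one_pos) fun k _ =>
          (Zinv_timeFam hκ hΘx hΘxc hΘy ε₀ i k).mul_zeroOrder (Xz_timeFam hκ ε₀ Θy k j)) ?_
    exact TimeFam.const ((hΘx1 j i).continuous_deriv le_rfl)

theorem dtMat_Zinv_timeFam (hκ : IsClassBFamily κ) (hΘx : ∀ t, IsWidth (Θx t))
    (hΘx1 : ∀ i j, ContDiff ℝ 1 fun t => Θx t i j) (hΘy : IsWidth Θy) (hu : TimeFam ε₀ w u)
    (l k : Fin d) : TimeFam ε₀ w (fun ε t z =>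
      (dtMat Θx t * (Zmat (Θx t) Θy (κ t) z)⁻¹) l k * u ε t z) := by
  simp only [Matrix.mul_apply]
  refine (TimeFam.mul (w₁ := fun _ => 1) ?_ hu).congr_weight fun z => one_mul _
  refine TimeFam.sum continuous_const (fun _ => one_pos) fun m _ => TimeFam.mul_zeroOrder ?_
    (Zinv_timeFam hκ hΘx (fun i j => (hΘx1 i j).continuous) hΘy ε₀ m k)
  exact TimeFam.const ((hΘx1 l m).continuous_deriv le_rfl)

theorem v2_timeFam (hκ : IsClassBFamily κ) (hΘx : ∀ t, IsWidth (Θx t))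
    (hΘx1 : ∀ i j, ContDiff ℝ 1 fun t => Θx t i j) (hΘy : IsWidth Θy) (hu : TimeFam ε₀ w u) :
    TimeFam ε₀ w (fun ε => v2 κ Θx Θy (u ε)) := by
  refine TimeFam.const_mul (TimeFam.sum hu.weight_cont hu.weight_pos fun k _ =>
    TimeFam.sum hu.weight_cont hu.weight_pos fun j _ => TimeFam.dz ?_ Θy j) _
  simp only [Matrix.vecMul, dotProduct]
  exact TimeFam.sum hu.weight_cont hu.weight_pos fun l _ => TimeFam.mul_zeroOrder
    ((dtMat_Zinv_timeFam hκ hΘx hΘx1 hΘy hu l k).dz Θy k)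
    (Zinv_timeFam hκ hΘx (fun i j => (hΘx1 i j).continuous) hΘy ε₀ l j)

end ZeroOrder

/-! ### Exchange of time and space derivatives -/

section TimeDerivatives

variable {E F : Type} [NormedAddCommGroup E] [NormedSpace ℝ E] [FiniteDimensional ℝ E]
  [NormedAddCommGroup F] [NormedSpace ℝ F] [CompleteSpace F]

/-- The time derivative commutes with the spatial derivative, if the time derivative is a symbol
family. -/
theorem hasDerivAt_fderiv_of_hasDerivAt {w : E → ℝ} {f f' : ℝ → E → F}
    (hf : ∀ t, Differentiable ℝ (f t)) (hf' : TimeFam 1 w (fun _ => f'))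
    (hd : ∀ x t, HasDerivAt (fun s => f s x) (f' t x) t) (x : E) (t : ℝ) :
    HasDerivAt (fun s => fderiv ℝ (f s) x) (fderiv ℝ (f' t) x) t := by
  let one : Set.Ioc (0 : ℝ) 1 := ⟨1, one_pos, le_rfl⟩
  have hc : Continuous fun p : ℝ × E => f' p.1 p.2 := hf'.continuous_uncurry one
  have hc' : Continuous fun p : ℝ × E => fderiv ℝ (f' p.1) p.2 := hf'.fderiv.continuous_uncurry one
  have hcx : ∀ x, Continuous fun s => f' s x :=
    fun x => hc.comp (by fun_prop : Continuous fun s => (s, x))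
  have hcx' : ∀ x, Continuous fun s => fderiv ℝ (f' s) x :=
    fun x => hc'.comp (by fun_prop : Continuous fun s => (s, x))
  -- The fundamental theorem of calculus in time, with the spatial differential taken under the
  -- integral.
  have key : ∀ s, fderiv ℝ (f s) x = fderiv ℝ (f t) x + ∫ r in t..s, fderiv ℝ (f' r) x := by
    intro s
    obtain ⟨M, hM⟩ := (isCompact_uIcc (a := t) (b := s)).prod (isCompact_closedBall x 1)
      |>.exists_bound_of_continuousOn hc'.continuousOn
    have h1 : HasFDerivAt (fun y => ∫ r in t..s, f' r y) (∫ r in t..s, fderiv ℝ (f' r) x) x := by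
      refine intervalIntegral.hasFDerivAt_integral_of_dominated_of_fderiv_le (𝕜 := ℝ)
        (F' := fun y r => fderiv ℝ (f' r) y) (bound := fun _ => M)
        (s := Metric.closedBall x 1) (Metric.closedBall_mem_nhds x one_pos)
        (Eventually.of_forall fun y => (hcx y).aestronglyMeasurable)
        ((hcx x).intervalIntegrable _ _) (hcx' x).aestronglyMeasurable ?_
        intervalIntegrable_const ?_
      · exact Eventually.of_forall fun r hr y hy => hM (r, y) ⟨Set.uIoc_subset_uIcc hr, hy⟩
      · exact Eventually.of_forall fun r _ y _ => (hf'.differentiable one r y).hasFDerivAt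
    have h2 : (fun y => ∫ r in t..s, f' r y) = fun y => f s y - f t y := funext fun y =>
      intervalIntegral.integral_eq_sub_of_hasDerivAt (fun r _ => hd y r)
        ((hcx y).intervalIntegrable _ _)
    rw [h2] at h1
    have h3 := h1.unique ((hf s x).hasFDerivAt.sub (hf t x).hasFDerivAt)
    rw [h3]
    abel
  have h4 : HasDerivAt (fun s => fderiv ℝ (f t) x + ∫ r in t..s, fderiv ℝ (f' r) x)
      (fderiv ℝ (f' t) x) t :=
    (intervalIntegral.integral_hasDerivAt_right ((hcx' x).intervalIntegrable _ _)
      ((hcx' x).stronglyMeasurableAtFilter _ _) (hcx' x).continuousAt).const_add _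
  exact h4.congr_of_eventuallyEq (Eventually.of_forall key)

/-- The mean value inequality in time at a single point x: only the derivatives at that x have to be
bounded, so weights in x can be carried through. -/
theorem norm_iteratedFDeriv_sub_le {w : E → ℝ} (k : ℕ) :
    ∀ {F : Type} [NormedAddCommGroup F] [NormedSpace ℝ F] [CompleteSpace F] {f f' : ℝ → E → F},
    (∀ t, ContDiff ℝ ∞ (f t)) → TimeFam 1 w (fun _ => f') →
    (∀ x t, HasDerivAt (fun s => f s x) (f' t x) t) → ∀ (s t C : ℝ) (x : E),
    (∀ r ∈ Set.uIcc t s, ‖iteratedFDeriv ℝ k (f' r) x‖ ≤ C) →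
    ‖iteratedFDeriv ℝ k (fun x => f s x - f t x) x‖ ≤ C * |s - t| := by
  induction k with
  | zero =>
    intro F _ _ _ f f' hf hf' hd s t C x hC
    rw [norm_iteratedFDeriv_zero]
    exact (convex_uIcc t s).norm_image_sub_le_of_norm_hasDerivWithin_le
      (fun r _ => (hd x r).hasDerivWithinAt) (fun r hr => by simpa using hC r hr)
      Set.left_mem_uIcc Set.right_mem_uIcc
  | succ k ih =>
    intro F _ _ _ f f' hf hf' hd s t C x hC
    have hdf : ∀ t, Differentiable ℝ (f t) := fun t => (hf t).differentiable (by simp)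
    rw [← norm_iteratedFDeriv_fderiv]
    have h1 : fderiv ℝ (fun x => f s x - f t x) = fun x => fderiv ℝ (f s) x - fderiv ℝ (f t) x :=
      funext fun y => fderiv_fun_sub (hdf s y) (hdf t y)
    rw [h1]
    refine ih (f := fun t => fderiv ℝ (f t)) (f' := fun t => fderiv ℝ (f' t))
      (fun t => (hf t).fderiv_right (by simp)) hf'.fderiv
      (hasDerivAt_fderiv_of_hasDerivAt hdf hf' hd) s t C x fun r hr => ?_
    rw [norm_iteratedFDeriv_fderiv]
    exact hC r hr

end TimeDerivatives

/-! ### Convergence and differentiation in Schwartz space -/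

section Schwartz

variable {H : Type*} {E : Type} [NormedAddCommGroup E] [NormedSpace ℝ E] [FiniteDimensional ℝ E]
  {F : Type} [NormedAddCommGroup F] [NormedSpace ℝ F]

/-- Pointwise convergence to zero with locally bounded derivatives is locally uniform, for all
derivatives. -/
theorem eventually_iteratedFDeriv_le_of_isCompact {l : Filter H} {f : H → E → F}
    (hf : ∀ᶠ η in l, ContDiff ℝ ∞ (f η))
    (hb : ∀ k : ℕ, ∃ C : ℝ, ∀ᶠ η in l, ∀ x, ‖iteratedFDeriv ℝ k (f η) x‖ ≤ C)
    (h0 : ∀ x, Tendsto (fun η => f η x) l (𝓝 0)) {K : Set E} (hK : IsCompact K) (k : ℕ)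
    {δ : ℝ} (hδ : 0 < δ) : ∀ᶠ η in l, ∀ x ∈ K, ‖iteratedFDeriv ℝ k (f η) x‖ ≤ δ := by
  refine hK.induction_on (p := fun s => ∀ᶠ η in l, ∀ x ∈ s, ‖iteratedFDeriv ℝ k (f η) x‖ ≤ δ)
    (by simp) (fun s t hst h => h.mono fun η h x hx => h x (hst hx))
    (fun s t hs ht => ?_) fun x _ => ?_
  · filter_upwards [hs, ht] with η h1 h2 x hx
    exact hx.elim (h1 x) (h2 x)
  · obtain ⟨C, hC⟩ := hb (k + 1)
    have h1 := tendsto_iteratedFDeriv_zero k hf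
      (fun k z => (hb k).imp fun C h => h.mono fun η h z' _ => h z') h0 x
    have h2 := Metric.tendsto_nhds.1 h1 (δ / 2) (by positivity)
    -- With this radius the mean value inequality changes the derivative by at most δ/2 over the
    -- ball.
    refine ⟨Metric.ball x (δ / (2 * (|C| + 1))),
      mem_nhdsWithin_of_mem_nhds (Metric.ball_mem_nhds x (by positivity)), ?_⟩
    filter_upwards [hf, hC, h2] with η hη hCη h2η y hy
    rw [dist_zero_right] at h2η
    have h3 : ‖iteratedFDeriv ℝ k (f η) y - iteratedFDeriv ℝ k (f η) x‖ ≤ C * ‖y - x‖ := by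
      refine convex_univ.norm_image_sub_le_of_norm_fderiv_le (𝕜 := ℝ)
        (fun z _ => (hη.differentiable_iteratedFDeriv (by exact_mod_cast WithTop.coe_lt_top _)) z)
        (fun z _ => ?_) (Set.mem_univ _) (Set.mem_univ _)
      rw [norm_fderiv_iteratedFDeriv]
      exact hCη z
    have h4 : ‖y - x‖ ≤ δ / (2 * (|C| + 1)) := by
      rw [← dist_eq_norm]
      exact (Metric.mem_ball.1 hy).le
    have h5 : C * ‖y - x‖ ≤ δ / 2 := by
      calc C * ‖y - x‖ ≤ (|C| + 1) * ‖y - x‖ := by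
            gcongr
            linarith [le_abs_self C]
        _ ≤ (|C| + 1) * (δ / (2 * (|C| + 1))) := by gcongr
        _ = δ / 2 := by field_simp
    have h6 := norm_add_le (iteratedFDeriv ℝ k (f η) y - iteratedFDeriv ℝ k (f η) x)
      (iteratedFDeriv ℝ k (f η) x)
    rw [sub_add_cancel] at h6
    linarith

/-- Bounded pointwise convergence to zero in Schwartz space is convergence in Schwartz space. -/
theorem tendsto_schwartz_zero {l : Filter H} {g : H → 𝓢(E, ℂ)}
    (hb : ∀ k n : ℕ, ∃ C : ℝ, ∀ᶠ η in l, ∀ x, ‖x‖ ^ k * ‖iteratedFDeriv ℝ n (g η) x‖ ≤ C)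
    (h0 : ∀ x, Tendsto (fun η => g η x) l (𝓝 0)) : Tendsto g l (𝓝 0) := by
  rw [(schwartz_withSeminorms ℝ E ℂ).tendsto_nhds]
  rintro ⟨k, n⟩ δ hδ
  -- One more power of ‖x‖ makes the tail beyond radius R at most C/R ≤ δ/2. Inside the ball,
  -- convergence is uniform by compactness.
  obtain ⟨C, hC⟩ := hb (k + 1) n
  set R : ℝ := 2 * (|C| + 1) / δ + 1 with hR
  have hRpos : 0 < R := by positivity
  have hK := eventually_iteratedFDeriv_le_of_isCompact (f := fun η => (g η : E → ℂ))
    (Eventually.of_forall fun η => (g η).smooth ⊤)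
    (fun k => (hb 0 k).imp fun C h => h.mono fun η h x => by simpa using h x) h0
    (isCompact_closedBall (0 : E) R) n (δ := δ / (2 * R ^ k)) (by positivity)
  filter_upwards [hC, hK] with η h1 h2
  rw [sub_zero]
  refine lt_of_le_of_lt (SchwartzMap.seminorm_le_bound ℝ k n (g η) (M := δ / 2) (by positivity)
    fun x => ?_) (by linarith)
  by_cases hx : ‖x‖ ≤ R
  · calc ‖x‖ ^ k * ‖iteratedFDeriv ℝ n (g η) x‖ ≤ R ^ k * (δ / (2 * R ^ k)) := by
          gcongr
          exact h2 x (by simpa using hx)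
      _ = δ / 2 := by field_simp
  · push Not at hx
    have h3 := h1 x
    have hxpos : 0 < ‖x‖ := hRpos.trans hx
    have h4 : R * (‖x‖ ^ k * ‖iteratedFDeriv ℝ n (g η) x‖) ≤ C := by
      refine le_trans ?_ h3
      rw [pow_succ]
      calc _ ≤ ‖x‖ * (‖x‖ ^ k * ‖iteratedFDeriv ℝ n (g η) x‖) := by gcongr
        _ = _ := by ring
    have h5 : C ≤ R * (δ / 2) := by
      rw [hR]
      have : (2 * (|C| + 1) / δ + 1) * (δ / 2) = |C| + 1 + δ / 2 := by field_simp
      rw [this]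
      linarith [le_abs_self C]
    exact le_of_mul_le_mul_left (h4.trans h5) hRpos

/-- A pointwise time derivative is a time derivative in Schwartz space, if its Schwartz seminorms
are bounded locally uniformly in time. -/
theorem tendsto_schwartz_slope {A B : ℝ → 𝓢(E, ℂ)}
    (hd : ∀ x t, HasDerivAt (fun s => A s x) (B t x) t)
    (hB : ∀ (k n : ℕ) (T : ℝ), ∃ C : ℝ, ∀ t ∈ Set.Icc (-T) T, ∀ x,
      ‖x‖ ^ k * ‖iteratedFDeriv ℝ n (B t) x‖ ≤ C)
    (hBc : ∀ x, Continuous fun t => B t x) (t : ℝ) :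
    Tendsto (fun h : ℝ => h⁻¹ • (A (t + h) - A t)) (𝓝[≠] 0) (𝓝 (B t)) := by
  have hfam : TimeFam 1 (fun _ : E => 1) (fun _ t x => B t x) := by
    refine TimeFam.of_indep continuous_const (fun _ => one_pos) (fun t => (B t).smooth ⊤)
      (fun k T => ?_) hBc
    obtain ⟨C, hC⟩ := hB 0 k T
    exact ⟨C, fun t ht x => by simpa using hC t ht x⟩
  rw [← tendsto_sub_nhds_zero_iff]
  refine tendsto_schwartz_zero (fun k n => ?_) fun x => ?_
  · obtain ⟨C, hC⟩ := hB k n (|t| + 1)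
    -- One `C` bounds the difference quotient, by the mean value inequality in time, the other its
    -- limit.
    refine ⟨C + C, ?_⟩
    have e1 : ∀ᶠ h in 𝓝[≠] (0 : ℝ), |h| < 1 ∧ h ≠ 0 := by
      have h0 : ∀ᶠ h in 𝓝 (0 : ℝ), |h| < 1 := by
        filter_upwards [Metric.ball_mem_nhds (0 : ℝ) one_pos] with h hh
        simpa using hh
      exact (h0.filter_mono nhdsWithin_le_nhds).and self_mem_nhdsWithin
    filter_upwards [e1] with h hh x
    obtain ⟨h1, h0⟩ := hh
    have hsub : ∀ r ∈ Set.uIcc t (t + h), r ∈ Set.Icc (-(|t| + 1)) (|t| + 1) := by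
      intro r hr
      have h2 := Set.abs_sub_left_of_mem_uIcc hr
      rw [add_sub_cancel_left] at h2
      refine abs_le.1 ?_
      calc |r| = |(r - t) + t| := by rw [sub_add_cancel]
        _ ≤ |r - t| + |t| := abs_add_le _ _
        _ ≤ |t| + 1 := by linarith
    have hAB : ((h⁻¹ • (A (t + h) - A t) - B t : 𝓢(E, ℂ)) : E → ℂ) =
        (h⁻¹ • fun x => A (t + h) x - A t x) - (B t : E → ℂ) := rfl
    have s1 : ContDiff ℝ ∞ fun x => A (t + h) x - A t x :=
      ((A (t + h)).smooth ⊤).sub ((A t).smooth ⊤)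
    have s2 : ContDiff ℝ ∞ (h⁻¹ • fun x => A (t + h) x - A t x) := s1.const_smul h⁻¹
    rw [hAB, iteratedFDeriv_sub_apply (contDiff_infty.1 s2 n).contDiffAt
      (contDiff_infty.1 ((B t).smooth ⊤) n).contDiffAt,
      iteratedFDeriv_const_smul_apply (contDiff_infty.1 s1 n).contDiffAt]
    have h3 : ‖x‖ ^ k * ‖iteratedFDeriv ℝ n (fun x => A (t + h) x - A t x) x‖ ≤ C * |h| := by
      rcases eq_or_lt_of_le (pow_nonneg (norm_nonneg x) k) with hx | hx
      · rw [← hx, zero_mul]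
        have := hC t (mem_Icc_abs t) x
        have hC0 : 0 ≤ C := le_trans (by positivity) this
        positivity
      · have := norm_iteratedFDeriv_sub_le n (f := fun t => (A t : E → ℂ)) (fun t => (A t).smooth ⊤)
          hfam hd (t + h) t (C / ‖x‖ ^ k) x fun r hr => by
            rw [le_div_iff₀ hx, mul_comm]
            exact hC r (hsub r hr) x
        rw [add_sub_cancel_left] at this
        calc _ ≤ ‖x‖ ^ k * (C / ‖x‖ ^ k * |h|) := by gcongr
          _ = C * |h| := by field_simp
    calc ‖x‖ ^ k * ‖h⁻¹ • iteratedFDeriv ℝ n (fun x => A (t + h) x - A t x) x -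
          iteratedFDeriv ℝ n (B t) x‖
        ≤ ‖x‖ ^ k * (|h|⁻¹ * ‖iteratedFDeriv ℝ n (fun x => A (t + h) x - A t x) x‖ +
          ‖iteratedFDeriv ℝ n (B t) x‖) := by
          gcongr
          refine (norm_sub_le _ _).trans ?_
          rw [norm_smul, norm_inv, Real.norm_eq_abs]
      _ = |h|⁻¹ * (‖x‖ ^ k * ‖iteratedFDeriv ℝ n (fun x => A (t + h) x - A t x) x‖) +
          ‖x‖ ^ k * ‖iteratedFDeriv ℝ n (B t) x‖ := by ring
      _ ≤ |h|⁻¹ * (C * |h|) + C := by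
          gcongr
          exact hC t (mem_Icc_abs t) x
      _ = C + C := by
          have : 0 < |h| := abs_pos.2 h0
          field_simp
  · have h1 := (hd x t).tendsto_slope_zero
    rw [← tendsto_sub_nhds_zero_iff] at h1
    exact h1

end Schwartz

/-! ### Smoothness of parametric integrals -/

section ParametricIntegrals

variable {Z : Type*} [MeasurableSpace Z] {μ : Measure Z} {E : Type} [NormedAddCommGroup E]
  [NormedSpace ℝ E] [FiniteDimensional ℝ E]

/-- Each directional derivative is a limit of a sequence of measurable difference quotients, and
finitely many directions determine the differential. -/
theorem aestronglyMeasurable_fderiv_of_forall {F : Type} [NormedAddCommGroup F] [NormedSpace ℝ F]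
    {f : E → Z → F} (hs : ∀ z, Differentiable ℝ fun x => f x z)
    (hm : ∀ x, AEStronglyMeasurable (f x) μ) (x : E) :
    AEStronglyMeasurable (fun z => fderiv ℝ (fun x => f x z) x) μ := by
  have h1 : ∀ v, AEStronglyMeasurable (fun z => fderiv ℝ (fun x => f x z) x v) μ := by
    intro v
    refine aestronglyMeasurable_of_tendsto_ae atTop
      (f := fun (n : ℕ) z => (n : ℝ) • (f (x + (n : ℝ)⁻¹ • v) z - f x z))
      (fun n => ((hm _).sub (hm _)).const_smul (n : ℝ)) (Eventually.of_forall fun z => ?_)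
    exact ((hs z x).hasFDerivAt.lim_real v).comp tendsto_natCast_atTop_atTop
  let b := Module.finBasis ℝ E
  have h2 : (fun z => fderiv ℝ (fun x => f x z) x) = fun z => ∑ i,
      ContinuousLinearMap.smulRightL ℝ E F (LinearMap.toContinuousLinearMap (b.coord i))
        (fderiv ℝ (fun x => f x z) x (b i)) := by
    funext z
    refine ContinuousLinearMap.ext fun v => ?_
    conv_lhs => rw [← b.sum_repr v]
    simp only [map_sum, map_smul]
    simp [sum_apply]
  rw [h2]
  exact Finset.aestronglyMeasurable_fun_sum _ fun i _ =>
    (ContinuousLinearMap.continuous _).comp_aestronglyMeasurable (h1 (b i))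

/-- Repeated differentiation under the integral. The dominating functions are uniform in x, whereas
the majorant `b` of the final bound belongs to a fixed x; this leaves room for weights such as
(1+‖x‖)^{-k}. -/
theorem contDiff_integral_and_norm_le (k : ℕ) :
    ∀ {F : Type} [NormedAddCommGroup F] [NormedSpace ℝ F] [CompleteSpace F] {f : E → Z → F},
    (∀ z, ContDiff ℝ ∞ fun x => f x z) → (∀ x, AEStronglyMeasurable (f x) μ) →
    (∀ k : ℕ, ∃ g : Z → ℝ, Integrable g μ ∧
      ∀ x z, ‖iteratedFDeriv ℝ k (fun x => f x z) x‖ ≤ g z) →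
    ContDiff ℝ k (fun x => ∫ z, f x z ∂μ) ∧
    ∀ (x : E) (b : Z → ℝ), Integrable b μ →
      (∀ z, ‖iteratedFDeriv ℝ k (fun x => f x z) x‖ ≤ b z) →
      ‖iteratedFDeriv ℝ k (fun x => ∫ z, f x z ∂μ) x‖ ≤ ∫ z, b z ∂μ := by
  induction k with
  | zero =>
    intro F _ _ _ f hs hm hb
    obtain ⟨g, hg, hgb⟩ := hb 0
    simp only [norm_iteratedFDeriv_zero] at hgb ⊢
    refine ⟨contDiff_zero.2 ?_, fun x b hb h => ?_⟩
    · exact continuous_of_dominated hm (fun x => Eventually.of_forall (hgb x)) hg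
        (Eventually.of_forall fun z => (hs z).continuous)
    · exact norm_integral_le_of_norm_le hb (Eventually.of_forall h)
  | succ k ih =>
    intro F _ _ _ f hs hm hb
    have hd : ∀ z, Differentiable ℝ fun x => f x z := fun z => (hs z).differentiable (by simp)
    obtain ⟨g₀, hg₀, hgb₀⟩ := hb 0
    obtain ⟨g₁, hg₁, hgb₁⟩ := hb 1
    simp only [norm_iteratedFDeriv_zero] at hgb₀
    have hm' := aestronglyMeasurable_fderiv_of_forall hd hm
    have hder : ∀ x, HasFDerivAt (fun x => ∫ z, f x z ∂μ)
        (∫ z, fderiv ℝ (fun x => f x z) x ∂μ) x := by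
      intro x
      refine hasFDerivAt_integral_of_dominated_of_fderiv_le (𝕜 := ℝ) (bound := g₁) (s := Set.univ)
        (F' := fun x z => fderiv ℝ (fun x => f x z) x)
        univ_mem (Eventually.of_forall hm) (hg₀.mono' (hm x) (Eventually.of_forall (hgb₀ x)))
        (hm' x) (Eventually.of_forall fun z x _ => ?_) hg₁
        (Eventually.of_forall fun z x _ => (hd z x).hasFDerivAt)
      have := hgb₁ x z
      rwa [show (1 : ℕ) = 0 + 1 from rfl, ← norm_iteratedFDeriv_fderiv,
        norm_iteratedFDeriv_zero] at this
    have hfd : fderiv ℝ (fun x => ∫ z, f x z ∂μ) = fun x => ∫ z, fderiv ℝ (fun x => f x z) x ∂μ :=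
      funext fun x => (hder x).fderiv
    obtain ⟨h1, h2⟩ := ih (f := fun x z => fderiv ℝ (fun x => f x z) x)
      (fun z => (hs z).fderiv_right (by simp)) hm' (fun k => by
        obtain ⟨g, hg, hgb⟩ := hb (k + 1)
        refine ⟨g, hg, fun x z => ?_⟩
        have := hgb x z
        rwa [← norm_iteratedFDeriv_fderiv] at this)
    refine ⟨?_, fun x b hb h => ?_⟩
    · rw [Nat.cast_succ, contDiff_succ_iff_fderiv]
      refine ⟨fun x => (hder x).differentiableAt, by simp, ?_⟩
      rw [hfd]
      exact h1
    · rw [← norm_iteratedFDeriv_fderiv, hfd]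
      refine h2 x b hb fun z => ?_
      have := h z
      rwa [← norm_iteratedFDeriv_fderiv] at this

end ParametricIntegrals

/-! ### Derivatives of exponentials and Gaussian decay -/

section Exponentials

variable {E : Type} [NormedAddCommGroup E] [NormedSpace ℝ E]

/-- Derivatives of `exp ∘ θ` in terms of those of `θ`. -/
theorem exists_norm_iteratedFDeriv_cexp_le (l : ℕ) : ∃ c : ℝ, 0 ≤ c ∧
    ∀ (θ : E → ℂ) (x : E) (D : ℝ), ContDiff ℝ ∞ θ → 0 ≤ D →
      (∀ j : ℕ, ‖iteratedFDeriv ℝ (j + 1) θ x‖ ≤ D ^ (j + 1)) →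
      ‖iteratedFDeriv ℝ l (fun x => Complex.exp (θ x)) x‖ ≤ c * ‖Complex.exp (θ x)‖ * D ^ l := by
  induction l using Nat.strong_induction_on with
  | _ l ih =>
    cases l with
    | zero => exact ⟨1, zero_le_one, fun θ x D _ _ _ => by simp⟩
    | succ l =>
      have ih' : ∀ j : ℕ, ∃ c : ℝ, 0 ≤ c ∧ (j ≤ l → ∀ (θ : E → ℂ) (x : E) (D : ℝ), ContDiff ℝ ∞ θ →
          0 ≤ D → (∀ j : ℕ, ‖iteratedFDeriv ℝ (j + 1) θ x‖ ≤ D ^ (j + 1)) →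
          ‖iteratedFDeriv ℝ j (fun x => Complex.exp (θ x)) x‖ ≤
            c * ‖Complex.exp (θ x)‖ * D ^ j) := by
        intro j
        by_cases hj : j ≤ l
        · obtain ⟨c, hc, h⟩ := ih j (by omega)
          exact ⟨c, hc, fun _ => h⟩
        · exact ⟨0, le_rfl, fun h => absurd h hj⟩
      choose c hc hcb using ih'
      -- Leibniz for d(e^θ) = e^θ dθ: the i-th derivative of e^θ brings D^i, the (l-i)-th derivative
      -- of dθ brings D^(l-i+1), and the exponents add up to l+1 in every term.
      refine ⟨∑ i ∈ Finset.range (l + 1), (l.choose i : ℝ) * c i,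
        Finset.sum_nonneg fun i _ => mul_nonneg (Nat.cast_nonneg _) (hc i),
        fun θ x D hθ hD hb => ?_⟩
      have hexp : ContDiff ℝ ∞ fun x => Complex.exp (θ x) := hθ.cexp
      have hfd : fderiv ℝ (fun x => Complex.exp (θ x)) =
          fun x => Complex.exp (θ x) • fderiv ℝ θ x := funext fun x =>
        ((hθ.differentiable (by simp) x).hasFDerivAt.cexp).fderiv
      rw [← norm_iteratedFDeriv_fderiv, hfd]
      refine (norm_iteratedFDeriv_smul_le hexp (hθ.fderiv_right (m := ∞) (by simp)) x (n := l)
        (by exact_mod_cast le_top)).trans ?_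
      rw [Finset.sum_mul, Finset.sum_mul]
      refine Finset.sum_le_sum fun i hi => ?_
      have hil : i ≤ l := Nat.lt_succ_iff.1 (Finset.mem_range.1 hi)
      rw [norm_iteratedFDeriv_fderiv]
      calc (l.choose i : ℝ) * ‖iteratedFDeriv ℝ i (fun x => Complex.exp (θ x)) x‖ *
            ‖iteratedFDeriv ℝ (l - i + 1) θ x‖
          ≤ (l.choose i : ℝ) * (c i * ‖Complex.exp (θ x)‖ * D ^ i) * D ^ (l - i + 1) := by
            gcongr
            · exact mul_nonneg (Nat.cast_nonneg _)
                (mul_nonneg (mul_nonneg (hc i) (norm_nonneg _)) (pow_nonneg hD i))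
            · exact hcb i hil θ x D hθ hD hb
            · exact hb _
        _ = _ := by
            have : D ^ (l + 1) = D ^ i * D ^ (l - i + 1) := by
              rw [← pow_add]
              congr 1
              omega
            rw [this]
            ring

/-- The power is at most m! e^{1+r} by the exponential series, and r - a r² ≤ 1/(4a) by completing
the square. -/
theorem one_add_pow_mul_exp_neg_sq_le {a : ℝ} (ha : 0 < a) (m : ℕ) : ∃ C : ℝ, 0 ≤ C ∧
    ∀ r : ℝ, 0 ≤ r → (1 + r) ^ m * Real.exp (-(a * r ^ 2)) ≤ C := by
  refine ⟨m.factorial * Real.exp (1 + 1 / (4 * a)), by positivity, fun r hr => ?_⟩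
  have h1 := Real.pow_div_factorial_le_exp (1 + r) (by linarith) m
  rw [div_le_iff₀ (by positivity)] at h1
  calc (1 + r) ^ m * Real.exp (-(a * r ^ 2))
      ≤ Real.exp (1 + r) * m.factorial * Real.exp (-(a * r ^ 2)) := by gcongr
    _ = m.factorial * Real.exp (1 + r - a * r ^ 2) := by
        rw [sub_eq_add_neg, Real.exp_add (1 + r)]
        ring
    _ ≤ _ := by
        gcongr
        have h2 : r - a * r ^ 2 ≤ 1 / (4 * a) := by
          rw [le_div_iff₀ (by positivity)]
          nlinarith [sq_nonneg (2 * a * r - 1)]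
        linarith

end Exponentials

/-! ### The x-dependent factor of the integral kernel -/

section Kernel

variable {d : ℕ}

/-- Complexification of a real vector, as a linear map. -/
noncomputable def coordC (j : Fin d) : Conf d →L[ℝ] ℂ :=
  Complex.ofRealCLM.comp (EuclideanSpace.proj j)

theorem coordC_apply (j : Fin d) (a : Conf d) : coordC j a = toC a j := rfl

/-- The bilinear form of a complex matrix on real vectors. -/
noncomputable def bilinC (Θ : Matrix (Fin d) (Fin d) ℂ) : Conf d →L[ℝ] Conf d →L[ℝ] ℂ :=
  ∑ j, ∑ k, ContinuousLinearMap.smulRightL ℝ (Conf d) (Conf d →L[ℝ] ℂ) (EuclideanSpace.proj j)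
    (Θ j k • coordC k)

theorem bilinC_apply (Θ : Matrix (Fin d) (Fin d) ℂ) (a b : Conf d) :
    bilinC Θ a b = toC a ⬝ᵥ Θ.mulVec (toC b) := by
  simp only [bilinC, sum_apply, dotProduct, Matrix.mulVec, Finset.mul_sum]
  refine Finset.sum_congr rfl fun j _ => Finset.sum_congr rfl fun k _ => ?_
  change a j • (Θ j k * toC b k) = _
  rw [Complex.real_smul]
  rfl

/-- The linear functional `a ↦ ξ · a`. -/
noncomputable def pairC (ξ : Conf d) : Conf d →L[ℝ] ℂ := ∑ j, ξ j • coordC j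

theorem pairC_apply (ξ a : Conf d) : pairC ξ a = toC ξ ⬝ᵥ toC a := by
  simp [pairC, sum_apply, dotProduct, coordC_apply, toC]

theorem pairC_eq_inner (ξ a : Conf d) : pairC ξ a = ((inner ℝ ξ a : ℝ) : ℂ) := by
  rw [pairC_apply]
  simp [dotProduct, toC, PiLp.inner_apply, mul_comm]

theorem norm_pairC_le (ξ : Conf d) : ‖pairC ξ‖ ≤ ‖ξ‖ :=
  ContinuousLinearMap.opNorm_le_bound _ (norm_nonneg _) fun a => by
    rw [pairC_eq_inner, Complex.norm_real]
    exact norm_inner_le_norm _ _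

theorem continuous_bilinC {X : Type*} [TopologicalSpace X] {Θ : X → Matrix (Fin d) (Fin d) ℂ}
    (hc : ∀ i j, Continuous fun t => Θ t i j) : Continuous fun t => bilinC (Θ t) := by
  unfold bilinC
  have : ContinuousAdd (Conf d →L[ℝ] Conf d →L[ℝ] ℂ) :=
    (SeminormedAddCommGroup.toIsTopologicalAddGroup
      (E := Conf d →L[ℝ] Conf d →L[ℝ] ℂ)).toContinuousAdd
  exact continuous_finsetSum _ fun i _ => continuous_finsetSum _ fun j _ =>
    (ContinuousLinearMap.continuous _).comp ((hc i j).smul continuous_const)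

/-- On the unit sphere times K the form has a positive minimum by compactness; homogeneity of degree
two covers all other vectors. -/
theorem IsWidth.exists_le_re {X : Type*} [TopologicalSpace X] {K : Set X} (hK : IsCompact K)
    {Θ : X → Matrix (Fin d) (Fin d) ℂ} (hΘ : ∀ t, IsWidth (Θ t))
    (hc : ∀ i j, Continuous fun t => Θ t i j) :
    ∃ c : ℝ, 0 < c ∧ ∀ t ∈ K, ∀ a : Conf d, c * ‖a‖ ^ 2 ≤ (bilinC (Θ t) a a).re := by
  have hbil := continuous_bilinC hc
  obtain ⟨c, hc0, h⟩ := exists_pos_le_of_isCompact (hK.prod (isCompact_sphere (0 : Conf d) 1))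
    (f := fun p => (bilinC (Θ p.1) p.2 p.2).re)
    (Continuous.continuousOn (Complex.continuous_re.comp
      (((hbil.comp continuous_fst).clm_apply continuous_snd).clm_apply continuous_snd)))
    (fun p hp => by
      have hstar : star (toC p.2) = toC p.2 := by
        funext j
        simp [toC]
      have h1 := (hΘ p.1).re_star_dotProduct_nonneg (toC p.2)
      rw [bilinC_apply]
      rw [hstar] at h1
      refine lt_of_le_of_ne h1 fun h0 => ?_
      have h2 := (hΘ p.1).eq_zero_of_re (a := toC p.2) (by rw [hstar]; exact h0.symm)
      have h3 : p.2 = 0 := by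
        ext j
        have := congrFun h2 j
        simpa [toC] using this
      have h4 : ‖p.2‖ = 1 := by simpa using hp.2
      rw [h3, norm_zero] at h4
      exact zero_ne_one h4)
  refine ⟨c, hc0, fun t ht a => ?_⟩
  rcases eq_or_ne a 0 with rfl | ha
  · simp
  have ha' : 0 < ‖a‖ := norm_pos_iff.2 ha
  have h1 := h (t, ‖a‖⁻¹ • a) ⟨ht, by simp [norm_smul, ha'.ne']⟩
  have h2 : (bilinC (Θ t) (‖a‖⁻¹ • a) (‖a‖⁻¹ • a)).re = (bilinC (Θ t) a a).re / ‖a‖ ^ 2 := by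
    simp only [map_smul, smul_apply, Complex.real_smul, Complex.mul_re, Complex.ofReal_re,
      Complex.ofReal_im, Complex.mul_im]
    field_simp
    ring
  simp only [h2] at h1
  rwa [le_div_iff₀ (by positivity)] at h1

/-- The exponent of the `x`-dependent factor of the integral kernel. -/
noncomputable def kernelExp (ε : ℝ) (κ : Phase d → Phase d) (S : Phase d → ℝ)
    (Θ : Matrix (Fin d) (Fin d) ℂ) (x : Conf d) (z : Phase d) : ℂ :=
  Complex.I / (ε : ℂ) * ((S z : ℂ) + pairC (κ z).2 (x - (κ z).1) +
    Complex.I / 2 * bilinC Θ (x - (κ z).1) (x - (κ z).1))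

/-- The `x`-dependent factor of the integral kernel. -/
noncomputable def kernel (ε : ℝ) (κ : Phase d → Phase d) (S : Phase d → ℝ)
    (Θ : Matrix (Fin d) (Fin d) ℂ) (x : Conf d) (z : Phase d) : ℂ :=
  Complex.exp (kernelExp ε κ S Θ x z)

/-- S and Ξ·(x-X) are real and contribute only a phase factor. -/
theorem norm_kernel (ε : ℝ) (κ : Phase d → Phase d) (S : Phase d → ℝ)
    (Θ : Matrix (Fin d) (Fin d) ℂ) (x : Conf d) (z : Phase d) : ‖kernel ε κ S Θ x z‖ =
      Real.exp (-(1 / (2 * ε) * (bilinC Θ (x - (κ z).1) (x - (κ z).1)).re)) := by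
  rw [kernel, Complex.norm_exp, kernelExp, pairC_eq_inner]
  congr 1
  set b := bilinC Θ (x - (κ z).1) (x - (κ z).1)
  have h : Complex.I / (ε : ℂ) * ((S z : ℂ) + ((inner ℝ (κ z).2 (x - (κ z).1) : ℝ) : ℂ) +
      Complex.I / 2 * b) = (((S z + inner ℝ (κ z).2 (x - (κ z).1)) / ε : ℝ) : ℂ) * Complex.I -
        ((1 / (2 * ε) : ℝ) : ℂ) * b := by
    push_cast
    ring_nf
    rw [Complex.I_sq]
    ring
  rw [h]
  simp

theorem contDiff_kernelExp (ε : ℝ) (κ : Phase d → Phase d) (S : Phase d → ℝ)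
    (Θ : Matrix (Fin d) (Fin d) ℂ) (z : Phase d) :
    ContDiff ℝ ∞ fun x => kernelExp ε κ S Θ x z := by
  unfold kernelExp
  fun_prop

theorem fderiv_kernelExp (ε : ℝ) (κ : Phase d → Phase d) (S : Phase d → ℝ)
    (Θ : Matrix (Fin d) (Fin d) ℂ) (z : Phase d) (x : Conf d) :
    fderiv ℝ (fun x => kernelExp ε κ S Θ x z) x = (Complex.I / (ε : ℂ)) • (pairC (κ z).2 +
      (Complex.I / 2) • (bilinC Θ + (bilinC Θ).flip) (x - (κ z).1)) := by
  have h1 : HasFDerivAt (fun x : Conf d => x - (κ z).1) (ContinuousLinearMap.id ℝ _) x :=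
    (hasFDerivAt_id x).sub_const _
  have h2 := (pairC (κ z).2).hasFDerivAt.comp x h1
  have h3 := (bilinC Θ).hasFDerivAt_of_bilinear h1 h1
  have h4 := ((h2.const_add (S z : ℂ)).add (h3.const_mul (Complex.I / 2))).const_mul
    (Complex.I / (ε : ℂ))
  refine HasFDerivAt.fderiv (h4.congr_fderiv ?_)
  refine ContinuousLinearMap.ext fun v => ?_
  simp

end Kernel

/-! ### Schwartz estimates of the kernel in x -/

section KernelBounds

variable {d : ℕ}

theorem smul_bilinC_apply (c : ℂ) (Θ : Matrix (Fin d) (Fin d) ℂ) (a b : Conf d) :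
    bilinC (c • Θ) a b = c * bilinC Θ a b := by
  simp [bilinC_apply, Matrix.smul_mulVec, dotProduct_smul]

theorem norm_bilinC_smul_le (c : ℂ) (Θ : Matrix (Fin d) (Fin d) ℂ) :
    ‖bilinC (c • Θ)‖ ≤ ‖c‖ * ‖bilinC Θ‖ := by
  refine ContinuousLinearMap.opNorm_le_bound₂ _ (by positivity) fun a b => ?_
  rw [smul_bilinC_apply, norm_mul, mul_assoc, mul_assoc]
  gcongr
  rw [← mul_assoc]
  exact (bilinC Θ).le_opNorm₂ a b

theorem fderiv_kernelExp_eq (ε : ℝ) (κ : Phase d → Phase d) (S : Phase d → ℝ)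
    (Θ : Matrix (Fin d) (Fin d) ℂ) (z : Phase d) :
    fderiv ℝ (fun x => kernelExp ε κ S Θ x z) = fun x => (Complex.I / (ε : ℂ)) • pairC (κ z).2 +
      (bilinC ((Complex.I / (ε : ℂ) * (Complex.I / 2)) • Θ) +
        (bilinC ((Complex.I / (ε : ℂ) * (Complex.I / 2)) • Θ)).flip) (x - (κ z).1) := by
  funext x
  rw [fderiv_kernelExp]
  refine ContinuousLinearMap.ext fun v => ?_
  simp [smul_bilinC_apply, -map_sub]
  ring

/-- The exponent is quadratic in x: its first derivative is affine, its second constant, and the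
others vanish. As the base is at least 1, powers of this one base cover all orders, which is the
form required by `exists_norm_iteratedFDeriv_cexp_le`. -/
theorem norm_iteratedFDeriv_kernelExp_le {ε K : ℝ} (hε : 0 < ε) (hK : 0 ≤ K)
    {κ : Phase d → Phase d} (S : Phase d → ℝ) {Θ : Matrix (Fin d) (Fin d) ℂ}
    (hΘ : ‖bilinC Θ‖ ≤ K) {z : Phase d} (hκ : ‖κ z‖ ≤ K * (1 + ‖z‖)) (x : Conf d) (j : ℕ) :
    ‖iteratedFDeriv ℝ (j + 1) (fun x => kernelExp ε κ S Θ x z) x‖ ≤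
      ((1 + K / ε) * (1 + ‖z‖) * (1 + ‖x - (κ z).1‖)) ^ (j + 1) := by
  set c : ℂ := Complex.I / (ε : ℂ) * (Complex.I / 2)
  have hc : ‖c‖ = 1 / (2 * ε) := by
    simp [c, abs_of_pos hε]
  have hB : ‖bilinC (c • Θ) + (bilinC (c • Θ)).flip‖ ≤ K / ε := by
    refine (ContinuousLinearMap.opNorm_add_le _ _).trans ?_
    rw [ContinuousLinearMap.opNorm_flip]
    have h1 := norm_bilinC_smul_le c Θ
    rw [hc] at h1
    have h2 : 1 / (2 * ε) * ‖bilinC Θ‖ ≤ 1 / (2 * ε) * K := by gcongr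
    have h3 : K / ε = 1 / (2 * ε) * K + 1 / (2 * ε) * K := by
      field_simp
      ring
    linarith
  have hKε : 0 ≤ K / ε := by positivity
  have hz : 1 ≤ 1 + ‖z‖ := by linarith [norm_nonneg z]
  have hr : 1 ≤ 1 + ‖x - (κ z).1‖ := by linarith [norm_nonneg (x - (κ z).1)]
  have hzr : 1 ≤ (1 + ‖z‖) * (1 + ‖x - (κ z).1‖) := one_le_mul_of_one_le_of_one_le hz hr
  have hD : 1 ≤ (1 + K / ε) * (1 + ‖z‖) * (1 + ‖x - (κ z).1‖) := by
    rw [mul_assoc]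
    exact one_le_mul_of_one_le_of_one_le (by linarith) hzr
  rw [← norm_iteratedFDeriv_fderiv, fderiv_kernelExp_eq]
  rcases j with _ | j
  · rw [norm_iteratedFDeriv_zero, zero_add, pow_one]
    refine (norm_add_le _ _).trans ?_
    have h1 : ‖(Complex.I / (ε : ℂ)) • pairC (κ z).2‖ ≤ K / ε * (1 + ‖z‖) := by
      rw [norm_smul]
      have : ‖Complex.I / (ε : ℂ)‖ = 1 / ε := by simp [abs_of_pos hε]
      rw [this]
      have h2 : ‖pairC (κ z).2‖ ≤ K * (1 + ‖z‖) :=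
        (norm_pairC_le _).trans ((norm_snd_le (κ z)).trans hκ)
      calc 1 / ε * ‖pairC (κ z).2‖ ≤ 1 / ε * (K * (1 + ‖z‖)) := by gcongr
        _ = _ := by ring
    have h2 : ‖(bilinC (c • Θ) + (bilinC (c • Θ)).flip) (x - (κ z).1)‖ ≤
        K / ε * ‖x - (κ z).1‖ :=
      (ContinuousLinearMap.le_opNorm _ _).trans (by gcongr)
    calc _ ≤ K / ε * (1 + ‖z‖) + K / ε * ‖x - (κ z).1‖ := add_le_add h1 h2
      _ ≤ K / ε * ((1 + ‖z‖) * (1 + ‖x - (κ z).1‖)) := by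
        have h3 := mul_nonneg (norm_nonneg z) (norm_nonneg (x - (κ z).1))
        rw [← mul_add]
        gcongr
        nlinarith
      _ ≤ _ := by
        rw [mul_assoc]
        gcongr
        linarith
  · rw [← norm_iteratedFDeriv_fderiv]
    have h3 : fderiv ℝ (fun x => (Complex.I / (ε : ℂ)) • pairC (κ z).2 +
        (bilinC (c • Θ) + (bilinC (c • Θ)).flip) (x - (κ z).1)) =
        fun _ => bilinC (c • Θ) + (bilinC (c • Θ)).flip := by
      funext x
      have h1 : HasFDerivAt (fun x : Conf d => x - (κ z).1) (ContinuousLinearMap.id ℝ _) x :=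
        (hasFDerivAt_id x).sub_const _
      exact (((bilinC (c • Θ) + (bilinC (c • Θ)).flip).hasFDerivAt.comp x h1).const_add _).fderiv
    rw [h3]
    rcases j with _ | j
    · rw [norm_iteratedFDeriv_zero]
      refine hB.trans (le_trans ?_ (le_self_pow₀ hD (by norm_num)))
      rw [mul_assoc]
      nlinarith
    · rw [iteratedFDeriv_const_of_ne (by simp)]
      simp only [Pi.zero_apply, norm_zero]
      positivity

/-- Schwartz bounds for the kernel in `x`, with polynomial growth in `z`, depending only on
bounds for the data. -/
theorem exists_norm_iteratedFDeriv_kernel_le {ε c K : ℝ} (hε : 0 < ε) (hc : 0 < c) (hK : 0 ≤ K)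
    (k l : ℕ) : ∃ C : ℝ, 0 ≤ C ∧ ∀ (κ : Phase d → Phase d) (S : Phase d → ℝ)
      (Θ : Matrix (Fin d) (Fin d) ℂ), ‖bilinC Θ‖ ≤ K →
      (∀ a, c * ‖a‖ ^ 2 ≤ (bilinC Θ a a).re) → (∀ z, ‖κ z‖ ≤ K * (1 + ‖z‖)) → ∀ x z,
      (1 + ‖x‖) ^ k * ‖iteratedFDeriv ℝ l (fun x => kernel ε κ S Θ x z) x‖ ≤
        C * (1 + ‖z‖) ^ (k + l) := by
  obtain ⟨c₁, hc₁, h₁⟩ := exists_norm_iteratedFDeriv_cexp_le (E := Conf d) l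
  -- Of the powers of 1+‖x-X‖ to be absorbed, `k` arise when the weight in x is moved to x-X and `l`
  -- from differentiating the exponential.
  obtain ⟨c₂, hc₂, h₂⟩ := one_add_pow_mul_exp_neg_sq_le (a := c / (2 * ε)) (by positivity) (k + l)
  refine ⟨c₁ * (1 + K) ^ k * (1 + K / ε) ^ l * c₂, by positivity, fun κ S Θ hΘ hpos hκ x z => ?_⟩
  have hX : ‖(κ z).1‖ ≤ K * (1 + ‖z‖) := (norm_fst_le (κ z)).trans (hκ z)
  have hz := norm_nonneg z
  set r := ‖x - (κ z).1‖ with hr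
  have hr0 : 0 ≤ r := norm_nonneg _
  have hx : 1 + ‖x‖ ≤ (1 + r) * ((1 + K) * (1 + ‖z‖)) := by
    have h1 : ‖x‖ ≤ r + ‖(κ z).1‖ := by
      simpa using norm_add_le (x - (κ z).1) (κ z).1
    have h2 : 1 + ‖(κ z).1‖ ≤ (1 + K) * (1 + ‖z‖) := by nlinarith
    have h3 := mul_le_mul_of_nonneg_left h2 (by linarith : 0 ≤ 1 + r)
    nlinarith [mul_nonneg hr0 (norm_nonneg (κ z).1)]
  have hk : ‖kernel ε κ S Θ x z‖ ≤ Real.exp (-(c / (2 * ε) * r ^ 2)) := by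
    rw [norm_kernel]
    refine Real.exp_le_exp.2 (neg_le_neg ?_)
    have := hpos (x - (κ z).1)
    calc c / (2 * ε) * r ^ 2 = 1 / (2 * ε) * (c * r ^ 2) := by ring
      _ ≤ _ := by gcongr
  have h3 := h₁ (fun x => kernelExp ε κ S Θ x z) x ((1 + K / ε) * (1 + ‖z‖) * (1 + r))
    (contDiff_kernelExp ε κ S Θ z) (by positivity)
    (fun j => norm_iteratedFDeriv_kernelExp_le hε hK S hΘ (hκ z) x j)
  calc (1 + ‖x‖) ^ k * ‖iteratedFDeriv ℝ l (fun x => kernel ε κ S Θ x z) x‖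
      ≤ ((1 + r) * ((1 + K) * (1 + ‖z‖))) ^ k * (c₁ * Real.exp (-(c / (2 * ε) * r ^ 2)) *
        ((1 + K / ε) * (1 + ‖z‖) * (1 + r)) ^ l) := by
        gcongr
        exact h3.trans (by gcongr; exact hk)
    _ = c₁ * (1 + K) ^ k * (1 + K / ε) ^ l * (1 + ‖z‖) ^ (k + l) *
        ((1 + r) ^ (k + l) * Real.exp (-(c / (2 * ε) * r ^ 2))) := by
        simp only [mul_pow, pow_add]
        ring
    _ ≤ c₁ * (1 + K) ^ k * (1 + K / ε) ^ l * (1 + ‖z‖) ^ (k + l) * c₂ := by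
        gcongr
        exact h₂ r hr0
    _ = _ := by ring

end KernelBounds

/-- A continuous function that decays faster than any power. -/
structure RapidDecay {E : Type} [NormedAddCommGroup E] (W : E → ℂ) : Prop where
  continuous : Continuous W
  bound : ∀ N : ℕ, ∃ C : ℝ, ∀ z, (1 + ‖z‖) ^ N * ‖W z‖ ≤ C

theorem RapidDecay.integrable_pow_mul {E : Type} [NormedAddCommGroup E] [NormedSpace ℝ E]
    [FiniteDimensional ℝ E] [MeasurableSpace E] [BorelSpace E] {μ : Measure E} [μ.IsAddHaarMeasure]
    {W : E → ℂ} (hW : RapidDecay W) (m : ℕ) : Integrable (fun z => (1 + ‖z‖) ^ m * ‖W z‖) μ := by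
  obtain ⟨C, hC⟩ := hW.bound (m + (Module.finrank ℝ E + 1))
  have h1 := (integrable_one_add_norm (E := E) (μ := μ)
    (r := ((Module.finrank ℝ E + 1 : ℕ) : ℝ)) (by push_cast; linarith)).const_mul C
  refine h1.mono' ?_ (Eventually.of_forall fun z => ?_)
  · have := hW.continuous
    exact Continuous.aestronglyMeasurable (by fun_prop)
  · have hz : 0 < 1 + ‖z‖ := by positivity
    rw [Real.norm_of_nonneg (by positivity), Real.rpow_neg hz.le, Real.rpow_natCast,
      ← div_eq_mul_inv, le_div_iff₀ (by positivity)]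
    have := hC z
    rw [pow_add] at this
    linarith

/-! ### Superpositions of kernels with rapidly decaying weight -/

section KernelFamilies

variable {d : ℕ}

instance : (volume : Measure (Phase d)).IsAddHaarMeasure :=
  Measure.prod.instIsAddHaarMeasure volume volume

/-- Regularity and growth of the data of the kernel, locally uniformly in time. -/
structure KernelFamily (κ : ℝ → Phase d → Phase d) (S : ℝ → Phase d → ℝ)
    (Θ : ℝ → Matrix (Fin d) (Fin d) ℂ) : Prop where
  map : Continuous fun p : ℝ × Phase d => κ p.1 p.2
  action : Continuous fun p : ℝ × Phase d => S p.1 p.2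
  width : ∀ t, IsWidth (Θ t)
  width_cont : ∀ i j, Continuous fun t => Θ t i j
  growth : ∀ T, ∃ K : ℝ, 0 ≤ K ∧ ∀ t ∈ Set.Icc (-T) T, ∀ z, ‖κ t z‖ ≤ K * (1 + ‖z‖)

/-- Joint continuity and growth of a time-dependent function on phase space. -/
structure PolyFamily (a : ℝ → Phase d → ℂ) : Prop where
  continuous : Continuous fun p : ℝ × Phase d => a p.1 p.2
  growth : ∃ m : ℕ, ∀ T, ∃ C : ℝ, 0 ≤ C ∧ ∀ t ∈ Set.Icc (-T) T, ∀ z, ‖a t z‖ ≤ C * (1 + ‖z‖) ^ m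

namespace KernelFamily

variable {κ : ℝ → Phase d → Phase d} {S : ℝ → Phase d → ℝ} {Θ : ℝ → Matrix (Fin d) (Fin d) ℂ}

theorem bound (h : KernelFamily κ S Θ) {ε : ℝ} (hε : 0 < ε) (T : ℝ) (k l : ℕ) :
    ∃ C : ℝ, 0 ≤ C ∧ ∀ t ∈ Set.Icc (-T) T, ∀ x z,
      (1 + ‖x‖) ^ k * ‖iteratedFDeriv ℝ l (fun x => kernel ε (κ t) (S t) (Θ t) x z) x‖ ≤
        C * (1 + ‖z‖) ^ (k + l) := by
  obtain ⟨K, hK, hκ⟩ := h.growth T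
  obtain ⟨c, hc, hpos⟩ := IsWidth.exists_le_re (isCompact_Icc (a := -T) (b := T)) h.width
    h.width_cont
  have hnorm : Continuous fun t => ‖bilinC (Θ t)‖ :=
    (continuous_norm (E := Conf d →L[ℝ] Conf d →L[ℝ] ℂ)).comp (continuous_bilinC h.width_cont)
  obtain ⟨B, hB⟩ := isCompact_Icc.exists_bound_of_continuousOn (s := Set.Icc (-T) T)
    hnorm.continuousOn
  obtain ⟨C, hC, hb⟩ := exists_norm_iteratedFDeriv_kernel_le (d := d) (K := max K B) hε hc
    (hK.trans (le_max_left _ _)) k l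
  refine ⟨C, hC, fun t ht => hb _ _ _ ?_ (hpos t ht) fun z => (hκ t ht z).trans ?_⟩
  · exact ((Real.le_norm_self _).trans (hB t ht)).trans (le_max_right _ _)
  · gcongr
    exact le_max_left _ _

theorem continuous_kernel (h : KernelFamily κ S Θ) (ε : ℝ) (x : Conf d) :
    Continuous fun p : ℝ × Phase d => kernel ε (κ p.1) (S p.1) (Θ p.1) x p.2 := by
  have h1 := h.map
  have h2 := h.action
  have h3 : Continuous fun p : ℝ × Phase d => x - (κ p.1 p.2).1 := by fun_prop
  have h4 : Continuous fun p : ℝ × Phase d => pairC (κ p.1 p.2).2 (x - (κ p.1 p.2).1) := by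
    simp only [pairC_eq_inner]
    exact Complex.continuous_ofReal.comp ((continuous_snd.comp h1).inner h3)
  have h5 : Continuous fun p : ℝ × Phase d =>
      bilinC (Θ p.1) (x - (κ p.1 p.2).1) (x - (κ p.1 p.2).1) :=
    ((((continuous_bilinC h.width_cont).comp continuous_fst).clm_apply h3).clm_apply h3)
  unfold kernel kernelExp
  fun_prop

theorem norm_kernel_le_one (h : KernelFamily κ S Θ) {ε : ℝ} (hε : 0 < ε) (t : ℝ) (x : Conf d)
    (z : Phase d) : ‖kernel ε (κ t) (S t) (Θ t) x z‖ ≤ 1 := by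
  obtain ⟨c, hc, hpos⟩ := IsWidth.exists_le_re (isCompact_singleton (x := t)) h.width
    h.width_cont
  rw [norm_kernel, Real.exp_le_one_iff, neg_nonpos]
  have := hpos t rfl (x - (κ t z).1)
  have h0 : 0 ≤ c * ‖x - (κ t z).1‖ ^ 2 := by positivity
  exact mul_nonneg (by positivity) (h0.trans this)

theorem integrable (h : KernelFamily κ S Θ) {ε : ℝ} (hε : 0 < ε) {a : ℝ → Phase d → ℂ}
    (ha : PolyFamily a) {W : Phase d → ℂ} (hW : RapidDecay W) (t : ℝ) (x : Conf d) :
    Integrable fun z => a t z * W z * kernel ε (κ t) (S t) (Θ t) x z := by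
  obtain ⟨m, hm⟩ := ha.growth
  obtain ⟨C, hC, hb⟩ := hm (|t| + 1)
  refine ((hW.integrable_pow_mul m).const_mul C).mono' ?_ (Eventually.of_forall fun z => ?_)
  · have h1 := (h.continuous_kernel ε x).comp (Continuous.prodMk_right t)
    have h2 := ha.continuous.comp (Continuous.prodMk_right t)
    exact ((h2.mul hW.continuous).mul h1).aestronglyMeasurable
  · rw [norm_mul, norm_mul]
    calc _ ≤ C * (1 + ‖z‖) ^ m * ‖W z‖ * 1 := by
          gcongr
          · exact hb t (mem_Icc_abs t) z
          · exact h.norm_kernel_le_one hε t x z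
      _ = _ := by ring

theorem continuous_integral (h : KernelFamily κ S Θ) {ε : ℝ} (hε : 0 < ε) {a : ℝ → Phase d → ℂ}
    (ha : PolyFamily a) {W : Phase d → ℂ} (hW : RapidDecay W) (x : Conf d) :
    Continuous fun t => ∫ z, a t z * W z * kernel ε (κ t) (S t) (Θ t) x z := by
  obtain ⟨m, hm⟩ := ha.growth
  refine continuous_iff_continuousAt.2 fun t₀ => ?_
  obtain ⟨C, hC, hb⟩ := hm (|t₀| + 1)
  refine continuousAt_of_dominated (bound := fun z => C * ((1 + ‖z‖) ^ m * ‖W z‖))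
    (Eventually.of_forall fun t => (h.integrable hε ha hW t x).1) ?_
    ((hW.integrable_pow_mul m).const_mul C) (Eventually.of_forall fun z => ?_)
  · filter_upwards [eventually_mem_Icc t₀] with t ht
    refine Eventually.of_forall fun z => ?_
    rw [norm_mul, norm_mul]
    calc _ ≤ C * (1 + ‖z‖) ^ m * ‖W z‖ * 1 := by
          gcongr
          · exact hb t ht z
          · exact h.norm_kernel_le_one hε t x z
      _ = _ := by ring
  · have h1 := (h.continuous_kernel ε x).comp (Continuous.prodMk_left z)
    have h2 := ha.continuous.comp (Continuous.prodMk_left z)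
    exact ((h2.mul continuous_const).mul h1).continuousAt

/-- Superpositions of kernels with a rapidly decaying weight are Schwartz functions, with
seminorms that are locally bounded in time. -/
theorem exists_schwartz (h : KernelFamily κ S Θ) {ε : ℝ} (hε : 0 < ε) {a : ℝ → Phase d → ℂ}
    (ha : PolyFamily a) {W : Phase d → ℂ} (hW : RapidDecay W) :
    ∃ M : ℝ → 𝓢(Conf d, ℂ),
      (∀ t x, M t x = ∫ z, a t z * W z * kernel ε (κ t) (S t) (Θ t) x z) ∧
      ∀ k n T, ∃ C, ∀ t ∈ Set.Icc (-T) T, ∀ x,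
        ‖x‖ ^ k * ‖iteratedFDeriv ℝ n (M t) x‖ ≤ C := by
  obtain ⟨m, hm⟩ := ha.growth
  have hs : ∀ t z, ContDiff ℝ ∞ fun x => a t z * W z * kernel ε (κ t) (S t) (Θ t) x z :=
    fun t z => contDiff_const.mul (contDiff_kernelExp ε (κ t) (S t) (Θ t) z).cexp
  have hbd : ∀ T k l, ∃ C, 0 ≤ C ∧ ∀ t ∈ Set.Icc (-T) T, ∀ x z, (1 + ‖x‖) ^ k *
      ‖iteratedFDeriv ℝ l (fun x => a t z * W z * kernel ε (κ t) (S t) (Θ t) x z) x‖ ≤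
        C * ((1 + ‖z‖) ^ (m + (k + l)) * ‖W z‖) := by
    intro T k l
    obtain ⟨C₁, hC₁, h₁⟩ := hm T
    obtain ⟨C₂, hC₂, h₂⟩ := h.bound hε T k l
    refine ⟨C₁ * C₂, by positivity, fun t ht x z => ?_⟩
    have h3 : iteratedFDeriv ℝ l (fun x => a t z * W z * kernel ε (κ t) (S t) (Θ t) x z) x =
        (a t z * W z) • iteratedFDeriv ℝ l (fun x => kernel ε (κ t) (S t) (Θ t) x z) x :=
      iteratedFDeriv_const_smul_apply (a := a t z * W z)
        (((contDiff_kernelExp ε (κ t) (S t) (Θ t) z).cexp.of_le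
          (by exact_mod_cast le_top)).contDiffAt)
    rw [h3, norm_smul, norm_mul]
    calc _ = ‖a t z‖ * ‖W z‖ * ((1 + ‖x‖) ^ k *
          ‖iteratedFDeriv ℝ l (fun x => kernel ε (κ t) (S t) (Θ t) x z) x‖) := by ring
      _ ≤ C₁ * (1 + ‖z‖) ^ m * ‖W z‖ * (C₂ * (1 + ‖z‖) ^ (k + l)) := by
        refine mul_le_mul ?_ (h₂ t ht x z) (by positivity) (by positivity)
        gcongr
        exact h₁ t ht z
      _ = _ := by
        rw [pow_add _ m]
        ring
  have hint : ∀ t l, _ := fun t l => contDiff_integral_and_norm_le (μ := volume) l (hs t)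
    (fun x => (h.integrable hε ha hW t x).1) (fun k => by
      obtain ⟨C, hC, hb⟩ := hbd (|t| + 1) 0 k
      refine ⟨_, (hW.integrable_pow_mul (m + (0 + k))).const_mul C, fun x z => ?_⟩
      have := hb t (mem_Icc_abs t) x z
      simpa only [pow_zero, one_mul] using this)
  have hdec : ∀ k n T, ∃ C, ∀ t ∈ Set.Icc (-T) T, ∀ x, ‖x‖ ^ k * ‖iteratedFDeriv ℝ n
      (fun x => ∫ z, a t z * W z * kernel ε (κ t) (S t) (Θ t) x z) x‖ ≤ C := by
    intro k n T
    obtain ⟨C, hC, hb⟩ := hbd T k n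
    refine ⟨∫ z, C * ((1 + ‖z‖) ^ (m + (k + n)) * ‖W z‖), fun t ht x => ?_⟩
    have hx : 0 < (1 + ‖x‖) ^ k := by positivity
    -- The majorant depends on x through (1+‖x‖)^{-k}; pulled out of the integral, this factor is
    -- the decay of the superposition.
    have h1 := (hint t n).2 x
      (fun z => ((1 + ‖x‖) ^ k)⁻¹ * (C * ((1 + ‖z‖) ^ (m + (k + n)) * ‖W z‖)))
      (((hW.integrable_pow_mul _).const_mul C).const_mul _) (fun z => by
        rw [inv_mul_eq_div, le_div_iff₀ hx, mul_comm]
        exact hb t ht x z)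
    rw [integral_const_mul, inv_mul_eq_div, le_div_iff₀ hx, mul_comm] at h1
    refine le_trans ?_ h1
    gcongr
    linarith
  refine ⟨fun t => ⟨fun x => ∫ z, a t z * W z * kernel ε (κ t) (S t) (Θ t) x z,
    contDiff_infty.2 fun l => (hint t l).1, fun k n => ?_⟩, fun t x => rfl, fun k n T => hdec k n T⟩
  obtain ⟨C, hC⟩ := hdec k n (|t| + 1)
  exact ⟨C, hC t (mem_Icc_abs t)⟩

end KernelFamily

end KernelFamilies

/-! ### The y-dependent factor and the operator L_y^† -/

section TransposeOperator

variable {d : ℕ}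

theorem IsWidth.bilinC_comm {Θ : Matrix (Fin d) (Fin d) ℂ} (hΘ : IsWidth Θ) (a b : Conf d) :
    bilinC Θ a b = bilinC Θ b a := by
  rw [bilinC_apply, bilinC_apply, Matrix.dotProduct_mulVec, ← Matrix.mulVec_transpose, hΘ.symm.eq,
    dotProduct_comm]

/-- The part of the phase that depends on `y`. -/
noncomputable def widthPhase (Θ : Matrix (Fin d) (Fin d) ℂ) (w : Conf d × Conf d × Conf d) : ℂ :=
  -pairC w.2.1 (w.2.2 - w.1) + Complex.I / 2 * bilinC Θ (w.2.2 - w.1) (w.2.2 - w.1)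

/-- The factor of the integral kernel that depends on `y`. -/
noncomputable def gaussFactor (ε : ℝ) (Θ : Matrix (Fin d) (Fin d) ℂ)
    (w : Conf d × Conf d × Conf d) : ℂ :=
  Complex.exp (Complex.I / (ε : ℂ) * widthPhase Θ w)

theorem phase_eq_add (κ : Phase d → Phase d) (S : Phase d → ℝ) (Θx Θy : Matrix (Fin d) (Fin d) ℂ)
    (x y q p : Conf d) : phase κ S Θx Θy x y q p = ((S (q, p) : ℂ) +
      pairC (κ (q, p)).2 (x - (κ (q, p)).1) +
      Complex.I / 2 * bilinC Θx (x - (κ (q, p)).1) (x - (κ (q, p)).1)) +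
      widthPhase Θy (q, p, y) := by
  simp only [phase, widthPhase, pairC_apply, bilinC_apply]
  ring

/-- The separation of x and y, which allows the y-integral to be carried out first, independently of
x, κ and S. -/
theorem cexp_phase (ε : ℝ) (κ : Phase d → Phase d) (S : Phase d → ℝ)
    (Θx Θy : Matrix (Fin d) (Fin d) ℂ) (x y q p : Conf d) :
    Complex.exp (Complex.I / (ε : ℂ) * phase κ S Θx Θy x y q p) =
      kernel ε κ S Θx x (q, p) * gaussFactor ε Θy (q, p, y) := by
  rw [phase_eq_add, mul_add, Complex.exp_add, kernel, kernelExp, gaussFactor]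

/-- The component `∂_{y_j} Φ` of the gradient of the phase. -/
noncomputable def gradComp (Θ : Matrix (Fin d) (Fin d) ℂ) (j : Fin d) :
    Conf d × Conf d × Conf d →L[ℝ] ℂ :=
  -(coordC j ∘L ContinuousLinearMap.fst ℝ _ _ ∘L ContinuousLinearMap.snd ℝ _ _) +
    ∑ k, (Complex.I * Θ j k) • (coordC k ∘L
      (ContinuousLinearMap.snd ℝ _ _ ∘L ContinuousLinearMap.snd ℝ _ _ -
        ContinuousLinearMap.fst ℝ _ _))

theorem gradComp_apply (Θ : Matrix (Fin d) (Fin d) ℂ) (j : Fin d) (w : Conf d × Conf d × Conf d) :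
    gradComp Θ j w = -toC w.2.1 j + Complex.I * Θ.mulVec (toC (w.2.2 - w.1)) j := by
  simp only [gradComp, add_apply, neg_apply, sum_apply, smul_apply, Matrix.mulVec, dotProduct,
    Finset.mul_sum]
  congr 1
  refine Finset.sum_congr rfl fun k _ => ?_
  rw [smul_eq_mul, mul_assoc]
  rfl

theorem sum_gradComp_coordC (Θ : Matrix (Fin d) (Fin d) ℂ)
    (w : Conf d × Conf d × Conf d) (v : Conf d) :
    ∑ j, gradComp Θ j w * toC v j = -pairC w.2.1 v + Complex.I * bilinC Θ v (w.2.2 - w.1) := by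
  simp only [gradComp_apply, pairC_apply, bilinC_apply, dotProduct, Finset.mul_sum, add_mul,
    Finset.sum_add_distrib, neg_mul, Finset.sum_neg_distrib]
  congr 1
  exact Finset.sum_congr rfl fun j _ => by ring

theorem hasFDerivAt_widthPhase_right {Θ : Matrix (Fin d) (Fin d) ℂ} (hΘ : IsWidth Θ)
    (q p y : Conf d) : HasFDerivAt (fun y => widthPhase Θ (q, p, y))
      (∑ j, gradComp Θ j (q, p, y) • coordC j) y := by
  have h1 : HasFDerivAt (fun y : Conf d => y - q) (ContinuousLinearMap.id ℝ _) y :=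
    (hasFDerivAt_id y).sub_const _
  have h2 := (pairC p).hasFDerivAt.comp y h1
  have h3 := (bilinC Θ).hasFDerivAt_of_bilinear h1 h1
  refine (h2.neg.add (h3.const_mul (Complex.I / 2))).congr_fderiv ?_
  refine ContinuousLinearMap.ext fun v => ?_
  have h4 := sum_gradComp_coordC Θ (q, p, y) v
  have h5 := hΘ.bilinC_comm (y - q) v
  simp only [sum_apply, smul_apply, coordC_apply, smul_eq_mul]
  rw [h4]
  simp [-map_sub, h5]
  ring

theorem fderiv_phase_right {Θy : Matrix (Fin d) (Fin d) ℂ} (hΘ : IsWidth Θy)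
    (κ : Phase d → Phase d) (S : Phase d → ℝ) (Θx : Matrix (Fin d) (Fin d) ℂ) (x y q p : Conf d) :
    HasFDerivAt (fun y => phase κ S Θx Θy x y q p)
      (∑ j, gradComp Θy j (q, p, y) • coordC j) y := by
  simp only [phase_eq_add]
  exact (hasFDerivAt_widthPhase_right hΘ q p y).const_add _

theorem sum_mul_basisVec (f : Fin d → ℂ) (j : Fin d) :
    (∑ k, f k • coordC k : Conf d →L[ℝ] ℂ) (basisVec j) = f j := by
  simp only [sum_apply, smul_apply, coordC_apply, smul_eq_mul]
  rw [Finset.sum_eq_single j]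
  · simp [toC, basisVec]
  · intro k _ hk
    simp [toC, basisVec, hk]
  · simp

theorem pderiv_phase {Θy : Matrix (Fin d) (Fin d) ℂ} (hΘ : IsWidth Θy)
    (κ : Phase d → Phase d) (S : Phase d → ℝ) (Θx : Matrix (Fin d) (Fin d) ℂ) (x q p : Conf d)
    (j : Fin d) (y : Conf d) :
    pderiv j (fun y => phase κ S Θx Θy x y q p) y = gradComp Θy j (q, p, y) := by
  rw [pderiv, (fderiv_phase_right hΘ κ S Θx x y q p).fderiv, sum_mul_basisVec]

theorem pderiv_star_phase {Θy : Matrix (Fin d) (Fin d) ℂ} (hΘ : IsWidth Θy)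
    (κ : Phase d → Phase d) (S : Phase d → ℝ) (Θx : Matrix (Fin d) (Fin d) ℂ) (x q p : Conf d)
    (j : Fin d) (y : Conf d) :
    pderiv j (fun y => star (phase κ S Θx Θy x y q p)) y = star (gradComp Θy j (q, p, y)) := by
  have h := Complex.conjCLE.toContinuousLinearMap.hasFDerivAt.comp y
    (fderiv_phase_right hΘ κ S Θx x y q p)
  have h' : HasFDerivAt (fun y => star (phase κ S Θx Θy x y q p)) _ y := h
  rw [pderiv, h'.fderiv]
  change star ((∑ k, gradComp Θy k (q, p, y) • coordC k : Conf d →L[ℝ] ℂ) (basisVec j)) = _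
  rw [sum_mul_basisVec]

/-- `1 + |∇_y Φ|²` as a function of `(q, p, y)`. -/
noncomputable def gradSq (Θ : Matrix (Fin d) (Fin d) ℂ) (w : Conf d × Conf d × Conf d) : ℝ :=
  1 + ∑ j, ‖gradComp Θ j w‖ ^ 2

theorem one_le_gradSq (Θ : Matrix (Fin d) (Fin d) ℂ) (w : Conf d × Conf d × Conf d) :
    1 ≤ gradSq Θ w :=
  le_add_of_nonneg_right (Finset.sum_nonneg fun _ _ => sq_nonneg _)

theorem gradWeight_phase {Θy : Matrix (Fin d) (Fin d) ℂ} (hΘ : IsWidth Θy)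
    (κ : Phase d → Phase d) (S : Phase d → ℝ) (Θx : Matrix (Fin d) (Fin d) ℂ) (x q p y : Conf d) :
    gradWeight (fun y => phase κ S Θx Θy x y q p) y = (gradSq Θy (q, p, y) : ℂ) := by
  rw [gradWeight, gradSq]
  simp only [pderiv_phase hΘ]

/-- `(L_y^†)^n φ` as a function of `(q, p, y)`. -/
noncomputable def iterL (ε : ℝ) (Θ : Matrix (Fin d) (Fin d) ℂ) (φ : Conf d → ℂ) :
    ℕ → Conf d × Conf d × Conf d → ℂ
  | 0 => fun w => φ w.2.2
  | n + 1 => fun w => iterL ε Θ φ n w / (gradSq Θ w : ℂ) + Complex.I * (ε : ℂ) *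
      ∑ j, fderiv ℝ (fun w' => star (gradComp Θ j w') * iterL ε Θ φ n w' / (gradSq Θ w' : ℂ)) w
        (0, 0, basisVec j)

end TransposeOperator

/-! ### Symbol estimates for powers of L_y^† -/

section TransposeSymbols

variable {d : ℕ} (Θ : Matrix (Fin d) (Fin d) ℂ)

theorem sqrt_gradSq_pos (w : Conf d × Conf d × Conf d) : 0 < Real.sqrt (gradSq Θ w) :=
  Real.sqrt_pos.2 (zero_lt_one.trans_le (one_le_gradSq Θ w))

theorem one_le_sqrt_gradSq (w : Conf d × Conf d × Conf d) : 1 ≤ Real.sqrt (gradSq Θ w) :=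
  Real.one_le_sqrt.2 (one_le_gradSq Θ w)

theorem norm_gradComp_le (j : Fin d) (w : Conf d × Conf d × Conf d) :
    ‖gradComp Θ j w‖ ≤ Real.sqrt (gradSq Θ w) := by
  refine Real.le_sqrt_of_sq_le ?_
  rw [gradSq]
  have := Finset.single_le_sum (f := fun j => ‖gradComp Θ j w‖ ^ 2) (fun i _ => sq_nonneg _)
    (Finset.mem_univ j)
  linarith

/-- The weight ρ = (1+|∇_yΦ|²)^{1/2} is adapted to the gradient: a component is linear in (q, p, y),
bounded by ρ, and has constant differential, while ρ ≥ 1. -/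
theorem gradComp_symbFam (j : Fin d) :
    SymbFam (fun w => Real.sqrt (gradSq Θ w)) (fun (_ : Unit) => (gradComp Θ j : _ → ℂ)) := by
  refine SymbFam.of_fderiv (fun _ => (gradComp Θ j).differentiable) zero_le_one
    (fun _ w => by simpa using norm_gradComp_le Θ j w) ?_
  have : (fun (_ : Unit) => fderiv ℝ (gradComp Θ j : _ → ℂ)) = fun _ _ => gradComp Θ j := by
    funext _ w
    exact (gradComp Θ j).fderiv
  rw [this]
  exact SymbFam.const _ (M := ‖gradComp Θ j‖) (fun _ => le_rfl) (one_le_sqrt_gradSq Θ)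

theorem star_gradComp_symbFam (j : Fin d) :
    SymbFam (fun w => Real.sqrt (gradSq Θ w)) (fun (_ : Unit) w => star (gradComp Θ j w)) :=
  (gradComp_symbFam Θ j).clm Complex.conjCLE.toContinuousLinearMap

theorem ofReal_gradSq (w : Conf d × Conf d × Conf d) :
    (gradSq Θ w : ℂ) = 1 + ∑ j, gradComp Θ j w * star (gradComp Θ j w) := by
  rw [gradSq]
  push_cast
  congr 1
  refine Finset.sum_congr rfl fun j _ => ?_
  exact (Complex.mul_conj' _).symm

theorem gradSq_symbFam :
    SymbFam (fun w => Real.sqrt (gradSq Θ w) * Real.sqrt (gradSq Θ w))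
      (fun (_ : Unit) w => (gradSq Θ w : ℂ)) := by
  simp only [ofReal_gradSq]
  have hpos : ∀ w, 0 ≤ Real.sqrt (gradSq Θ w) := fun w => Real.sqrt_nonneg _
  refine (SymbFam.const (fun _ => (1 : ℂ)) (M := 1) (by simp) fun w =>
    one_le_mul_of_one_le_of_one_le (one_le_sqrt_gradSq Θ w) (one_le_sqrt_gradSq Θ w)).add ?_
  exact SymbFam.sum (fun w => mul_nonneg (hpos w) (hpos w)) fun j _ =>
    (gradComp_symbFam Θ j).mul (star_gradComp_symbFam Θ j) hpos

theorem gradSq_inv_symbFam :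
    SymbFam (fun w => (Real.sqrt (gradSq Θ w) * Real.sqrt (gradSq Θ w))⁻¹)
      (fun (_ : Unit) w => (gradSq Θ w : ℂ)⁻¹) := by
  refine (gradSq_symbFam Θ).inv (fun w => mul_pos (sqrt_gradSq_pos Θ w) (sqrt_gradSq_pos Θ w))
    zero_lt_one fun _ w => ?_
  have h := zero_le_one.trans (one_le_gradSq Θ w)
  rw [one_mul, Real.mul_self_sqrt h, Complex.norm_real]
  exact Real.le_norm_self _

theorem schwartz_symbFam (φ : 𝓢(Conf d, ℂ)) (N : ℕ) :
    SymbFam (fun y => ((1 + ‖y‖) ^ N)⁻¹) (fun (_ : Unit) => (φ : Conf d → ℂ)) := by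
  refine ⟨fun _ => φ.smooth ⊤, fun k => ?_⟩
  refine ⟨2 ^ N * (Finset.Iic (N, k)).sup (fun m => SchwartzMap.seminorm ℝ m.1 m.2) φ,
    by positivity, fun _ y => ?_⟩
  rw [← div_eq_mul_inv, le_div_iff₀ (by positivity), mul_comm]
  exact SchwartzMap.one_add_le_sup_seminorm_apply (𝕜 := ℝ) (m := (N, k)) le_rfl le_rfl φ y

/-- The gradient component costs one power of ρ and the division by ρ² gains two, so one power of
decay is won. -/
theorem transport_symbFam {ψ : Conf d × Conf d × Conf d → ℂ} {v : Conf d × Conf d × Conf d → ℝ}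
    (hv : ∀ w, 0 ≤ v w) {n : ℕ}
    (h : SymbFam (fun w => (Real.sqrt (gradSq Θ w) ^ n)⁻¹ * v w) (fun (_ : Unit) => ψ))
    (j : Fin d) :
    SymbFam (fun w => (Real.sqrt (gradSq Θ w) ^ (n + 1))⁻¹ * v w)
      (fun (_ : Unit) w => star (gradComp Θ j w) * ψ w / (gradSq Θ w : ℂ)) := by
  have hpos := sqrt_gradSq_pos Θ
  have h1 := h.mul (gradSq_inv_symbFam Θ) fun w => by
    have := hpos w
    have := hv w
    positivity
  have h5 := (star_gradComp_symbFam Θ j).mul h1 fun w => (hpos w).le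
  simp only [div_eq_mul_inv, mul_assoc]
  refine h5.mono 1 zero_le_one fun w => ?_
  have h3 := (hpos w).ne'
  rw [one_mul, pow_succ]
  field_simp
  exact le_rfl

theorem div_gradSq_symbFam {ψ : Conf d × Conf d × Conf d → ℂ} {v : Conf d × Conf d × Conf d → ℝ}
    (hv : ∀ w, 0 ≤ v w) {n : ℕ}
    (h : SymbFam (fun w => (Real.sqrt (gradSq Θ w) ^ n)⁻¹ * v w) (fun (_ : Unit) => ψ)) :
    SymbFam (fun w => (Real.sqrt (gradSq Θ w) ^ (n + 1))⁻¹ * v w)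
      (fun (_ : Unit) w => ψ w / (gradSq Θ w : ℂ)) := by
  have hpos := sqrt_gradSq_pos Θ
  have h1 := h.mul (gradSq_inv_symbFam Θ) fun w => by
    have := hpos w
    have := hv w
    positivity
  simp only [div_eq_mul_inv]
  refine h1.mono 1 zero_le_one fun w => ?_
  have h2 := one_le_sqrt_gradSq Θ w
  have h3 := hpos w
  have h0 := hv w
  have h4 : (Real.sqrt (gradSq Θ w) * Real.sqrt (gradSq Θ w))⁻¹ ≤
      (Real.sqrt (gradSq Θ w))⁻¹ := by
    gcongr
    nlinarith
  calc _ ≤ (Real.sqrt (gradSq Θ w) ^ n)⁻¹ * v w * (Real.sqrt (gradSq Θ w))⁻¹ := by gcongr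
    _ = _ := by
      rw [pow_succ, mul_inv]
      ring

/-- Each application gains a factor ρ⁻¹ in all derivatives: differentiation does not spoil the
weight. The decay in y is that of φ, with `N` at choice. -/
theorem iterL_symbFam (ε : ℝ) (φ : 𝓢(Conf d, ℂ)) (n N : ℕ) :
    SymbFam (fun w => (Real.sqrt (gradSq Θ w) ^ n)⁻¹ * ((1 + ‖w.2.2‖) ^ N)⁻¹)
      (fun (_ : Unit) => iterL ε Θ φ n) := by
  have hpos := sqrt_gradSq_pos Θ
  induction n with
  | zero =>
    refine ((schwartz_symbFam φ N).comp_clm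
      (ContinuousLinearMap.snd ℝ (Conf d) (Conf d) ∘L
        ContinuousLinearMap.snd ℝ (Conf d) (Conf d × Conf d))).mono 1 zero_le_one fun w => ?_
    simp
  | succ n ih =>
    have hv : ∀ w : Conf d × Conf d × Conf d, 0 ≤ ((1 + ‖w.2.2‖) ^ N)⁻¹ := fun w => by positivity
    refine SymbFam.add (div_gradSq_symbFam Θ hv ih) ?_
    refine SymbFam.clm (L := ContinuousLinearMap.mul ℝ ℂ (Complex.I * ε)) ?_
    refine SymbFam.sum (fun w => ?_) fun j _ => ?_
    · have := hpos w
      positivity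
    · exact (transport_symbFam Θ hv ih j).fderiv.clm (ContinuousLinearMap.apply ℝ ℂ
        ((0, 0, basisVec j) : Conf d × Conf d × Conf d))

end TransposeSymbols

/-! ### Decay of the regularised integrand -/

section IterateTranspose

variable {d : ℕ} {Θ : Matrix (Fin d) (Fin d) ℂ}

theorem hasFDerivAt_comp_right {F : Conf d × Conf d × Conf d → ℂ} (hF : Differentiable ℝ F)
    (q p y : Conf d) : HasFDerivAt (fun y => F (q, p, y))
      (fderiv ℝ F (q, p, y) ∘L (ContinuousLinearMap.inr ℝ (Conf d) (Conf d × Conf d) ∘L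
        ContinuousLinearMap.inr ℝ (Conf d) (Conf d))) y := by
  have h2 : HasFDerivAt (fun y : Conf d => (q, p, y)) (ContinuousLinearMap.inr ℝ (Conf d)
      (Conf d × Conf d) ∘L ContinuousLinearMap.inr ℝ (Conf d) (Conf d)) y :=
    (ContinuousLinearMap.hasFDerivAt _).const_add (q, p, (0 : Conf d)) |>.congr_of_eventuallyEq
      (Eventually.of_forall fun y => by simp)
  exact (hF (q, p, y)).hasFDerivAt.comp y h2

theorem pderiv_comp_right {F : Conf d × Conf d × Conf d → ℂ} (hF : Differentiable ℝ F)
    (q p y : Conf d) (j : Fin d) :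
    pderiv j (fun y => F (q, p, y)) y = fderiv ℝ F (q, p, y) (0, 0, basisVec j) := by
  rw [pderiv, (hasFDerivAt_comp_right hF q p y).fderiv]
  rfl

/-- The coefficients of L_y^† depend only on (q, p, y), and a symbol independent of y is a constant
for it. -/
theorem iterate_transposeL (hΘ : IsWidth Θ) (ε : ℝ) (κ : Phase d → Phase d) (S : Phase d → ℝ)
    (Θx : Matrix (Fin d) (Fin d) ℂ) (φ : 𝓢(Conf d, ℂ)) (x q p : Conf d) (c : ℂ) (n : ℕ) :
    (transposeL ε (fun y => phase κ S Θx Θ x y q p))^[n] (fun y => c * φ y) =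
      fun y => c * iterL ε Θ φ n (q, p, y) := by
  induction n with
  | zero => rfl
  | succ n ih =>
    rw [Function.iterate_succ_apply', ih]
    funext y
    have hv : ∀ w : Conf d × Conf d × Conf d, 0 ≤ ((1 + ‖w.2.2‖) ^ 0)⁻¹ := fun w => by positivity
    have hd := fun j => (transport_symbFam Θ hv (iterL_symbFam Θ ε φ n 0) j).differentiable ()
    have h1 : ∀ j, pderiv j (fun y' => pderiv j (fun y'' => star (phase κ S Θx Θ x y'' q p)) y' *
        (c * iterL ε Θ φ n (q, p, y')) / gradWeight (fun y => phase κ S Θx Θ x y q p) y') y =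
        c * fderiv ℝ (fun w' => star (gradComp Θ j w') * iterL ε Θ φ n w' / (gradSq Θ w' : ℂ))
          (q, p, y) (0, 0, basisVec j) := by
      intro j
      simp only [pderiv_star_phase hΘ, gradWeight_phase hΘ]
      have h2 : (fun y' => star (gradComp Θ j (q, p, y')) * (c * iterL ε Θ φ n (q, p, y')) /
          (gradSq Θ (q, p, y') : ℂ)) = fun y' => c * (star (gradComp Θ j (q, p, y')) *
            iterL ε Θ φ n (q, p, y') / (gradSq Θ (q, p, y') : ℂ)) := by
        funext y'
        ring
      rw [h2, ← pderiv_comp_right (hd j), pderiv, pderiv,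
        fderiv_const_mul (hasFDerivAt_comp_right (hd j) q p y).differentiableAt]
      rfl
    rw [transposeL, Finset.sum_congr rfl fun j _ => h1 j, gradWeight_phase hΘ, iterL,
      ← Finset.mul_sum]
    ring

theorem norm_gaussFactor (ε : ℝ) (Θ : Matrix (Fin d) (Fin d) ℂ) (w : Conf d × Conf d × Conf d) :
    ‖gaussFactor ε Θ w‖ =
      Real.exp (-(1 / (2 * ε) * (bilinC Θ (w.2.2 - w.1) (w.2.2 - w.1)).re)) := by
  rw [gaussFactor, Complex.norm_exp, widthPhase, pairC_eq_inner]
  congr 1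
  set b := bilinC Θ (w.2.2 - w.1) (w.2.2 - w.1)
  have h : Complex.I / (ε : ℂ) * (-((inner ℝ w.2.1 (w.2.2 - w.1) : ℝ) : ℂ) +
      Complex.I / 2 * b) = ((-(inner ℝ w.2.1 (w.2.2 - w.1)) / ε : ℝ) : ℂ) * Complex.I -
        ((1 / (2 * ε) : ℝ) : ℂ) * b := by
    push_cast
    ring_nf
    rw [Complex.I_sq]
    ring
  rw [h]
  simp

theorem exists_norm_gaussFactor_le (hΘ : IsWidth Θ) {ε : ℝ} (hε : 0 < ε) : ∃ c : ℝ, 0 < c ∧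
    ∀ w, ‖gaussFactor ε Θ w‖ ≤ Real.exp (-(c * ‖w.2.2 - w.1‖ ^ 2)) := by
  obtain ⟨c, hc, hpos⟩ := IsWidth.exists_le_re (isCompact_singleton (x := (0 : ℝ)))
    (Θ := fun _ => Θ) (fun _ => hΘ) (fun _ _ => continuous_const)
  refine ⟨c / (2 * ε), by positivity, fun w => ?_⟩
  rw [norm_gaussFactor]
  refine Real.exp_le_exp.2 (neg_le_neg ?_)
  have := hpos 0 rfl (w.2.2 - w.1)
  calc c / (2 * ε) * ‖w.2.2 - w.1‖ ^ 2 = 1 / (2 * ε) * (c * ‖w.2.2 - w.1‖ ^ 2) := by ring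
    _ ≤ _ := by gcongr

theorem norm_gaussFactor_le_one (hΘ : IsWidth Θ) {ε : ℝ} (hε : 0 < ε)
    (w : Conf d × Conf d × Conf d) : ‖gaussFactor ε Θ w‖ ≤ 1 := by
  obtain ⟨c, hc, h⟩ := exists_norm_gaussFactor_le hΘ hε
  refine (h w).trans (Real.exp_le_one_iff.2 ?_)
  have : 0 ≤ c * ‖w.2.2 - w.1‖ ^ 2 := by positivity
  linarith

theorem contDiff_gaussFactor (ε : ℝ) (Θ : Matrix (Fin d) (Fin d) ℂ) :
    ContDiff ℝ ∞ (gaussFactor ε Θ) := by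
  have h : ContDiff ℝ ∞ fun w : Conf d × Conf d × Conf d => pairC w.2.1 (w.2.2 - w.1) := by
    simp only [pairC_eq_inner]
    have h1 : ContDiff ℝ ∞ fun w : Conf d × Conf d × Conf d => w.2.1 := by fun_prop
    have h2 : ContDiff ℝ ∞ fun w : Conf d × Conf d × Conf d => w.2.2 - w.1 := by fun_prop
    exact Complex.ofRealCLM.contDiff.comp (h1.inner ℝ h2)
  unfold gaussFactor widthPhase
  fun_prop

theorem norm_le_sum_abs (a : Conf d) : ‖a‖ ≤ ∑ j, |a j| := by
  have h := (EuclideanSpace.basisFun (Fin d) ℝ).sum_repr a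
  calc ‖a‖ = ‖∑ j, a j • (basisVec j : Conf d)‖ := by
        conv_lhs => rw [← h]
        simp [basisVec]
    _ ≤ ∑ j, ‖a j • (basisVec j : Conf d)‖ := norm_sum_le _ _
    _ = _ := by simp [norm_smul, basisVec]

/-- The gradient of the phase controls `p` up to powers of `y - q`. -/
theorem exists_one_add_norm_le_sqrt_gradSq (Θ : Matrix (Fin d) (Fin d) ℂ) : ∃ K : ℝ, 0 ≤ K ∧
    ∀ w : Conf d × Conf d × Conf d,
      1 + ‖w.2.1‖ ≤ K * Real.sqrt (gradSq Θ w) * (1 + ‖w.2.2 - w.1‖) := by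
  refine ⟨1 + ∑ j, (1 + ‖gradComp Θ j‖), by positivity, fun w => ?_⟩
  set ρ := Real.sqrt (gradSq Θ w)
  set r := ‖w.2.2 - w.1‖
  have hρ : 1 ≤ ρ := one_le_sqrt_gradSq Θ w
  have hr : 0 ≤ r := norm_nonneg _
  have hρr : 1 ≤ ρ * (1 + r) := one_le_mul_of_one_le_of_one_le hρ (by linarith)
  have h1 : ∀ j, |w.2.1 j| ≤ (1 + ‖gradComp Θ j‖) * (ρ * (1 + r)) := by
    intro j
    -- The gradient component is -p_j + i(Θ(y-q))_j, and its second summand is the same functional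
    -- at (0, 0, y-q).
    have h2 : toC w.2.1 j = gradComp Θ j (0, 0, w.2.2 - w.1) - gradComp Θ j w := by
      rw [gradComp_apply, gradComp_apply]
      simp [toC]
    have h3 : |w.2.1 j| = ‖toC w.2.1 j‖ := by simp [toC]
    have h4 : ‖gradComp Θ j (0, 0, w.2.2 - w.1)‖ ≤ ‖gradComp Θ j‖ * r := by
      refine ((gradComp Θ j).le_opNorm _).trans_eq ?_
      simp [Prod.norm_def, r]
    rw [h3, h2]
    refine (norm_sub_le _ _).trans ?_
    have h5 : ‖gradComp Θ j w‖ ≤ ρ := norm_gradComp_le Θ j w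
    have h6 : ‖gradComp Θ j‖ * r ≤ ‖gradComp Θ j‖ * (ρ * (1 + r)) := by
      gcongr
      nlinarith
    nlinarith
  have h2 := (norm_le_sum_abs w.2.1).trans (Finset.sum_le_sum fun j _ => h1 j)
  rw [← Finset.sum_mul] at h2
  linarith

/-- The Gaussian factor together with the powers of `L_y^†` yields decay in `(q, p, y)`. -/
theorem exists_gaussFactor_decay (hΘ : IsWidth Θ) {ε : ℝ} (hε : 0 < ε) (n A B : ℕ) :
    ∃ C : ℝ, 0 ≤ C ∧ ∀ w : Conf d × Conf d × Conf d, ‖gaussFactor ε Θ w‖ *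
      ((Real.sqrt (gradSq Θ w) ^ n)⁻¹ * ((1 + ‖w.2.2‖) ^ (A + B))⁻¹) ≤
        C * (((1 + ‖w.1‖) ^ A)⁻¹ * (((1 + ‖w.2.1‖) ^ n)⁻¹ * ((1 + ‖w.2.2‖) ^ B)⁻¹)) := by
  obtain ⟨K, hK, hp⟩ := exists_one_add_norm_le_sqrt_gradSq Θ
  obtain ⟨c, hc, hg⟩ := exists_norm_gaussFactor_le hΘ hε
  -- `A` powers of 1+|y-q| pay for trading q against y, and `n` powers for trading p against ρ.
  obtain ⟨C, hC, he⟩ := one_add_pow_mul_exp_neg_sq_le hc (A + n)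
  refine ⟨C * K ^ n, by positivity, fun w => ?_⟩
  have hw := hp w
  have hρpos := sqrt_gradSq_pos Θ w
  set ρ := Real.sqrt (gradSq Θ w)
  have hr := norm_nonneg (w.2.2 - w.1)
  have hq : 1 + ‖w.1‖ ≤ (1 + ‖w.2.2 - w.1‖) * (1 + ‖w.2.2‖) := by
    have h1 : ‖w.1‖ ≤ ‖w.2.2 - w.1‖ + ‖w.2.2‖ := by
      have := norm_sub_le w.2.2 (w.2.2 - w.1)
      rw [sub_sub_cancel] at this
      linarith
    nlinarith [mul_nonneg hr (norm_nonneg w.2.2)]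
  have h1 : ‖gaussFactor ε Θ w‖ * ((1 + ‖w.1‖) ^ A * (1 + ‖w.2.1‖) ^ n) ≤
      C * K ^ n * (ρ ^ n * (1 + ‖w.2.2‖) ^ A) := by
    calc _ ≤ Real.exp (-(c * ‖w.2.2 - w.1‖ ^ 2)) *
          (((1 + ‖w.2.2 - w.1‖) * (1 + ‖w.2.2‖)) ^ A * (K * ρ * (1 + ‖w.2.2 - w.1‖)) ^ n) := by
          gcongr
          exact hg w
      _ = (1 + ‖w.2.2 - w.1‖) ^ (A + n) * Real.exp (-(c * ‖w.2.2 - w.1‖ ^ 2)) *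
          (K ^ n * (ρ ^ n * (1 + ‖w.2.2‖) ^ A)) := by
          simp only [mul_pow, pow_add]
          ring
      _ ≤ C * (K ^ n * (ρ ^ n * (1 + ‖w.2.2‖) ^ A)) := by
          gcongr
          exact he _ hr
      _ = _ := by ring
  have h2 : (0 : ℝ) < (1 + ‖w.1‖) ^ A := by positivity
  have h3 : (0 : ℝ) < (1 + ‖w.2.1‖) ^ n := by positivity
  have h4 : (0 : ℝ) < (1 + ‖w.2.2‖) ^ A := by positivity
  have h5 : (0 : ℝ) < (1 + ‖w.2.2‖) ^ B := by positivity
  have h6 : (0 : ℝ) < ρ ^ n := by positivity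
  rw [pow_add, ← mul_inv, ← mul_inv, ← mul_inv, ← div_eq_mul_inv, ← div_eq_mul_inv,
    div_le_div_iff₀ (by positivity) (by positivity)]
  calc _ = ‖gaussFactor ε Θ w‖ * ((1 + ‖w.1‖) ^ A * (1 + ‖w.2.1‖) ^ n) *
        (1 + ‖w.2.2‖) ^ B := by ring
    _ ≤ C * K ^ n * (ρ ^ n * (1 + ‖w.2.2‖) ^ A) * (1 + ‖w.2.2‖) ^ B := by gcongr
    _ = _ := by ring

end IterateTranspose

/-! ### The y-integral: independence of n and rapid decay -/

section GaussTransform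

variable {d : ℕ} {Θ : Matrix (Fin d) (Fin d) ℂ}

/-- The integral over `y` of the `y`-dependent part of the kernel against `φ`. -/
noncomputable def gaussTransform (ε : ℝ) (Θ : Matrix (Fin d) (Fin d) ℂ) (φ : Conf d → ℂ)
    (z : Phase d) : ℂ :=
  ∫ y, gaussFactor ε Θ (z.1, z.2, y) * φ y

theorem integrable_inv_one_add_norm_pow (d : ℕ) :
    Integrable fun y : Conf d => ((1 + ‖y‖) ^ (d + 1))⁻¹ := by
  have h := integrable_one_add_norm (E := Conf d) (μ := volume) (r := ((d + 1 : ℕ) : ℝ))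
    (by rw [finrank_euclideanSpace_fin]; push_cast; linarith)
  refine h.congr (Eventually.of_forall fun y => ?_)
  have hy : 0 ≤ 1 + ‖y‖ := by positivity
  simp only [Real.rpow_neg hy, Real.rpow_natCast]

theorem integrable_gaussFactor_mul (hΘ : IsWidth Θ) {ε : ℝ} (hε : 0 < ε)
    {F : Conf d × Conf d × Conf d → ℂ} {n : ℕ}
    (hF : SymbFam (fun w => (Real.sqrt (gradSq Θ w) ^ n)⁻¹ * ((1 + ‖w.2.2‖) ^ (d + 1))⁻¹)
      (fun (_ : Unit) => F)) (q p : Conf d) :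
    Integrable fun y => gaussFactor ε Θ (q, p, y) * F (q, p, y) := by
  obtain ⟨C, hC, hb⟩ := hF.norm_le
  refine ((integrable_inv_one_add_norm_pow d).const_mul C).mono' ?_
    (Eventually.of_forall fun y => ?_)
  · have h1 := (contDiff_gaussFactor ε Θ).continuous
    have h2 := (hF.smooth ()).continuous
    exact Continuous.aestronglyMeasurable (by fun_prop)
  · rw [norm_mul]
    have h3 : (Real.sqrt (gradSq Θ (q, p, y)) ^ n)⁻¹ ≤ 1 :=
      inv_le_one_of_one_le₀ (one_le_pow₀ (one_le_sqrt_gradSq Θ _))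
    calc _ ≤ 1 * (C * ((Real.sqrt (gradSq Θ (q, p, y)) ^ n)⁻¹ * ((1 + ‖y‖) ^ (d + 1))⁻¹)) := by
          gcongr
          · exact norm_gaussFactor_le_one hΘ hε _
          · exact hb () _
      _ ≤ 1 * (C * (1 * ((1 + ‖y‖) ^ (d + 1))⁻¹)) := by gcongr
      _ = _ := by ring

theorem hasFDerivAt_gaussFactor_right (hΘ : IsWidth Θ) (ε : ℝ) (q p y : Conf d) :
    HasFDerivAt (fun y => gaussFactor ε Θ (q, p, y)) (gaussFactor ε Θ (q, p, y) •
      (Complex.I / (ε : ℂ)) • ∑ j, gradComp Θ j (q, p, y) • coordC j) y :=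
  ((hasFDerivAt_widthPhase_right hΘ q p y).const_mul (Complex.I / (ε : ℂ))).cexp

/-- Integration by parts: `L_y^†` does not change the integral. -/
theorem integral_gaussFactor_iterL (hΘ : IsWidth Θ) {ε : ℝ} (hε : 0 < ε) (φ : 𝓢(Conf d, ℂ))
    (z : Phase d) (n : ℕ) : ∫ y, gaussFactor ε Θ (z.1, z.2, y) * iterL ε Θ φ n (z.1, z.2, y) =
      gaussTransform ε Θ φ z := by
  obtain ⟨q, p⟩ := z
  induction n with
  | zero => rfl
  | succ n ih =>
    rw [← ih]
    have hv : ∀ w : Conf d × Conf d × Conf d, 0 ≤ ((1 + ‖w.2.2‖) ^ (d + 1))⁻¹ :=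
      fun w => by positivity
    have hψ := iterL_symbFam Θ ε φ n (d + 1)
    have hF := fun j => transport_symbFam Θ hv hψ j
    have hε0 : (ε : ℂ) ≠ 0 := by exact_mod_cast hε.ne'
    have hpos := sqrt_gradSq_pos Θ
    have i0 := integrable_gaussFactor_mul hΘ hε (div_gradSq_symbFam Θ hv hψ) q p
    have i1 : ∀ j, Integrable fun y => gaussFactor ε Θ (q, p, y) *
        (gradComp Θ j (q, p, y) * (star (gradComp Θ j (q, p, y)) * iterL ε Θ φ n (q, p, y) /
          (gradSq Θ (q, p, y) : ℂ))) := fun j =>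
      integrable_gaussFactor_mul hΘ hε (n := n)
        (((gradComp_symbFam Θ j).mul (hF j) fun w => (hpos w).le).mono 1 zero_le_one fun w => by
          have h3 := (hpos w).ne'
          rw [one_mul, pow_succ]
          field_simp
          exact le_rfl) q p
    have i2 : ∀ j, Integrable fun y => gaussFactor ε Θ (q, p, y) * fderiv ℝ
        (fun w => star (gradComp Θ j w) * iterL ε Θ φ n w / (gradSq Θ w : ℂ)) (q, p, y)
          (0, 0, basisVec j) := fun j => integrable_gaussFactor_mul hΘ hε ((hF j).fderiv.clm
      (ContinuousLinearMap.apply ℝ ℂ ((0, 0, basisVec j) : Conf d × Conf d × Conf d))) q p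
    -- The Gaussian factor has derivative (i/ε) ∂_jΦ times itself, which supplies the missing ∂_jΦ
    -- next to its conjugate.
    have hparts : ∀ j, ∫ y, gaussFactor ε Θ (q, p, y) *
        fderiv ℝ (fun w => star (gradComp Θ j w) * iterL ε Θ φ n w / (gradSq Θ w : ℂ)) (q, p, y)
          (0, 0, basisVec j) = -(Complex.I / (ε : ℂ)) * ∫ y, gaussFactor ε Θ (q, p, y) *
        (gradComp Θ j (q, p, y) * (star (gradComp Θ j (q, p, y)) * iterL ε Θ φ n (q, p, y) /
          (gradSq Θ (q, p, y) : ℂ))) := by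
      intro j
      have hd := (hF j).differentiable ()
      have hg : ∀ y, fderiv ℝ (fun y => gaussFactor ε Θ (q, p, y)) y (basisVec j) =
          Complex.I / (ε : ℂ) * (gaussFactor ε Θ (q, p, y) * gradComp Θ j (q, p, y)) := by
        intro y
        rw [(hasFDerivAt_gaussFactor_right hΘ ε q p y).fderiv, smul_apply, smul_apply,
          sum_mul_basisVec]
        simp only [smul_eq_mul]
        ring
      have h := integral_mul_fderiv_eq_neg_fderiv_mul_of_integrable (𝕜 := ℂ) (μ := volume)
        (f := fun y => gaussFactor ε Θ (q, p, y))
        (g := fun y => star (gradComp Θ j (q, p, y)) * iterL ε Θ φ n (q, p, y) /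
          (gradSq Θ (q, p, y) : ℂ)) (v := basisVec j) ?_ ?_
        (integrable_gaussFactor_mul hΘ hε (hF j) q p)
        (fun y _ => (hasFDerivAt_gaussFactor_right hΘ ε q p y).differentiableAt)
        (fun y _ => (hasFDerivAt_comp_right hd q p y).differentiableAt)
      · simp only [hg] at h
        have h' : ∀ y, fderiv ℝ (fun y => star (gradComp Θ j (q, p, y)) *
            iterL ε Θ φ n (q, p, y) / (gradSq Θ (q, p, y) : ℂ)) y (basisVec j) = fderiv ℝ
            (fun w => star (gradComp Θ j w) * iterL ε Θ φ n w / (gradSq Θ w : ℂ)) (q, p, y)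
              (0, 0, basisVec j) := fun y => pderiv_comp_right hd q p y j
        simp only [h'] at h
        rw [h, neg_mul, ← integral_const_mul]
        congr 2
        funext y
        ring
      · simp only [hg]
        refine ((i1 j).const_mul (Complex.I / (ε : ℂ))).congr (Eventually.of_forall fun y => ?_)
        simp only
        ring
      · refine (i2 j).congr (Eventually.of_forall fun y => ?_)
        simp only
        congr 1
        exact (pderiv_comp_right hd q p y j).symm
    have e1 : ∀ y, gaussFactor ε Θ (q, p, y) * iterL ε Θ φ (n + 1) (q, p, y) =
        gaussFactor ε Θ (q, p, y) * (iterL ε Θ φ n (q, p, y) / (gradSq Θ (q, p, y) : ℂ)) +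
        ∑ j, Complex.I * (ε : ℂ) * (gaussFactor ε Θ (q, p, y) * fderiv ℝ
          (fun w => star (gradComp Θ j w) * iterL ε Θ φ n w / (gradSq Θ w : ℂ)) (q, p, y)
            (0, 0, basisVec j)) := by
      intro y
      rw [iterL, mul_add, Finset.mul_sum, Finset.mul_sum]
      congr 1
      exact Finset.sum_congr rfl fun j _ => by ring
    -- The splitting 1 = (1 + ∑ |∂_jΦ|²)/(1+|∇_yΦ|²), which matches the zeroth-order and first-order
    -- parts of L_y^†.
    have e2 : ∀ y, gaussFactor ε Θ (q, p, y) * iterL ε Θ φ n (q, p, y) =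
        gaussFactor ε Θ (q, p, y) * (iterL ε Θ φ n (q, p, y) / (gradSq Θ (q, p, y) : ℂ)) +
        ∑ j, gaussFactor ε Θ (q, p, y) * (gradComp Θ j (q, p, y) *
          (star (gradComp Θ j (q, p, y)) * iterL ε Θ φ n (q, p, y) /
            (gradSq Θ (q, p, y) : ℂ))) := by
      intro y
      have h0 : (gradSq Θ (q, p, y) : ℂ) ≠ 0 := by
        exact_mod_cast (zero_lt_one.trans_le (one_le_gradSq Θ _)).ne'
      have h1 : ∀ j, gaussFactor ε Θ (q, p, y) * (gradComp Θ j (q, p, y) *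
          (star (gradComp Θ j (q, p, y)) * iterL ε Θ φ n (q, p, y) /
            (gradSq Θ (q, p, y) : ℂ))) = gradComp Θ j (q, p, y) * star (gradComp Θ j (q, p, y)) *
          (gaussFactor ε Θ (q, p, y) * iterL ε Θ φ n (q, p, y) / (gradSq Θ (q, p, y) : ℂ)) :=
        fun j => by ring
      simp only [h1]
      rw [← Finset.sum_mul]
      have h2 := ofReal_gradSq Θ (q, p, y)
      generalize ∑ j, gradComp Θ j (q, p, y) * star (gradComp Θ j (q, p, y)) = s at h2 ⊢
      have h3 : s = (gradSq Θ (q, p, y) : ℂ) - 1 := by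
        rw [h2]
        ring
      rw [h3]
      field_simp
      ring
    simp only [e1, e2]
    rw [integral_add i0 (integrable_finsetSum _ fun j _ => (i2 j).const_mul _),
      integral_add i0 (integrable_finsetSum _ fun j _ => i1 j), integral_finsetSum _ fun j _ =>
        (i2 j).const_mul _, integral_finsetSum _ fun j _ => i1 j]
    congr 1
    refine Finset.sum_congr rfl fun j _ => ?_
    rw [integral_const_mul, hparts, ← mul_assoc]
    have : Complex.I * (ε : ℂ) * -(Complex.I / (ε : ℂ)) = 1 := by
      field_simp
      rw [Complex.I_sq]
      ring
    rw [this, one_mul]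

theorem integrable_gaussFactor_schwartz (hΘ : IsWidth Θ) {ε : ℝ} (hε : 0 < ε) (φ : 𝓢(Conf d, ℂ))
    (z : Phase d) : Integrable fun y => gaussFactor ε Θ (z.1, z.2, y) * φ y :=
  integrable_gaussFactor_mul hΘ hε (iterL_symbFam Θ ε φ 0 (d + 1)) z.1 z.2

theorem continuous_gaussTransform (hΘ : IsWidth Θ) {ε : ℝ} (hε : 0 < ε) (φ : 𝓢(Conf d, ℂ)) :
    Continuous (gaussTransform ε Θ φ) := by
  refine continuous_of_dominated (bound := fun y => ‖φ y‖)
    (fun z => (integrable_gaussFactor_schwartz hΘ hε φ z).1)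
    (fun z => Eventually.of_forall fun y => ?_) φ.integrable.norm
    (Eventually.of_forall fun y => ?_)
  · rw [norm_mul]
    exact mul_le_of_le_one_left (norm_nonneg _) (norm_gaussFactor_le_one hΘ hε _)
  · have h1 := (contDiff_gaussFactor ε Θ).continuous
    fun_prop

theorem exists_norm_gaussFactor_mul_iterL_le (hΘ : IsWidth Θ) {ε : ℝ} (hε : 0 < ε)
    (φ : 𝓢(Conf d, ℂ)) (n A B : ℕ) : ∃ C : ℝ, 0 ≤ C ∧ ∀ w,
      ‖gaussFactor ε Θ w * iterL ε Θ φ n w‖ ≤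
        C * (((1 + ‖w.1‖) ^ A)⁻¹ * (((1 + ‖w.2.1‖) ^ n)⁻¹ * ((1 + ‖w.2.2‖) ^ B)⁻¹)) := by
  obtain ⟨C₁, hC₁, h₁⟩ := (iterL_symbFam Θ ε φ n (A + B)).norm_le
  obtain ⟨C₂, hC₂, h₂⟩ := exists_gaussFactor_decay hΘ hε n A B
  refine ⟨C₁ * C₂, by positivity, fun w => ?_⟩
  rw [norm_mul]
  calc _ ≤ ‖gaussFactor ε Θ w‖ * (C₁ * ((Real.sqrt (gradSq Θ w) ^ n)⁻¹ *
        ((1 + ‖w.2.2‖) ^ (A + B))⁻¹)) := by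
        gcongr
        exact h₁ () w
    _ = C₁ * (‖gaussFactor ε Θ w‖ * ((Real.sqrt (gradSq Θ w) ^ n)⁻¹ *
        ((1 + ‖w.2.2‖) ^ (A + B))⁻¹)) := by ring
    _ ≤ C₁ * (C₂ * (((1 + ‖w.1‖) ^ A)⁻¹ * (((1 + ‖w.2.1‖) ^ n)⁻¹ *
        ((1 + ‖w.2.2‖) ^ B)⁻¹))) := mul_le_mul_of_nonneg_left (h₂ w) hC₁
    _ = _ := by ring

/-- Inserting N powers of L_y^† leaves the integral unchanged and gives decay of order N in p; decay
in q comes from the Gaussian together with the decay of φ in y. -/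
theorem rapidDecay_gaussTransform (hΘ : IsWidth Θ) {ε : ℝ} (hε : 0 < ε) (φ : 𝓢(Conf d, ℂ)) :
    RapidDecay (gaussTransform ε Θ φ) := by
  refine ⟨continuous_gaussTransform hΘ hε φ, fun N => ?_⟩
  obtain ⟨C, hC, hb⟩ := exists_norm_gaussFactor_mul_iterL_le hΘ hε φ N N (d + 1)
  refine ⟨C * ∫ y : Conf d, ((1 + ‖y‖) ^ (d + 1))⁻¹, fun z => ?_⟩
  rw [← integral_gaussFactor_iterL hΘ hε φ z N]
  have h1 := norm_integral_le_of_norm_le ((((integrable_inv_one_add_norm_pow d).const_mul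
    (((1 + ‖z.2‖) ^ N)⁻¹)).const_mul (((1 + ‖z.1‖) ^ N)⁻¹)).const_mul C)
    (Eventually.of_forall fun y => hb (z.1, z.2, y))
  rw [integral_const_mul, integral_const_mul, integral_const_mul] at h1
  have hI : 0 ≤ ∫ y : Conf d, ((1 + ‖y‖) ^ (d + 1))⁻¹ := integral_nonneg fun y => by positivity
  set J := ∫ y : Conf d, ((1 + ‖y‖) ^ (d + 1))⁻¹
  have hz : 1 + ‖z‖ ≤ (1 + ‖z.1‖) * (1 + ‖z.2‖) := by
    have h2 : ‖z‖ ≤ ‖z.1‖ + ‖z.2‖ := max_le (by linarith [norm_nonneg z.2])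
      (by linarith [norm_nonneg z.1])
    nlinarith [mul_nonneg (norm_nonneg z.1) (norm_nonneg z.2)]
  have hp : (0 : ℝ) < (1 + ‖z.1‖) ^ N := by positivity
  have hp' : (0 : ℝ) < (1 + ‖z.2‖) ^ N := by positivity
  calc _ ≤ ((1 + ‖z.1‖) * (1 + ‖z.2‖)) ^ N *
        (C * (((1 + ‖z.1‖) ^ N)⁻¹ * (((1 + ‖z.2‖) ^ N)⁻¹ * J))) := by gcongr
    _ = _ := by
      rw [mul_pow]
      field_simp

end GaussTransform

/-! ### Absolute convergence and reduction to an integral over phase space -/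

section OperatorFormula

variable {d : ℕ} {Θy : Matrix (Fin d) (Fin d) ℂ}

theorem fioIntegrand_lift (hΘy : IsWidth Θy) (n : ℕ) (ε : ℝ) (κ : Phase d → Phase d)
    (S : Phase d → ℝ) (a : Phase d → ℂ) (Θx : Matrix (Fin d) (Fin d) ℂ) (φ : 𝓢(Conf d, ℂ))
    (x : Conf d) (w : Conf d × Conf d × Conf d) :
    fioIntegrand n ε κ S (lift a) Θx Θy φ x w = a (w.1, w.2.1) * kernel ε κ S Θx x (w.1, w.2.1) *
      (gaussFactor ε Θy w * iterL ε Θy φ n w) := by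
  have h := congrFun (iterate_transposeL hΘy ε κ S Θx φ x w.1 w.2.1 (a (w.1, w.2.1)) n) w.2.2
  unfold fioIntegrand lift
  rw [h, cexp_phase]
  ring

/-- A symbol of order `μ` in `p` and of some order in `q`. -/
def HasOrder (μ : ℝ) (a : Phase d → ℂ) : Prop :=
  ∃ (C : ℝ) (M : ℕ), 0 ≤ C ∧ ∀ z, ‖a z‖ ≤ C * ((1 + ‖z.1‖) ^ M * (1 + ‖z.2‖ ^ 2) ^ (μ / 2))

/-- Growth ⟨p⟩^μ against decay of order n in p leaves ⟨p⟩^{-(n-μ)}, integrable because n-μ > d.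
Growth in q is harmless, since the decay in q can be taken of order M+d+1. -/
theorem integrable_fioIntegrand (hΘy : IsWidth Θy) {ε : ℝ} (hε : 0 < ε) {κ : Phase d → Phase d}
    {S : Phase d → ℝ} {Θx : Matrix (Fin d) (Fin d) ℂ} {x : Conf d}
    (hk : Continuous (kernel ε κ S Θx x)) (hk1 : ∀ z, ‖kernel ε κ S Θx x z‖ ≤ 1)
    {a : Phase d → ℂ} (ha : Continuous a) {μ : ℝ} (hord : HasOrder μ a) {n : ℕ} (hn : μ + d < n)
    (φ : 𝓢(Conf d, ℂ)) : Integrable (fioIntegrand n ε κ S (lift a) Θx Θy φ x) := by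
  obtain ⟨C₁, M, hC₁, h₁⟩ := hord
  obtain ⟨C₂, hC₂, h₂⟩ := exists_norm_gaussFactor_mul_iterL_le hΘy hε φ n (M + (d + 1)) (d + 1)
  have hp : Integrable fun p : Conf d => (1 + ‖p‖ ^ 2) ^ (-((n : ℝ) - μ) / 2) :=
    integrable_rpow_neg_one_add_norm_sq (by rw [finrank_euclideanSpace_fin]; linarith)
  have hint := ((integrable_inv_one_add_norm_pow d).mul_prod
    (hp.mul_prod (integrable_inv_one_add_norm_pow d))).const_mul (C₁ * C₂)
  refine hint.mono' ?_ (Eventually.of_forall fun w => ?_)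
  · refine Continuous.aestronglyMeasurable ?_
    simp only [funext fun w => fioIntegrand_lift hΘy n ε κ S a Θx φ x w]
    have h1 := (contDiff_gaussFactor ε Θy).continuous
    have h2 := ((iterL_symbFam Θy ε φ n 0).smooth ()).continuous
    fun_prop
  · rw [fioIntegrand_lift hΘy, norm_mul, norm_mul]
    have h3 : (1 + ‖w.2.1‖ ^ 2) ^ (μ / 2) * ((1 + ‖w.2.1‖) ^ n)⁻¹ ≤
        (1 + ‖w.2.1‖ ^ 2) ^ (-((n : ℝ) - μ) / 2) := by
      have h4 : (0 : ℝ) < 1 + ‖w.2.1‖ ^ 2 := by positivity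
      have h5 : (1 + ‖w.2.1‖ ^ 2) ^ ((n : ℝ) / 2) ≤ (1 + ‖w.2.1‖) ^ n := by
        have h6 : 1 + ‖w.2.1‖ ^ 2 ≤ (1 + ‖w.2.1‖) ^ 2 := by nlinarith [norm_nonneg w.2.1]
        calc _ ≤ ((1 + ‖w.2.1‖) ^ 2) ^ ((n : ℝ) / 2) := by gcongr
          _ = (1 + ‖w.2.1‖) ^ n := by
            rw [← Real.rpow_natCast _ 2, ← Real.rpow_mul (by positivity)]
            rw [show ((2 : ℕ) : ℝ) * ((n : ℝ) / 2) = n by push_cast; ring, Real.rpow_natCast]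
      rw [show -((n : ℝ) - μ) / 2 = μ / 2 - n / 2 by ring, Real.rpow_sub h4, div_eq_mul_inv]
      exact mul_le_mul_of_nonneg_left (inv_anti₀ (by positivity) h5) (by positivity)
    have h7 : (0 : ℝ) < (1 + ‖w.1‖) ^ M := by positivity
    calc _ ≤ C₁ * ((1 + ‖w.1‖) ^ M * (1 + ‖w.2.1‖ ^ 2) ^ (μ / 2)) * 1 *
          (C₂ * (((1 + ‖w.1‖) ^ (M + (d + 1)))⁻¹ *
            (((1 + ‖w.2.1‖) ^ n)⁻¹ * ((1 + ‖w.2.2‖) ^ (d + 1))⁻¹))) := by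
          gcongr
          · exact h₁ (w.1, w.2.1)
          · exact hk1 _
          · exact h₂ w
      _ = C₁ * C₂ * (((1 + ‖w.1‖) ^ (d + 1))⁻¹ * ((1 + ‖w.2.1‖ ^ 2) ^ (μ / 2) *
          ((1 + ‖w.2.1‖) ^ n)⁻¹ * ((1 + ‖w.2.2‖) ^ (d + 1))⁻¹)) := by
          rw [pow_add]
          field_simp
      _ ≤ _ := by gcongr

/-- Fubini, followed by the integration by parts in y read backwards. The right-hand side no longer
contains `n`, so the operator does not depend on it. -/
theorem fio_lift_eq (hΘy : IsWidth Θy) {ε : ℝ} (hε : 0 < ε) {κ : Phase d → Phase d}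
    {S : Phase d → ℝ} {Θx : Matrix (Fin d) (Fin d) ℂ} {x : Conf d} {a : Phase d → ℂ} {n : ℕ}
    {φ : 𝓢(Conf d, ℂ)} (hint : Integrable (fioIntegrand n ε κ S (lift a) Θx Θy φ x)) :
    fio n ε κ S (lift a) Θx Θy φ x = (((2 * Real.pi * ε) ^ (3 * (d : ℝ) / 2) : ℝ) : ℂ)⁻¹ *
      ∫ z, a z * gaussTransform ε Θy φ z * kernel ε κ S Θx x z := by
  rw [fio]
  congr 1
  have hmp := volume_preserving_prodAssoc (α₁ := Conf d) (β₁ := Conf d) (γ₁ := Conf d)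
  rw [← hmp.integral_comp MeasurableEquiv.prodAssoc.measurableEmbedding]
  have hint' := (hmp.integrable_comp_emb MeasurableEquiv.prodAssoc.measurableEmbedding).2 hint
  rw [Measure.volume_eq_prod (Conf d × Conf d) (Conf d)] at hint' ⊢
  rw [integral_prod (fun v => fioIntegrand n ε κ S (lift a) Θx Θy φ x
    (MeasurableEquiv.prodAssoc v)) hint']
  refine integral_congr_ae (Eventually.of_forall fun z => ?_)
  have h : ∀ y, fioIntegrand n ε κ S (lift a) Θx Θy φ x (MeasurableEquiv.prodAssoc (z, y)) =
      a z * kernel ε κ S Θx x z *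
        (gaussFactor ε Θy (z.1, z.2, y) * iterL ε Θy φ n (z.1, z.2, y)) := fun y =>
    fioIntegrand_lift hΘy n ε κ S a Θx φ x _
  simp only [h]
  rw [integral_const_mul, integral_gaussFactor_iterL hΘy hε]
  ring

end OperatorFormula

/-! ### Derivatives of the y-integral in phase space -/

section GaussTransformDerivative

variable {d : ℕ} {Θ : Matrix (Fin d) (Fin d) ℂ}

theorem RapidDecay.mul_of_le {W a : Phase d → ℂ} (hW : RapidDecay W) (ha : Continuous a) {C : ℝ}
    (hC : 0 ≤ C) {m : ℕ} (hb : ∀ z, ‖a z‖ ≤ C * (1 + ‖z‖) ^ m) : RapidDecay fun z => a z * W z := by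
  refine ⟨ha.mul hW.continuous, fun N => ?_⟩
  obtain ⟨C', hC'⟩ := hW.bound (m + N)
  refine ⟨C * C', fun z => ?_⟩
  rw [norm_mul]
  calc _ ≤ (1 + ‖z‖) ^ N * (C * (1 + ‖z‖) ^ m * ‖W z‖) := by
        gcongr
        exact hb z
    _ = C * ((1 + ‖z‖) ^ (m + N) * ‖W z‖) := by
        rw [pow_add]
        ring
    _ ≤ C * C' := by
        gcongr
        exact hC' z

theorem RapidDecay.add {W V : Phase d → ℂ} (hW : RapidDecay W) (hV : RapidDecay V) :
    RapidDecay fun z => W z + V z := by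
  refine ⟨hW.continuous.add hV.continuous, fun N => ?_⟩
  obtain ⟨C, hC⟩ := hW.bound N
  obtain ⟨C', hC'⟩ := hV.bound N
  refine ⟨C + C', fun z => ?_⟩
  calc _ ≤ (1 + ‖z‖) ^ N * (‖W z‖ + ‖V z‖) := by
        gcongr
        exact norm_add_le _ _
    _ ≤ C + C' := by
        rw [mul_add]
        exact add_le_add (hC z) (hC' z)

theorem RapidDecay.const_mul {W : Phase d → ℂ} (hW : RapidDecay W) (c : ℂ) :
    RapidDecay fun z => c * W z :=
  hW.mul_of_le continuous_const (norm_nonneg c) (m := 0) fun z => by simp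

theorem RapidDecay.sum {s : Finset (Fin d)} {W : Fin d → Phase d → ℂ}
    (hW : ∀ j ∈ s, RapidDecay (W j)) : RapidDecay fun z => ∑ j ∈ s, W j z := by
  induction s using Finset.induction_on with
  | empty => exact ⟨by simpa using continuous_const, fun N => ⟨0, fun z => by simp⟩⟩
  | insert j s hj ih =>
    simp only [Finset.sum_insert hj]
    exact (hW j (Finset.mem_insert_self _ _)).add
      (ih fun k hk => hW k (Finset.mem_insert_of_mem hk))

theorem pairC_eq_bilinC (a b : Conf d) : pairC a b = bilinC 1 a b := by
  rw [pairC_apply, bilinC_apply, Matrix.one_mulVec]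

/-- The functional `(q, p) ↦ p_j + i (Θ q)_j`. -/
noncomputable def shearComp (Θ : Matrix (Fin d) (Fin d) ℂ) (j : Fin d) : Phase d →L[ℝ] ℂ :=
  coordC j ∘L ContinuousLinearMap.snd ℝ _ _ +
    ∑ k, (Complex.I * Θ j k) • (coordC k ∘L ContinuousLinearMap.fst ℝ _ _)

theorem shearComp_apply (Θ : Matrix (Fin d) (Fin d) ℂ) (j : Fin d) (v : Phase d) :
    shearComp Θ j v = toC v.2 j + Complex.I * Θ.mulVec (toC v.1) j := by
  simp only [shearComp, add_apply, sum_apply, smul_apply, Matrix.mulVec, dotProduct,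
    Finset.mul_sum]
  congr 1
  refine Finset.sum_congr rfl fun k _ => ?_
  rw [smul_eq_mul, mul_assoc]
  rfl

/-- The differential is arranged as p·dq minus multiples of dp_j + i(Θ dq)_j, since the latter forms
vanish under ∂_z. -/
theorem hasFDerivAt_widthPhase_left (hΘ : IsWidth Θ) (y : Conf d) (z : Phase d) :
    HasFDerivAt (fun z : Phase d => widthPhase Θ (z.1, z.2, y))
      (pairC z.2 ∘L ContinuousLinearMap.fst ℝ _ _ - ∑ j, toC (y - z.1) j • shearComp Θ j) z := by
  have h1 : HasFDerivAt (fun z : Phase d => y - z.1) (-ContinuousLinearMap.fst ℝ _ _) z :=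
    (ContinuousLinearMap.fst ℝ (Conf d) (Conf d)).hasFDerivAt.const_sub y
  have h0 : HasFDerivAt (fun z : Phase d => z.2) (ContinuousLinearMap.snd ℝ _ _) z :=
    (ContinuousLinearMap.snd ℝ (Conf d) (Conf d)).hasFDerivAt
  have h2 := (bilinC 1).hasFDerivAt_of_bilinear h0 h1
  have h3 := (bilinC Θ).hasFDerivAt_of_bilinear h1 h1
  have h4 := h2.neg.add (h3.const_mul (Complex.I / 2))
  have h5 : HasFDerivAt (fun z : Phase d => widthPhase Θ (z.1, z.2, y)) _ z :=
    h4.congr_of_eventuallyEq (Eventually.of_forall fun z => by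
      simp only [widthPhase, pairC_eq_bilinC]
      rfl)
  refine h5.congr_fderiv (ContinuousLinearMap.ext fun v => ?_)
  have h6 : ∑ j, toC (y - z.1) j * shearComp Θ j v =
      pairC v.2 (y - z.1) + Complex.I * bilinC Θ (y - z.1) v.1 := by
    simp only [shearComp_apply, pairC_apply, bilinC_apply, dotProduct, Finset.mul_sum, mul_add,
      Finset.sum_add_distrib]
    congr 1
    · exact Finset.sum_congr rfl fun j _ => by ring
    · exact Finset.sum_congr rfl fun j _ => by ring
  have h7 := hΘ.bilinC_comm v.1 (y - z.1)
  simp only [sub_apply, sum_apply, smul_apply, smul_eq_mul]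
  rw [h6]
  simp [-map_sub, h7, pairC_eq_bilinC]
  ring

/-- Multiplication of a Schwartz function by a coordinate. -/
noncomputable def mulCoord (j : Fin d) (φ : 𝓢(Conf d, ℂ)) : 𝓢(Conf d, ℂ) :=
  SchwartzMap.bilinLeftCLM (ContinuousLinearMap.mul ℝ ℂ)
    (coordC j).hasTemperateGrowth φ

theorem mulCoord_apply (j : Fin d) (φ : 𝓢(Conf d, ℂ)) (y : Conf d) :
    mulCoord j φ y = φ y * toC y j := rfl

/-- The transform of `φ` multiplied by `y_j - q_j`. -/
noncomputable def momentTransform (ε : ℝ) (Θ : Matrix (Fin d) (Fin d) ℂ) (φ : 𝓢(Conf d, ℂ))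
    (j : Fin d) (z : Phase d) : ℂ :=
  gaussTransform ε Θ (mulCoord j φ) z - toC z.1 j * gaussTransform ε Θ φ z

theorem norm_toC_le (a : Conf d) (j : Fin d) : ‖toC a j‖ ≤ ‖a‖ := by
  rw [toC, Complex.norm_real]
  exact PiLp.norm_apply_le a j

theorem rapidDecay_momentTransform (hΘ : IsWidth Θ) {ε : ℝ} (hε : 0 < ε) (φ : 𝓢(Conf d, ℂ))
    (j : Fin d) : RapidDecay (momentTransform ε Θ φ j) := by
  have h1 := rapidDecay_gaussTransform hΘ hε (mulCoord j φ)
  have h2 := (rapidDecay_gaussTransform hΘ hε φ).mul_of_le (a := fun z => toC z.1 j)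
    (C := 1) (m := 1) ((coordC j).continuous.comp continuous_fst) zero_le_one fun z => by
      rw [one_mul, pow_one]
      linarith [(norm_toC_le z.1 j).trans (norm_fst_le z)]
  refine Eq.subst (motive := RapidDecay) (funext fun z => ?_) (h1.add (h2.const_mul (-1)))
  rw [momentTransform]
  ring

/-- The derivative of `gaussTransform`. -/
noncomputable def gaussTransformFDeriv (ε : ℝ) (Θ : Matrix (Fin d) (Fin d) ℂ) (φ : 𝓢(Conf d, ℂ))
    (z : Phase d) : Phase d →L[ℝ] ℂ :=
  (Complex.I / (ε : ℂ)) • (gaussTransform ε Θ φ z • (pairC z.2 ∘L ContinuousLinearMap.fst ℝ _ _) -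
    ∑ j, momentTransform ε Θ φ j z • shearComp Θ j)

theorem hasFDerivAt_gaussTransform (hΘ : IsWidth Θ) {ε : ℝ} (hε : 0 < ε) (φ : 𝓢(Conf d, ℂ))
    (z₀ : Phase d) :
    HasFDerivAt (gaussTransform ε Θ φ) (gaussTransformFDeriv ε Θ φ z₀) z₀ := by
  -- The factor y_j - q_j is split so that y_j is absorbed in φ: y_j φ is again a Schwartz function,
  -- and every piece is an integral of the same kind.
  set F' : Phase d → Conf d → Phase d →L[ℝ] ℂ := fun z y =>
    (Complex.I / (ε : ℂ)) • ((gaussFactor ε Θ (z.1, z.2, y) * φ y) •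
      (pairC z.2 ∘L ContinuousLinearMap.fst ℝ _ _) -
      ∑ j, (gaussFactor ε Θ (z.1, z.2, y) * mulCoord j φ y -
        toC z.1 j * (gaussFactor ε Θ (z.1, z.2, y) * φ y)) • shearComp Θ j) with hF'
  have hi := integrable_gaussFactor_schwartz hΘ hε φ
  have hij := fun j => integrable_gaussFactor_schwartz hΘ hε (mulCoord j φ)
  have hint1 : Integrable fun y => (gaussFactor ε Θ (z₀.1, z₀.2, y) * φ y) •
      (pairC z₀.2 ∘L ContinuousLinearMap.fst ℝ (Conf d) (Conf d)) := (hi z₀).smul_const _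
  have hint2 : ∀ j, Integrable fun y => (gaussFactor ε Θ (z₀.1, z₀.2, y) * mulCoord j φ y -
      toC z₀.1 j * (gaussFactor ε Θ (z₀.1, z₀.2, y) * φ y)) • shearComp Θ j := fun j =>
    ((hij j z₀).sub ((hi z₀).const_mul _)).smul_const _
  have hint : Integrable (F' z₀) :=
    (hint1.sub (integrable_finsetSum _ fun j _ => hint2 j)).smul (Complex.I / (ε : ℂ))
  have hval : ∫ y, F' z₀ y = gaussTransformFDeriv ε Θ φ z₀ := by
    rw [hF', integral_smul, integral_sub hint1 (integrable_finsetSum _ fun j _ => hint2 j),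
      integral_smul_const, integral_finsetSum _ fun j _ => hint2 j, gaussTransformFDeriv]
    congr 2
    refine Finset.sum_congr rfl fun j _ => ?_
    rw [integral_smul_const, integral_sub (hij j z₀) ((hi z₀).const_mul _), integral_const_mul]
    rfl
  -- `R` bounds ‖z‖ on the unit ball around z₀; the majorant then depends on y only, with one power
  -- of 1+‖y‖ for the factor y_j - q_j.
  set R := ‖z₀‖ + 1
  set K := ∑ j, ‖shearComp Θ j‖
  have hK : 0 ≤ K := Finset.sum_nonneg fun j _ => norm_nonneg _
  have hR : 1 ≤ R := by linarith [norm_nonneg z₀]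
  have hbound : Integrable fun y : Conf d =>
      1 / ε * (R + K * (1 + R)) * ((1 + ‖y‖) ^ 1 * ‖φ y‖) := by
    refine (RapidDecay.integrable_pow_mul (W := φ) ⟨φ.continuous, fun N => ?_⟩ 1).const_mul _
    obtain ⟨C, -, hC⟩ := (schwartz_symbFam φ N).norm_le
    refine ⟨C, fun y => ?_⟩
    have := hC () y
    rwa [← div_eq_mul_inv, le_div_iff₀ (by positivity), mul_comm] at this
  have hder : ∀ y z, HasFDerivAt (fun z : Phase d => gaussFactor ε Θ (z.1, z.2, y) * φ y)
      (F' z y) z := by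
    intro y z
    have h :=
      (((hasFDerivAt_widthPhase_left hΘ y z).const_mul (Complex.I / (ε : ℂ))).cexp).mul_const
      (φ y)
    refine h.congr_fderiv (ContinuousLinearMap.ext fun v => ?_)
    simp only [hF', mulCoord_apply, smul_apply, sub_apply, sum_apply, smul_eq_mul,
      gaussFactor, mul_sub, Finset.mul_sum, sub_mul]
    simp only [ContinuousLinearMap.comp_apply, ContinuousLinearMap.coe_fst', toC, PiLp.sub_apply,
      Complex.ofReal_sub]
    congr 1
    · ring
    · exact Finset.sum_congr rfl fun j _ => by ring
  have h := hasFDerivAt_integral_of_dominated_of_fderiv_le (𝕜 := ℝ) (μ := volume)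
    (F := fun (z : Phase d) y => gaussFactor ε Θ (z.1, z.2, y) * φ y) (F' := F')
    (x₀ := z₀) (s := Metric.ball z₀ 1)
    (bound := fun y : Conf d => 1 / ε * (R + K * (1 + R)) * ((1 + ‖y‖) ^ 1 * ‖φ y‖))
    (Metric.ball_mem_nhds z₀ one_pos)
    (Eventually.of_forall fun z => (hi z).1) (hi z₀) hint.1
    (Eventually.of_forall fun y z hz => ?_) hbound (Eventually.of_forall fun y z _ => hder y z)
  · rwa [hval] at h
  · have hz' : ‖z‖ ≤ R := by
      have h1 : ‖z - z₀‖ < 1 := by rwa [← dist_eq_norm]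
      have h2 := norm_add_le (z - z₀) z₀
      rw [sub_add_cancel] at h2
      linarith
    have hg := norm_gaussFactor_le_one hΘ hε (z.1, z.2, y)
    have hgφ : ‖gaussFactor ε Θ (z.1, z.2, y) * φ y‖ ≤ ‖φ y‖ := by
      rw [norm_mul]
      exact mul_le_of_le_one_left (norm_nonneg _) hg
    have hP : ‖pairC z.2 ∘L ContinuousLinearMap.fst ℝ (Conf d) (Conf d)‖ ≤ R := by
      refine (ContinuousLinearMap.opNorm_comp_le _ _).trans ?_
      calc _ ≤ R * 1 := by
            gcongr
            · exact (norm_pairC_le _).trans ((norm_snd_le z).trans hz')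
            · exact ContinuousLinearMap.norm_fst_le _ _ _
        _ = R := mul_one _
    have hy := norm_nonneg y
    have hφ := norm_nonneg (φ y)
    rw [hF']
    simp only [norm_smul]
    have hI : ‖Complex.I / (ε : ℂ)‖ = 1 / ε := by simp [abs_of_pos hε]
    rw [hI, mul_assoc]
    gcongr
    refine (norm_sub_le _ _).trans ?_
    have e1 : ‖(gaussFactor ε Θ (z.1, z.2, y) * φ y) •
        (pairC z.2 ∘L ContinuousLinearMap.fst ℝ (Conf d) (Conf d))‖ ≤ ‖φ y‖ * R := by
      rw [norm_smul]
      gcongr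
    have e2 : ‖∑ j, (gaussFactor ε Θ (z.1, z.2, y) * mulCoord j φ y -
        toC z.1 j * (gaussFactor ε Θ (z.1, z.2, y) * φ y)) • shearComp Θ j‖ ≤
        ((‖y‖ + R) * ‖φ y‖) * K := by
      refine (norm_sum_le _ _).trans ?_
      rw [Finset.mul_sum]
      refine Finset.sum_le_sum fun j _ => ?_
      rw [norm_smul]
      gcongr
      have e3 : gaussFactor ε Θ (z.1, z.2, y) * mulCoord j φ y -
        toC z.1 j * (gaussFactor ε Θ (z.1, z.2, y) * φ y) =
          (toC y j - toC z.1 j) * (gaussFactor ε Θ (z.1, z.2, y) * φ y) := by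
        rw [mulCoord_apply]
        ring
      rw [e3, norm_mul]
      gcongr
      refine (norm_sub_le _ _).trans (add_le_add (norm_toC_le _ _) ?_)
      exact (norm_toC_le _ _).trans ((norm_fst_le z).trans hz')
    refine (add_le_add e1 e2).trans ?_
    have e4 : (0 : ℝ) ≤ ‖φ y‖ * (‖y‖ * R + K * (‖y‖ * R)) := by positivity
    nlinarith

theorem rapidDecay_gaussTransformFDeriv (hΘ : IsWidth Θ) {ε : ℝ} (hε : 0 < ε) (φ : 𝓢(Conf d, ℂ))
    (v : Phase d) : RapidDecay fun z => gaussTransformFDeriv ε Θ φ z v := by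
  have h1 := (rapidDecay_gaussTransform hΘ hε φ).mul_of_le (a := fun z => pairC z.2 v.1)
    (C := ‖v.1‖) (m := 1)
    (by
      simp only [pairC_eq_inner]
      exact Complex.continuous_ofReal.comp (continuous_snd.inner continuous_const))
    (norm_nonneg _) fun z => by
      rw [pairC_eq_inner, Complex.norm_real, pow_one, mul_comm]
      refine (norm_inner_le_norm _ _).trans ?_
      gcongr
      linarith [norm_snd_le z]
  have h2 : RapidDecay fun z => ∑ j, shearComp Θ j v * momentTransform ε Θ φ j z :=
    RapidDecay.sum fun j _ => (rapidDecay_momentTransform hΘ hε φ j).const_mul _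
  refine Eq.subst (motive := RapidDecay) (funext fun z => ?_)
    ((h1.add (h2.const_mul (-1))).const_mul (Complex.I / ε))
  simp only [gaussTransformFDeriv, smul_apply, sub_apply, sum_apply, smul_eq_mul,
    ContinuousLinearMap.comp_apply, ContinuousLinearMap.coe_fst']
  rw [neg_one_mul, ← sub_eq_add_neg, mul_comm (pairC _ _)]
  congr 2
  exact Finset.sum_congr rfl fun j _ => mul_comm _ _

theorem dzCLM_apply (Θy : Matrix (Fin d) (Fin d) ℂ) (k : Fin d) (L : Phase d →L[ℝ] ℂ) :
    dzCLM Θy k L = ∑ j, Θy⁻¹ k j * L (basisVec j, 0) - Complex.I * L (0, basisVec k) := by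
  simp [dzCLM, sum_apply]

theorem dzCLM_smul (Θy : Matrix (Fin d) (Fin d) ℂ) (k : Fin d) (c : ℂ) (L : Phase d →L[ℝ] ℂ) :
    dzCLM Θy k (c • L) = c * dzCLM Θy k L := by
  simp only [dzCLM_apply, smul_apply, smul_eq_mul, mul_sub, Finset.mul_sum]
  congr 1
  · exact Finset.sum_congr rfl fun j _ => by ring
  · ring

theorem toC_basisVec (j k : Fin d) : toC (basisVec j) k = if k = j then 1 else 0 := by
  simp only [toC, basisVec, PiLp.single_apply]
  split_ifs <;> simp

theorem toC_zero : toC (0 : Conf d) = 0 := by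
  funext j
  simp [toC]

/-- This is what the form of ∂_z is made for: Θ⁻¹∂_q turns iΘq into i times the identity, which
-i∂_p cancels. -/
theorem dzCLM_shearComp (hΘ : IsWidth Θ) (j k : Fin d) : dzCLM Θ k (shearComp Θ j) = 0 := by
  rw [dzCLM_apply]
  simp only [shearComp_apply, toC_zero, Matrix.mulVec_zero]
  simp only [Matrix.mulVec, dotProduct, toC_basisVec]
  simp only [Pi.zero_apply, zero_add, mul_ite, mul_one, mul_zero, Finset.sum_ite_eq',
    Finset.mem_univ, if_true, add_zero]
  have h : ∑ i, Θ⁻¹ k i * Θ i j = (1 : Matrix (Fin d) (Fin d) ℂ) k j := by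
    rw [← Matrix.nonsing_inv_mul Θ hΘ.isUnit_det, Matrix.mul_apply]
  have h2 : ∑ i, Θ⁻¹ k i * (Complex.I * Θ j i) = Complex.I * ∑ i, Θ⁻¹ k i * Θ i j := by
    rw [Finset.mul_sum]
    refine Finset.sum_congr rfl fun i _ => ?_
    rw [hΘ.symm.apply]
    ring
  rw [h2, h, Matrix.one_apply]
  by_cases hjk : j = k
  · simp [hjk]
  · simp [hjk, Ne.symm hjk]

/-- The moments drop out, and under ∂_z the transform merely reproduces itself with a factor. -/
theorem dzCLM_gaussTransformFDeriv (hΘ : IsWidth Θ) (ε : ℝ) (φ : 𝓢(Conf d, ℂ)) (k : Fin d)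
    (z : Phase d) : dzCLM Θ k (gaussTransformFDeriv ε Θ φ z) =
      Complex.I / (ε : ℂ) * (gaussTransform ε Θ φ z *
        dzCLM Θ k (pairC z.2 ∘L ContinuousLinearMap.fst ℝ _ _)) := by
  rw [gaussTransformFDeriv, dzCLM_smul, map_sub, map_sum, dzCLM_smul]
  simp only [dzCLM_smul, dzCLM_shearComp hΘ, mul_zero, Finset.sum_const_zero, sub_zero]

end GaussTransformDerivative

/-! ### Symbols of polynomial growth at fixed ε -/

section PolynomialSymbols

variable {d : ℕ}

/-- The evolution equation concerns one ε at a time; with ε frozen, only polynomial growth of the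
symbol matters. -/
theorem TimeFam.fix {E F : Type} [NormedAddCommGroup E] [NormedSpace ℝ E] [NormedAddCommGroup F]
    [NormedSpace ℝ F] [FiniteDimensional ℝ E] {ε₀ : ℝ} {w : E → ℝ} {u : ℝ → ℝ → E → F}
    (h : TimeFam ε₀ w u) (ε : Set.Ioc 0 ε₀) (ε₁ : ℝ) : TimeFam ε₁ w (fun _ => u ε) := by
  refine TimeFam.of_indep h.weight_cont h.weight_pos (fun t => h.smooth ε t) (fun k T => ?_)
    fun z => (h.continuous_uncurry ε).comp (Continuous.prodMk_left z)
  obtain ⟨C, -, hC⟩ := (h.symb T).bounded k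
  exact ⟨C, fun t ht z => hC (ε, ⟨t, ht⟩) z⟩

/-- A time-dependent symbol of some polynomial order. -/
def PolySymb (a : ℝ → Phase d → ℂ) : Prop :=
  ∃ m : ℕ, TimeFam 1 (fun z => (1 + ‖z‖) ^ m) (fun _ => a)

theorem TimeFam.polySymb {a : ℝ → Phase d → ℂ} {m : ℕ}
    (h : TimeFam 1 (fun z => (1 + ‖z‖) ^ m) (fun _ => a)) : PolySymb a := ⟨m, h⟩

theorem TimeFam.polySymb_of_one {a : ℝ → Phase d → ℂ}
    (h : TimeFam 1 (fun _ => 1) (fun _ => a)) : PolySymb a :=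
  ⟨0, h.congr_weight fun _ => (pow_zero _).symm⟩

namespace PolySymb

variable {a b : ℝ → Phase d → ℂ}

theorem mul (ha : PolySymb a) (hb : PolySymb b) : PolySymb fun t z => a t z * b t z := by
  obtain ⟨m, ha⟩ := ha
  obtain ⟨n, hb⟩ := hb
  exact ⟨m + n, (ha.mul hb).congr_weight fun z => (pow_add _ _ _).symm⟩

theorem exists_le (ha : PolySymb a) : ∃ m : ℕ, ∀ n, m ≤ n →
    TimeFam 1 (fun z => (1 + ‖z‖) ^ n) (fun _ => a) := by
  obtain ⟨m, ha⟩ := ha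
  refine ⟨m, fun n hn => ha.mono (continuous_one_add_norm_pow n) (one_add_norm_pow_pos n) 1
    zero_le_one fun z => ?_⟩
  rw [one_mul]
  exact pow_le_pow_right₀ (by linarith [norm_nonneg z]) hn

theorem add (ha : PolySymb a) (hb : PolySymb b) : PolySymb fun t z => a t z + b t z := by
  obtain ⟨m, ha⟩ := ha.exists_le
  obtain ⟨n, hb⟩ := hb.exists_le
  exact ⟨max m n, (ha _ (le_max_left _ _)).add (hb _ (le_max_right _ _))⟩

theorem const {c : ℝ → ℂ} (hc : Continuous c) : PolySymb fun t (_ : Phase d) => c t :=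
  (TimeFam.const hc).polySymb_of_one

theorem const_mul (ha : PolySymb a) (c : ℂ) : PolySymb fun t z => c * a t z :=
  (const continuous_const).mul ha

theorem neg (ha : PolySymb a) : PolySymb fun t z => -a t z := by
  simpa using ha.const_mul (-1)

theorem sub (ha : PolySymb a) (hb : PolySymb b) : PolySymb fun t z => a t z - b t z := by
  simpa only [sub_eq_add_neg] using ha.add hb.neg

theorem sum {ι : Type*} {s : Finset ι} {a : ι → ℝ → Phase d → ℂ} (ha : ∀ j ∈ s, PolySymb (a j)) :
    PolySymb fun t z => ∑ j ∈ s, a j t z := by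
  classical
  induction s using Finset.induction_on with
  | empty => simpa using const continuous_const
  | insert j s hj ih =>
    simp only [Finset.sum_insert hj]
    exact (ha j (Finset.mem_insert_self _ _)).add
      (ih fun k hk => ha k (Finset.mem_insert_of_mem hk))

theorem fderiv_apply (ha : PolySymb a) (v : Phase d) : PolySymb fun t z => fderiv ℝ (a t) z v := by
  obtain ⟨m, ha⟩ := ha
  exact ⟨m, ha.fderiv.clm (ContinuousLinearMap.apply ℝ ℂ v)⟩

theorem dz (ha : PolySymb a) (Θy : Matrix (Fin d) (Fin d) ℂ) (k : Fin d) :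
    PolySymb fun t z => dz Θy k (a t) z := by
  obtain ⟨m, ha⟩ := ha
  exact ⟨m, ha.dz Θy k⟩

theorem differentiable (ha : PolySymb a) (t : ℝ) : Differentiable ℝ (a t) := by
  obtain ⟨m, ha⟩ := ha
  exact ha.differentiable ⟨1, one_pos, le_rfl⟩ t

theorem polyFamily (ha : PolySymb a) : PolyFamily a := by
  obtain ⟨m, ha⟩ := ha
  refine ⟨ha.continuous_uncurry ⟨1, one_pos, le_rfl⟩, m, fun T => ?_⟩
  obtain ⟨C, hC, hb⟩ := ha.norm_le T
  exact ⟨C, hC, hb ⟨1, one_pos, le_rfl⟩⟩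

end PolySymb

end PolynomialSymbols

/-! ### Derivatives of the kernel in phase space -/

section KernelDerivative

variable {d : ℕ}

/-- The standing assumptions on the canonical transformations, actions and width matrices. -/
structure EvolutionData (κ : ℝ → Phase d → Phase d) (S : ℝ → Phase d → ℝ)
    (Θx : ℝ → Matrix (Fin d) (Fin d) ℂ) (Θy : Matrix (Fin d) (Fin d) ℂ) : Prop where
  classB : IsClassBFamily κ
  action : ∀ t, IsAction (κ t) (S t)
  action_C1 : ∀ z, ContDiff ℝ 1 (fun t => S t z)
  width : ∀ t, IsWidth (Θx t)
  width_C1 : ∀ i j, ContDiff ℝ 1 (fun t => Θx t i j)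
  width_right : IsWidth Θy

/-- The derivative of `kernelExp` in `z`. -/
noncomputable def kernelExpFDeriv (ε : ℝ) (κ : Phase d → Phase d) (Θ : Matrix (Fin d) (Fin d) ℂ)
    (x : Conf d) (z : Phase d) : Phase d →L[ℝ] ℂ :=
  (Complex.I / (ε : ℂ)) • (-(pairC z.2 ∘L ContinuousLinearMap.fst ℝ (Conf d) (Conf d)) +
    ∑ l, toC (x - (κ z).1) l • (coordC l ∘L ContinuousLinearMap.snd ℝ _ _ ∘L fderiv ℝ κ z) -
    ∑ m, (Complex.I * Θ.mulVec (toC (x - (κ z).1)) m) •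
      (coordC m ∘L ContinuousLinearMap.fst ℝ _ _ ∘L fderiv ℝ κ z))

theorem IsAction.ofReal_fderiv {κ : Phase d → Phase d} {S : Phase d → ℝ} (hS : IsAction κ S)
    (z v : Phase d) : ((fderiv ℝ S z v : ℝ) : ℂ) =
      -pairC z.2 v.1 + pairC (κ z).2 (fderiv ℝ κ z v).1 := by
  rw [hS.fderiv_eq, pairC_apply, pairC_apply]
  simp only [add_apply, neg_apply, sum_apply, smul_apply, ContinuousLinearMap.comp_apply,
    momCoord_apply, posCoord_apply, smul_eq_mul, dotProduct, toC]
  push_cast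
  rfl

/-- The term Ξ·dX of dS cancels the one that arises when x-X is differentiated in Ξ·(x-X). Apart
from -p·dq, everything left is proportional to x-X. -/
theorem hasFDerivAt_kernelExp {κ : Phase d → Phase d} {S : Phase d → ℝ}
    {Θ : Matrix (Fin d) (Fin d) ℂ} (hS : IsAction κ S) (hΘ : IsWidth Θ)
    (hκ : Differentiable ℝ κ) (ε : ℝ) (x : Conf d) (z : Phase d) :
    HasFDerivAt (fun z => kernelExp ε κ S Θ x z) (kernelExpFDeriv ε κ Θ x z) z := by
  have hX : HasFDerivAt (fun z => x - (κ z).1)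
      (-(ContinuousLinearMap.fst ℝ _ _ ∘L fderiv ℝ κ z)) z :=
    ((ContinuousLinearMap.fst ℝ (Conf d) (Conf d)).hasFDerivAt.comp z
      (hκ z).hasFDerivAt).const_sub x
  have hΞ : HasFDerivAt (fun z => (κ z).2) (ContinuousLinearMap.snd ℝ _ _ ∘L fderiv ℝ κ z) z :=
    (ContinuousLinearMap.snd ℝ (Conf d) (Conf d)).hasFDerivAt.comp z (hκ z).hasFDerivAt
  have h1 := Complex.ofRealCLM.hasFDerivAt.comp z (hS.differentiable z).hasFDerivAt
  have h2 := (bilinC 1).hasFDerivAt_of_bilinear hΞ hX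
  have h3 := (bilinC Θ).hasFDerivAt_of_bilinear hX hX
  have h4 := ((h1.add h2).add (h3.const_mul (Complex.I / 2))).const_mul (Complex.I / (ε : ℂ))
  have h5 : HasFDerivAt (fun z => kernelExp ε κ S Θ x z) _ z :=
    h4.congr_of_eventuallyEq (Eventually.of_forall fun z => by
      simp only [kernelExp, pairC_eq_bilinC]
      rfl)
  refine h5.congr_fderiv (ContinuousLinearMap.ext fun v => ?_)
  have e1 := hS.ofReal_fderiv z v
  have e2 : ∑ l, toC (x - (κ z).1) l * toC (fderiv ℝ κ z v).2 l =
      pairC (fderiv ℝ κ z v).2 (x - (κ z).1) := by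
    rw [pairC_apply, dotProduct_comm]
    rfl
  have e3 : ∑ m, Complex.I * Θ.mulVec (toC (x - (κ z).1)) m * toC (fderiv ℝ κ z v).1 m =
      Complex.I * bilinC Θ (fderiv ℝ κ z v).1 (x - (κ z).1) := by
    rw [bilinC_apply, dotProduct, Finset.mul_sum]
    exact Finset.sum_congr rfl fun m _ => by ring
  have e4 := hΘ.bilinC_comm (fderiv ℝ κ z v).1 (x - (κ z).1)
  have e5 : kernelExpFDeriv ε κ Θ x z v = Complex.I / (ε : ℂ) * (-pairC z.2 v.1 +
      pairC (fderiv ℝ κ z v).2 (x - (κ z).1) -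
        Complex.I * bilinC Θ (fderiv ℝ κ z v).1 (x - (κ z).1)) := by
    rw [← e2, ← e3]
    simp only [kernelExpFDeriv, smul_apply, sub_apply, add_apply, neg_apply, sum_apply, smul_eq_mul]
    rfl
  have e6 : (Complex.ofRealCLM ∘L fderiv ℝ S z) v = ((fderiv ℝ S z v : ℝ) : ℂ) := rfl
  rw [e5]
  simp only [smul_apply, add_apply, smul_eq_mul, e6, e1]
  simp [-map_sub, -mul_eq_mul_left_iff, pairC_eq_bilinC, e4]
  ring

theorem zgrad_apply_clm {κ : Phase d → Phase d} {z : Phase d} (hκ : DifferentiableAt ℝ κ z)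
    (Θy : Matrix (Fin d) (Fin d) ℂ) (L : Phase d →L[ℝ] ℂ) (k : Fin d) :
    dz Θy k (fun z' => L (κ z')) z = dzCLM Θy k (L ∘L fderiv ℝ κ z) := by
  rw [dz_eq]
  congr 1
  exact (L.hasFDerivAt.comp z hκ.hasFDerivAt).fderiv

/-- The origin of 𝒵: the terms proportional to x-X combine to (i/ε)(Ξ_z - iX_zΘ)(x-X) = ε⁻¹(X_zΘ +
iΞ_z)(x-X). -/
theorem dzCLM_kernelExpFDeriv {κ : Phase d → Phase d} {z : Phase d}
    (hκ : DifferentiableAt ℝ κ z) (ε : ℝ) (Θ Θy : Matrix (Fin d) (Fin d) ℂ) (x : Conf d)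
    (k : Fin d) : dzCLM Θy k (kernelExpFDeriv ε κ Θ x z) = -(Complex.I / (ε : ℂ) *
      dzCLM Θy k (pairC z.2 ∘L ContinuousLinearMap.fst ℝ _ _)) +
      1 / (ε : ℂ) * (Zmat Θ Θy κ z).mulVec (toC (x - (κ z).1)) k := by
  have h1 : ∀ l, dzCLM Θy k (coordC l ∘L ContinuousLinearMap.snd ℝ _ _ ∘L fderiv ℝ κ z) =
      zgrad Θy (fun z' => toC (κ z').2) z k l := fun l =>
    (zgrad_apply_clm hκ Θy (coordC l ∘L ContinuousLinearMap.snd ℝ _ _) k).symm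
  have h2 : ∀ l, dzCLM Θy k (coordC l ∘L ContinuousLinearMap.fst ℝ _ _ ∘L fderiv ℝ κ z) =
      Xz Θy κ z k l := fun l =>
    (zgrad_apply_clm hκ Θy (coordC l ∘L ContinuousLinearMap.fst ℝ _ _) k).symm
  rw [kernelExpFDeriv, dzCLM_smul, map_sub, map_add, map_neg, map_sum, map_sum]
  simp only [dzCLM_smul, h1, h2]
  set Y := toC (x - (κ z).1)
  have h3 : (Zmat Θ Θy κ z).mulVec Y k = ∑ m, Xz Θy κ z k m * Θ.mulVec Y m +
      Complex.I * ∑ l, zgrad Θy (fun z' => toC (κ z').2) z k l * Y l := by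
    rw [Zmat, Matrix.add_mulVec, Matrix.smul_mulVec, ← Matrix.mulVec_mulVec]
    rfl
  have h4 : ∑ m, Complex.I * Θ.mulVec Y m * Xz Θy κ z k m =
      Complex.I * ∑ m, Xz Θy κ z k m * Θ.mulVec Y m := by
    rw [Finset.mul_sum]
    exact Finset.sum_congr rfl fun m _ => by ring
  have h5 : ∑ l, Y l * zgrad Θy (fun z' => toC (κ z').2) z k l =
      ∑ l, zgrad Θy (fun z' => toC (κ z').2) z k l * Y l :=
    Finset.sum_congr rfl fun l _ => mul_comm _ _
  rw [h3, h4, h5]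
  generalize ∑ m, Xz Θy κ z k m * Θ.mulVec Y m = A
  generalize ∑ l, zgrad Θy (fun z' => toC (κ z').2) z k l * Y l = B
  have hI : Complex.I * Complex.I = -1 := Complex.I_mul_I
  linear_combination (-(A / (ε : ℂ))) * hI

end KernelDerivative

/-! ### Trading powers of x-X for powers of ε -/

section IntegrationByParts

variable {d : ℕ} {κ : ℝ → Phase d → Phase d} {S : ℝ → Phase d → ℝ}
  {Θx : ℝ → Matrix (Fin d) (Fin d) ℂ} {Θy : Matrix (Fin d) (Fin d) ℂ}

namespace EvolutionData

theorem width_continuous (h : EvolutionData κ S Θx Θy) (i j : Fin d) :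
    Continuous fun t => Θx t i j := (h.width_C1 i j).continuous

theorem kernelFamily (h : EvolutionData κ S Θx Θy) : KernelFamily κ S Θx := by
  have h1 := h.classB.timeFam 1
  have h2 := action_timeFam h.classB h.action h.action_C1 1
  refine ⟨h1.continuous_uncurry ⟨1, one_pos, le_rfl⟩, h2.continuous_uncurry ⟨1, one_pos, le_rfl⟩,
    h.width, h.width_continuous, fun T => ?_⟩
  obtain ⟨C, hC, hb⟩ := h1.norm_le T
  exact ⟨C, hC, fun t ht z => by simpa using hb ⟨1, one_pos, le_rfl⟩ t ht z⟩

theorem position_polySymb (h : EvolutionData κ S Θx Θy) (x : Conf d) (j : Fin d) :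
    PolySymb fun t z => toC (x - (κ t z).1) j := by
  have h1 : PolySymb fun t z => toC (κ t z).1 j :=
    (((h.classB.timeFam 1).clm (posCoord j)).ofReal).polySymb
  have h2 := (PolySymb.const (d := d) (c := fun _ => toC x j) continuous_const).sub h1
  simpa [toC] using h2

theorem momentum_polySymb (h : EvolutionData κ S Θx Θy) (j : Fin d) :
    PolySymb fun t z => toC (κ t z).2 j :=
  (((h.classB.timeFam 1).clm (momCoord j)).ofReal).polySymb

theorem kernelExp_polySymb (h : EvolutionData κ S Θx Θy) (ε : ℝ) (x : Conf d) :
    PolySymb fun t z => kernelExp ε (κ t) (S t) (Θx t) x z := by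
  simp only [kernelExp, pairC_apply, bilinC_apply, dotProduct, Matrix.mulVec]
  refine PolySymb.const_mul (((PolySymb.add ?_ ?_)).add (PolySymb.const_mul ?_ _)) _
  · exact (action_timeFam h.classB h.action h.action_C1 1).ofReal.polySymb
  · exact PolySymb.sum fun j _ => (h.momentum_polySymb j).mul (h.position_polySymb x j)
  · exact PolySymb.sum fun j _ => (h.position_polySymb x j).mul (PolySymb.sum fun k _ =>
      (PolySymb.const (h.width_continuous j k)).mul (h.position_polySymb x k))

theorem Zinv_polySymb (h : EvolutionData κ S Θx Θy) (i j : Fin d) :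
    PolySymb fun t z => (Zmat (Θx t) Θy (κ t) z)⁻¹ i j :=
  (Zinv_timeFam h.classB h.width h.width_continuous h.width_right 1 i j).polySymb_of_one

variable {ε : ℝ}

theorem integrable (h : EvolutionData κ S Θx Θy) (hε : 0 < ε) {a : ℝ → Phase d → ℂ}
    (ha : PolySymb a) {W : Phase d → ℂ} (hW : RapidDecay W) (t : ℝ) (x : Conf d) :
    Integrable fun z => a t z * W z * kernel ε (κ t) (S t) (Θx t) x z :=
  h.kernelFamily.integrable hε ha.polyFamily hW t x

/-- Integration by parts in a direction of phase space. -/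
theorem integral_mul_fderiv (h : EvolutionData κ S Θx Θy) (hε : 0 < ε) {b : ℝ → Phase d → ℂ}
    (hb : PolySymb b) (φ : 𝓢(Conf d, ℂ)) (t : ℝ) (x : Conf d) (v : Phase d) :
    Integrable (fun z => b t z * (kernel ε (κ t) (S t) (Θx t) x z *
      (gaussTransform ε Θy φ z * kernelExpFDeriv ε (κ t) (Θx t) x z v +
        gaussTransformFDeriv ε Θy φ z v))) ∧
    ∫ z, b t z * (kernel ε (κ t) (S t) (Θx t) x z *
      (gaussTransform ε Θy φ z * kernelExpFDeriv ε (κ t) (Θx t) x z v +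
        gaussTransformFDeriv ε Θy φ z v)) =
      -∫ z, fderiv ℝ (b t) z v * gaussTransform ε Θy φ z * kernel ε (κ t) (S t) (Θx t) x z := by
  have hW := rapidDecay_gaussTransform h.width_right hε φ
  have hW' := rapidDecay_gaussTransformFDeriv h.width_right hε φ v
  have hE := fun z =>
    hasFDerivAt_kernelExp (h.action t) (h.width t) (h.classB.differentiable t) ε x z
  have hE' : PolySymb fun t z => kernelExpFDeriv ε (κ t) (Θx t) x z v := by
    have h1 := (h.kernelExp_polySymb ε x).fderiv_apply v
    refine Eq.subst (motive := PolySymb) (funext fun t => funext fun z => ?_) h1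
    rw [(hasFDerivAt_kernelExp (h.action t) (h.width t) (h.classB.differentiable t) ε x z).fderiv]
  have hK : ∀ z, HasFDerivAt (fun z => gaussTransform ε Θy φ z * kernel ε (κ t) (S t) (Θx t) x z)
      (gaussTransform ε Θy φ z • kernel ε (κ t) (S t) (Θx t) x z •
        kernelExpFDeriv ε (κ t) (Θx t) x z +
        kernel ε (κ t) (S t) (Θx t) x z • gaussTransformFDeriv ε Θy φ z) z := fun z =>
    (hasFDerivAt_gaussTransform h.width_right hε φ z).mul (hE z).cexp
  have hKv : ∀ z,
      fderiv ℝ (fun z => gaussTransform ε Θy φ z * kernel ε (κ t) (S t) (Θx t) x z) z v =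
      kernel ε (κ t) (S t) (Θx t) x z * (gaussTransform ε Θy φ z *
        kernelExpFDeriv ε (κ t) (Θx t) x z v + gaussTransformFDeriv ε Θy φ z v) := fun z => by
    rw [(hK z).fderiv]
    simp only [add_apply, smul_apply, smul_eq_mul]
    ring
  have i1 : Integrable fun z => fderiv ℝ (b t) z v * (gaussTransform ε Θy φ z *
      kernel ε (κ t) (S t) (Θx t) x z) := by
    simp only [← mul_assoc]
    exact h.integrable hε (hb.fderiv_apply v) hW t x
  have i2 : Integrable fun z => b t z * (gaussTransform ε Θy φ z *
      kernel ε (κ t) (S t) (Θx t) x z) := by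
    simp only [← mul_assoc]
    exact h.integrable hε hb hW t x
  have i3 : Integrable fun z => b t z * (kernel ε (κ t) (S t) (Θx t) x z *
      (gaussTransform ε Θy φ z * kernelExpFDeriv ε (κ t) (Θx t) x z v +
        gaussTransformFDeriv ε Θy φ z v)) := by
    refine ((h.integrable hε (hb.mul hE') hW t x).add (h.integrable hε hb hW' t x)).congr
      (Eventually.of_forall fun z => ?_)
    simp only [Pi.add_apply]
    ring
  refine ⟨i3, ?_⟩
  have key := integral_mul_fderiv_eq_neg_fderiv_mul_of_integrable (𝕜 := ℂ) (μ := volume)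
    (f := b t) (g := fun z => gaussTransform ε Θy φ z * kernel ε (κ t) (S t) (Θx t) x z) (v := v)
    i1 (by simpa only [hKv] using i3) i2 (fun z _ => hb.differentiable t z)
    (fun z _ => (hK z).differentiableAt)
  simp only [hKv] at key
  rw [key]
  simp only [mul_assoc]

/-- Multiplication by `𝒵 (x - X)` is, up to a factor, the operator `∂_z`. -/
theorem integral_mul_Zmat (h : EvolutionData κ S Θx Θy) (hε : 0 < ε) {b : ℝ → Phase d → ℂ}
    (hb : PolySymb b) (φ : 𝓢(Conf d, ℂ)) (t : ℝ) (x : Conf d) (k : Fin d) :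
    ∫ z, b t z * (Zmat (Θx t) Θy (κ t) z).mulVec (toC (x - (κ t z).1)) k *
      gaussTransform ε Θy φ z * kernel ε (κ t) (S t) (Θx t) x z =
      -(ε : ℂ) * ∫ z, dz Θy k (b t) z * gaussTransform ε Θy φ z *
        kernel ε (κ t) (S t) (Θx t) x z := by
  have hε0 : (ε : ℂ) ≠ 0 := by exact_mod_cast hε.ne'
  have hW := rapidDecay_gaussTransform h.width_right hε φ
  set G : Phase d → Phase d → ℂ := fun v z => b t z * (kernel ε (κ t) (S t) (Θx t) x z *
      (gaussTransform ε Θy φ z * kernelExpFDeriv ε (κ t) (Θx t) x z v +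
        gaussTransformFDeriv ε Θy φ z v)) with hG
  have hi : ∀ v, Integrable (G v) := fun v => (h.integral_mul_fderiv hε hb φ t x v).1
  have hv : ∀ v, ∫ z, G v z = -∫ z, fderiv ℝ (b t) z v * gaussTransform ε Θy φ z *
      kernel ε (κ t) (S t) (Θx t) x z := fun v => (h.integral_mul_fderiv hε hb φ t x v).2
  -- The contributions of p·dq from the two factors are opposite, so ∂_z of the product retains only
  -- ε⁻¹𝒵(x-X).
  have e1 : ∀ z, b t z * (Zmat (Θx t) Θy (κ t) z).mulVec (toC (x - (κ t z).1)) k *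
      gaussTransform ε Θy φ z * kernel ε (κ t) (S t) (Θx t) x z =
      (ε : ℂ) * (∑ j, Θy⁻¹ k j * G (basisVec j, 0) z - Complex.I * G (0, basisVec k) z) := by
    intro z
    have h1 := dzCLM_kernelExpFDeriv (h.classB.differentiable t z) ε (Θx t) Θy x k
    have h2 := dzCLM_gaussTransformFDeriv h.width_right ε φ k z
    have h3 : ∑ j, Θy⁻¹ k j * G (basisVec j, 0) z - Complex.I * G (0, basisVec k) z =
        b t z * (kernel ε (κ t) (S t) (Θx t) x z * dzCLM Θy k (gaussTransform ε Θy φ z •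
          kernelExpFDeriv ε (κ t) (Θx t) x z + gaussTransformFDeriv ε Θy φ z)) := by
      rw [dzCLM_apply, mul_sub, mul_sub, Finset.mul_sum, Finset.mul_sum]
      simp only [hG, add_apply, smul_apply, smul_eq_mul]
      congr 1
      · exact Finset.sum_congr rfl fun j _ => by ring
      · ring
    rw [h3, map_add, dzCLM_smul, h1, h2]
    field_simp
    ring
  have e2 : ∀ z, dz Θy k (b t) z * gaussTransform ε Θy φ z * kernel ε (κ t) (S t) (Θx t) x z =
      ∑ j, Θy⁻¹ k j * (fderiv ℝ (b t) z (basisVec j, 0) * gaussTransform ε Θy φ z *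
        kernel ε (κ t) (S t) (Θx t) x z) - Complex.I * (fderiv ℝ (b t) z (0, basisVec k) *
        gaussTransform ε Θy φ z * kernel ε (κ t) (S t) (Θx t) x z) := by
    intro z
    rw [dz, sub_mul, sub_mul, Finset.sum_mul, Finset.sum_mul]
    congr 1
    · exact Finset.sum_congr rfl fun j _ => by ring
    · ring
  have i1 : ∀ v, Integrable fun z => fderiv ℝ (b t) z v * gaussTransform ε Θy φ z *
      kernel ε (κ t) (S t) (Θx t) x z := fun v => h.integrable hε (hb.fderiv_apply v) hW t x
  simp only [e1, e2]
  rw [integral_const_mul, integral_sub (integrable_finsetSum _ fun j _ => (hi _).const_mul _)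
    ((hi _).const_mul _), integral_sub (integrable_finsetSum _ fun j _ => (i1 _).const_mul _)
    ((i1 _).const_mul _), integral_finsetSum _ fun j _ => (hi _).const_mul _,
    integral_finsetSum _ fun j _ => (i1 _).const_mul _]
  simp only [integral_const_mul, hv, mul_neg, Finset.sum_neg_distrib]
  ring

/-- Integration by parts for the pairing with `x - X`. -/
theorem integral_dotProduct (h : EvolutionData κ S Θx Θy) (hε : 0 < ε)
    {a : Fin d → ℝ → Phase d → ℂ} (ha : ∀ l, PolySymb (a l)) (φ : 𝓢(Conf d, ℂ)) (t : ℝ)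
    (x : Conf d) :
    ∫ z, (∑ l, a l t z * toC (x - (κ t z).1) l) * gaussTransform ε Θy φ z *
      kernel ε (κ t) (S t) (Θx t) x z =
      -(ε : ℂ) * ∫ z, zdiv Θy (fun z' => Matrix.vecMul (fun l => a l t z')
        (Zmat (Θx t) Θy (κ t) z')⁻¹) z * gaussTransform ε Θy φ z *
        kernel ε (κ t) (S t) (Θx t) x z := by
  have hW := rapidDecay_gaussTransform h.width_right hε φ
  set b : Fin d → ℝ → Phase d → ℂ := fun k t z =>
    Matrix.vecMul (fun l => a l t z) (Zmat (Θx t) Θy (κ t) z)⁻¹ k with hbdef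
  have hb : ∀ k, PolySymb (b k) := fun k => by
    simp only [hbdef, Matrix.vecMul, dotProduct]
    exact PolySymb.sum fun l _ => (ha l).mul (h.Zinv_polySymb l k)
  have hZ : ∀ i j, PolySymb fun t z => Zmat (Θx t) Θy (κ t) z i j := fun i j =>
    (Zmat_timeFam h.classB h.width_continuous 1 Θy i j).polySymb_of_one
  have hc : ∀ k, PolySymb fun t z => b k t z *
      (Zmat (Θx t) Θy (κ t) z).mulVec (toC (x - (κ t z).1)) k := fun k => by
    refine (hb k).mul ?_
    simp only [Matrix.mulVec, dotProduct]
    exact PolySymb.sum fun l _ => (hZ k l).mul (h.position_polySymb x l)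
  -- The identity 𝒵⁻¹𝒵 is inserted between a and x-X.
  have e1 : ∀ z, (∑ l, a l t z * toC (x - (κ t z).1) l) * gaussTransform ε Θy φ z *
      kernel ε (κ t) (S t) (Θx t) x z = ∑ k, b k t z *
        (Zmat (Θx t) Θy (κ t) z).mulVec (toC (x - (κ t z).1)) k * gaussTransform ε Θy φ z *
          kernel ε (κ t) (S t) (Θx t) x z := by
    intro z
    rw [← Finset.sum_mul, ← Finset.sum_mul]
    congr 2
    change (fun l => a l t z) ⬝ᵥ toC (x - (κ t z).1) = (fun k => b k t z) ⬝ᵥ _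
    have hdet := isUnit_det_Zmat (h.classB.canonical t) (h.width t) h.width_right z
    rw [Matrix.dotProduct_mulVec]
    congr 1
    simp only [hbdef]
    rw [Matrix.vecMul_vecMul, Matrix.nonsing_inv_mul _ hdet, Matrix.vecMul_one]
  have e2 : ∀ z, zdiv Θy (fun z' => Matrix.vecMul (fun l => a l t z')
      (Zmat (Θx t) Θy (κ t) z')⁻¹) z * gaussTransform ε Θy φ z *
        kernel ε (κ t) (S t) (Θx t) x z = ∑ k, dz Θy k (b k t) z * gaussTransform ε Θy φ z *
          kernel ε (κ t) (S t) (Θx t) x z := fun z => by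
    rw [zdiv, Finset.sum_mul, Finset.sum_mul]
  simp only [e1, e2]
  rw [integral_finsetSum _ fun k _ => h.integrable hε (hc k) hW t x,
    integral_finsetSum _ fun k _ => h.integrable hε ((hb k).dz Θy k) hW t x, Finset.mul_sum]
  exact Finset.sum_congr rfl fun k _ => h.integral_mul_Zmat hε (hb k) φ t x k

end EvolutionData

end IntegrationByParts

/-! ### The time derivative and the symbols v₀, v₁, v₂ -/

section TimeDerivative

variable {d : ℕ} {κ : ℝ → Phase d → Phase d} {S : ℝ → Phase d → ℝ}
  {Θx : ℝ → Matrix (Fin d) (Fin d) ℂ} {Θy : Matrix (Fin d) (Fin d) ℂ}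

/-- The time derivative of the exponent of the kernel, divided by `i / ε`. -/
noncomputable def dtPhase (κ : ℝ → Phase d → Phase d) (S : ℝ → Phase d → ℝ)
    (Θx : ℝ → Matrix (Fin d) (Fin d) ℂ) (x : Conf d) (t : ℝ) (z : Phase d) : ℂ :=
  ((deriv (fun s => S s z) t : ℝ) : ℂ) - toC (dtX κ t z) ⬝ᵥ toC (κ t z).2 +
    (∑ l, (toC (dtXi κ t z) - Complex.I • (Θx t).mulVec (toC (dtX κ t z))) l *
      toC (x - (κ t z).1) l) +
    Complex.I / 2 * ∑ m, (∑ l, toC (x - (κ t z).1) l * dtMat Θx t l m) * toC (x - (κ t z).1) m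

namespace EvolutionData

theorem hasDerivAt_kernelExp (h : EvolutionData κ S Θx Θy) (ε : ℝ) (x : Conf d) (z : Phase d)
    (t : ℝ) : HasDerivAt (fun s => kernelExp ε (κ s) (S s) (Θx s) x z)
      (Complex.I / (ε : ℂ) * dtPhase κ S Θx x t z) t := by
  have hκ := h.classB.hasDerivAt z t
  have hX : ∀ j, HasDerivAt (fun s => toC (κ s z).1 j) (toC (dtX κ t z) j) t := fun j => by
    rw [h.classB.dtX_eq]
    exact (coordC j ∘L ContinuousLinearMap.fst ℝ (Conf d) (Conf d)).hasFDerivAt.comp_hasDerivAt t hκ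
  have hΞ : ∀ j, HasDerivAt (fun s => toC (κ s z).2 j) (toC (dtXi κ t z) j) t := fun j => by
    rw [h.classB.dtXi_eq]
    exact (coordC j ∘L ContinuousLinearMap.snd ℝ (Conf d) (Conf d)).hasFDerivAt.comp_hasDerivAt t hκ
  have hY : ∀ j, HasDerivAt (fun s => toC (x - (κ s z).1) j) (-toC (dtX κ t z) j) t := fun j => by
    have := (hX j).const_sub (toC x j)
    refine this.congr_of_eventuallyEq (Eventually.of_forall fun s => ?_)
    simp [toC]
  have hΘ : ∀ i j, HasDerivAt (fun s => Θx s i j) (dtMat Θx t i j) t := fun i j =>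
    (((h.width_C1 i j).differentiable one_ne_zero) t).hasDerivAt
  have hS : HasDerivAt (fun s => ((S s z : ℝ) : ℂ)) ((deriv (fun s => S s z) t : ℝ) : ℂ) t :=
    ((((h.action_C1 z).differentiable one_ne_zero) t).hasDerivAt).ofReal_comp
  have h1 : HasDerivAt (fun s => ∑ j, toC (κ s z).2 j * toC (x - (κ s z).1) j)
      (∑ j, (toC (dtXi κ t z) j * toC (x - (κ t z).1) j +
        toC (κ t z).2 j * -toC (dtX κ t z) j)) t :=
    HasDerivAt.fun_sum fun j _ => (hΞ j).mul (hY j)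
  have h2 : HasDerivAt (fun s => ∑ j, toC (x - (κ s z).1) j *
      ∑ k, Θx s j k * toC (x - (κ s z).1) k)
      (∑ j, (-toC (dtX κ t z) j * (∑ k, Θx t j k * toC (x - (κ t z).1) k) +
        toC (x - (κ t z).1) j * ∑ k, (dtMat Θx t j k * toC (x - (κ t z).1) k +
          Θx t j k * -toC (dtX κ t z) k))) t :=
    HasDerivAt.fun_sum fun j _ => (hY j).mul (HasDerivAt.fun_sum fun k _ => (hΘ j k).mul (hY k))
  have h3 := ((hS.add h1).add (h2.const_mul (Complex.I / 2))).const_mul (Complex.I / (ε : ℂ))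
  have h4 : HasDerivAt (fun s => kernelExp ε (κ s) (S s) (Θx s) x z) _ t :=
    h3.congr_of_eventuallyEq (Eventually.of_forall fun s => by
      simp only [kernelExp, pairC_apply, bilinC_apply, dotProduct, Matrix.mulVec]
      rfl)
  refine h4.congr_deriv ?_
  congr 1
  rw [dtPhase]
  set Y := toC (x - (κ t z).1)
  set V := toC (dtX κ t z)
  have e1 : ∑ j, (toC (dtXi κ t z) j * Y j + toC (κ t z).2 j * -V j) =
      ∑ j, toC (dtXi κ t z) j * Y j - V ⬝ᵥ toC (κ t z).2 := by
    rw [Finset.sum_add_distrib, sub_eq_add_neg, dotProduct, ← Finset.sum_neg_distrib]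
    congr 1
    exact Finset.sum_congr rfl fun j _ => by ring
  have e2 : ∑ l, (toC (dtXi κ t z) - Complex.I • (Θx t).mulVec V) l * Y l =
      ∑ l, toC (dtXi κ t z) l * Y l - Complex.I * ∑ l, (Θx t).mulVec V l * Y l := by
    rw [Finset.mul_sum, ← Finset.sum_sub_distrib]
    refine Finset.sum_congr rfl fun l _ => ?_
    simp only [Pi.sub_apply, Pi.smul_apply, smul_eq_mul]
    ring
  have e3 : ∑ j, (-V j * (∑ k, Θx t j k * Y k) + Y j * ∑ k, (dtMat Θx t j k * Y k +
      Θx t j k * -V k)) = -(V ⬝ᵥ (Θx t).mulVec Y) + ∑ j, Y j * ∑ k, dtMat Θx t j k * Y k -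
        ∑ l, (Θx t).mulVec V l * Y l := by
    rw [dotProduct, ← Finset.sum_neg_distrib, ← Finset.sum_add_distrib, ← Finset.sum_sub_distrib]
    refine Finset.sum_congr rfl fun j _ => ?_
    simp only [Matrix.mulVec, dotProduct, Finset.sum_add_distrib, mul_neg, Finset.sum_neg_distrib]
    ring
  -- Symmetry of Θx makes the two terms with X' in the derivative of the quadratic form equal, which
  -- removes the factor 1/2.
  have e4 : V ⬝ᵥ (Θx t).mulVec Y = ∑ l, (Θx t).mulVec V l * Y l := by
    rw [Matrix.dotProduct_mulVec, ← Matrix.mulVec_transpose, (h.width t).symm.eq]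
    rfl
  have e5 : ∑ m, (∑ l, Y l * dtMat Θx t l m) * Y m = ∑ j, Y j * ∑ k, dtMat Θx t j k * Y k := by
    simp only [Finset.sum_mul, Finset.mul_sum]
    rw [Finset.sum_comm]
    exact Finset.sum_congr rfl fun j _ => Finset.sum_congr rfl fun k _ => by ring
  rw [e1, e2, e3, e4, e5]
  ring

theorem dtMat_polySymb (h : EvolutionData κ S Θx Θy) (i j : Fin d) :
    PolySymb fun t (_ : Phase d) => dtMat Θx t i j :=
  PolySymb.const ((h.width_C1 i j).continuous_deriv le_rfl)

theorem velocity_polySymb (h : EvolutionData κ S Θx Θy) (l : Fin d) :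
    PolySymb fun t z =>
      (toC (dtXi κ t z) - Complex.I • (Θx t).mulVec (toC (dtX κ t z))) l := by
  simp only [Pi.sub_apply, Pi.smul_apply, smul_eq_mul, Matrix.mulVec, dotProduct]
  exact (dtXi_timeFam h.classB 1 l).polySymb.sub (PolySymb.const_mul (PolySymb.sum fun k _ =>
    (PolySymb.const (h.width_continuous l k)).mul (dtX_timeFam h.classB 1 k).polySymb) _)

theorem dtPhase_polySymb (h : EvolutionData κ S Θx Θy) (x : Conf d) :
    PolySymb (dtPhase κ S Θx x) := by
  refine PolySymb.add (PolySymb.add (PolySymb.sub ?_ ?_) ?_) (PolySymb.const_mul ?_ _)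
  · exact (dt_action_timeFam h.classB h.action h.action_C1 1).ofReal.polySymb
  · simp only [dotProduct]
    exact PolySymb.sum fun j _ => (dtX_timeFam h.classB 1 j).polySymb.mul (h.momentum_polySymb j)
  · exact PolySymb.sum fun l _ => (h.velocity_polySymb l).mul (h.position_polySymb x l)
  · exact PolySymb.sum fun m _ => (PolySymb.sum fun l _ =>
      (h.position_polySymb x l).mul (h.dtMat_polySymb l m)).mul (h.position_polySymb x m)

/-- The time derivative of the symbol times the kernel, divided by the kernel. -/
theorem dtSymbol_polySymb (h : EvolutionData κ S Θx Θy) {u : ℝ → Phase d → ℂ} (hu : PolySymb u)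
    (hu' : PolySymb fun t z => deriv (fun s => u s z) t) (ε : ℝ) (x : Conf d) :
    PolySymb fun t z => deriv (fun s => u s z) t +
      u t z * (Complex.I / (ε : ℂ) * dtPhase κ S Θx x t z) :=
  hu'.add (hu.mul ((h.dtPhase_polySymb x).const_mul _))

theorem hasDerivAt_integral (h : EvolutionData κ S Θx Θy) {ε : ℝ} (hε : 0 < ε)
    {u : ℝ → Phase d → ℂ} (hu : PolySymb u)
    (hu' : PolySymb fun t z => deriv (fun s => u s z) t)
    (hd : ∀ z, Differentiable ℝ fun t => u t z) {W : Phase d → ℂ} (hW : RapidDecay W)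
    (x : Conf d) (t : ℝ) :
    HasDerivAt (fun s => ∫ z, u s z * W z * kernel ε (κ s) (S s) (Θx s) x z)
      (∫ z, (deriv (fun s => u s z) t + u t z * (Complex.I / (ε : ℂ) * dtPhase κ S Θx x t z)) *
        W z * kernel ε (κ t) (S t) (Θx t) x z) t := by
  have hD := h.dtSymbol_polySymb hu hu' ε x
  obtain ⟨m, hm⟩ := hD.polyFamily.growth
  obtain ⟨C, hC, hb⟩ := hm (|t| + 1)
  refine (hasDerivAt_integral_of_dominated_loc_of_deriv_le (𝕜 := ℝ) (μ := volume)
    (F := fun s z => u s z * W z * kernel ε (κ s) (S s) (Θx s) x z)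
    (F' := fun t z => (deriv (fun s => u s z) t +
      u t z * (Complex.I / (ε : ℂ) * dtPhase κ S Θx x t z)) *
        W z * kernel ε (κ t) (S t) (Θx t) x z)
    (s := Set.Icc (-(|t| + 1)) (|t| + 1)) (bound := fun z => C * ((1 + ‖z‖) ^ m * ‖W z‖))
    (eventually_mem_Icc t) (Eventually.of_forall fun s => (h.integrable hε hu hW s x).1)
    (h.integrable hε hu hW t x) (h.integrable hε hD hW t x).1
    (Eventually.of_forall fun z s hs => ?_) ((hW.integrable_pow_mul m).const_mul C)
    (Eventually.of_forall fun z s _ => ?_)).2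
  · rw [norm_mul, norm_mul]
    calc _ ≤ C * (1 + ‖z‖) ^ m * ‖W z‖ * 1 := by
          gcongr
          · exact hb s hs z
          · exact h.kernelFamily.norm_kernel_le_one hε s x z
      _ = _ := by ring
  · have h1 := ((hd z s).hasDerivAt.mul_const (W z)).mul (h.hasDerivAt_kernelExp ε x z s).cexp
    refine h1.congr_deriv ?_
    rw [kernel]
    ring

variable {u : ℝ → Phase d → ℂ}

theorem dtMat_Zinv_polySymb (h : EvolutionData κ S Θx Θy) (hu : PolySymb u) (l k : Fin d) :
    PolySymb fun t z => (dtMat Θx t * (Zmat (Θx t) Θy (κ t) z)⁻¹) l k * u t z := by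
  obtain ⟨m, hu⟩ := hu
  exact ⟨m, dtMat_Zinv_timeFam h.classB h.width h.width_C1 h.width_right hu l k⟩

theorem v0_polySymb (h : EvolutionData κ S Θx Θy) (hu : PolySymb u) : PolySymb (v0 κ S u) := by
  obtain ⟨m, hu⟩ := hu
  exact ⟨m + 2, (v0_timeFam h.classB h.action h.action_C1 hu).congr_weight
    fun z => (pow_add _ _ _).symm⟩

theorem v1_polySymb (h : EvolutionData κ S Θx Θy) (hu : PolySymb u)
    (hu' : PolySymb fun t z => deriv (fun s => u s z) t) : PolySymb (v1 κ Θx Θy u) := by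
  obtain ⟨m, hu⟩ := hu.exists_le
  obtain ⟨n, hu'⟩ := hu'.exists_le
  exact ⟨max m n + 1, (v1_timeFam h.classB h.width h.width_C1 h.width_right
    (hu _ (le_max_left _ _)) (hu' _ (le_max_right _ _))).congr_weight
      fun z => (pow_add _ _ _).symm⟩

theorem v2_polySymb (h : EvolutionData κ S Θx Θy) (hu : PolySymb u) :
    PolySymb (v2 κ Θx Θy u) := by
  obtain ⟨m, hu⟩ := hu
  exact ⟨m, v2_timeFam h.classB h.width h.width_C1 h.width_right hu⟩

theorem dz_position (x : Conf d) (t : ℝ) (z : Phase d)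
    (k l : Fin d) : dz Θy k (fun z => toC (x - (κ t z).1) l) z = -Xz Θy (κ t) z k l := by
  have h1 : ∀ z, toC (x - (κ t z).1) l = toC x l - toC (κ t z).1 l := fun z => by simp [toC]
  have h2 : Xz Θy (κ t) z k l = dz Θy k (fun z => toC (κ t z).1 l) z := rfl
  simp only [h1]
  rw [h2, dz_eq, dz_eq, fderiv_const_sub, map_neg]

theorem dz_mul {f g : Phase d → ℂ} {z : Phase d} (hf : DifferentiableAt ℝ f z)
    (hg : DifferentiableAt ℝ g z) (k : Fin d) :
    dz Θy k (fun z => f z * g z) z = f z * dz Θy k g z + g z * dz Θy k f z := by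
  rw [dz_eq, dz_eq, dz_eq, fderiv_fun_mul hf hg, map_add, dzCLM_smul, dzCLM_smul]

theorem dz_sum {f : Fin d → Phase d → ℂ} {z : Phase d}
    (hf : ∀ l, DifferentiableAt ℝ (f l) z) (k : Fin d) :
    dz Θy k (fun z => ∑ l, f l z) z = ∑ l, dz Θy k (f l) z := by
  simp only [dz_eq]
  rw [fderiv_fun_sum fun l _ => hf l, map_sum]

/-- The divergence produced by the quadratic term of the phase. -/
theorem zdiv_quadratic (h : EvolutionData κ S Θx Θy) (hu : PolySymb u) (x : Conf d) (t : ℝ)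
    (z : Phase d) :
    zdiv Θy (fun z' => Matrix.vecMul
      (fun m => u t z' * ∑ l, toC (x - (κ t z').1) l * dtMat Θx t l m)
      (Zmat (Θx t) Θy (κ t) z')⁻¹) z =
      -(u t z * ((Zmat (Θx t) Θy (κ t) z)⁻¹ * Xz Θy (κ t) z * dtMat Θx t).trace) +
      ∑ k, ∑ l, dz Θy k (fun z' => (dtMat Θx t * (Zmat (Θx t) Θy (κ t) z')⁻¹) l k * u t z') z *
        toC (x - (κ t z).1) l := by
  have e1 : ∀ k z', Matrix.vecMul (fun m => u t z' * ∑ l, toC (x - (κ t z').1) l * dtMat Θx t l m)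
      (Zmat (Θx t) Θy (κ t) z')⁻¹ k = ∑ l, toC (x - (κ t z').1) l *
        ((dtMat Θx t * (Zmat (Θx t) Θy (κ t) z')⁻¹) l k * u t z') := by
    intro k z'
    simp only [Matrix.vecMul, dotProduct, Matrix.mul_apply, Finset.mul_sum, Finset.sum_mul]
    rw [Finset.sum_comm]
    exact Finset.sum_congr rfl fun l _ => Finset.sum_congr rfl fun m _ => by ring
  have hY := fun l => (h.position_polySymb x l).differentiable t z
  have hG := fun l k => (h.dtMat_Zinv_polySymb hu l k).differentiable t z
  -- Product rule: ∂_z of x-X is -X_z and leads to the trace; otherwise the factor x-X survives.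
  have e2 : ∀ k, dz Θy k (fun z' => ∑ l, toC (x - (κ t z').1) l *
        ((dtMat Θx t * (Zmat (Θx t) Θy (κ t) z')⁻¹) l k * u t z')) z =
      ∑ l, dz Θy k (fun z' => (dtMat Θx t * (Zmat (Θx t) Θy (κ t) z')⁻¹) l k * u t z') z *
        toC (x - (κ t z).1) l -
      u t z * ∑ l, Xz Θy (κ t) z k l * (dtMat Θx t * (Zmat (Θx t) Θy (κ t) z)⁻¹) l k := by
    intro k
    have hYG : ∀ l, DifferentiableAt ℝ (fun z' => toC (x - (κ t z').1) l *
        ((dtMat Θx t * (Zmat (Θx t) Θy (κ t) z')⁻¹) l k * u t z')) z := fun l =>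
      (hY l).mul (hG l k)
    rw [dz_sum hYG, Finset.mul_sum, ← Finset.sum_sub_distrib]
    refine Finset.sum_congr rfl fun l _ => ?_
    rw [dz_mul (hY l) (hG l k), dz_position]
    ring
  have e3 : ((Zmat (Θx t) Θy (κ t) z)⁻¹ * Xz Θy (κ t) z * dtMat Θx t).trace =
      ∑ k, ∑ l, Xz Θy (κ t) z k l * (dtMat Θx t * (Zmat (Θx t) Θy (κ t) z)⁻¹) l k := by
    rw [Matrix.mul_assoc, Matrix.trace_mul_comm, Matrix.mul_assoc]
    rfl
  simp only [zdiv, e1, e2]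
  rw [Finset.sum_sub_distrib, ← Finset.mul_sum, e3]
  ring

/-- The time derivative is, after integration by parts, an operator of the same type with symbol
`v₀ + ε v₁ + ε² v₂`. -/
theorem integral_dtSymbol (h : EvolutionData κ S Θx Θy) {ε : ℝ} (hε : 0 < ε) (hu : PolySymb u)
    (hu' : PolySymb fun t z => deriv (fun s => u s z) t) (φ : 𝓢(Conf d, ℂ)) (t : ℝ) (x : Conf d) :
    Complex.I * (ε : ℂ) * ∫ z, (deriv (fun s => u s z) t +
      u t z * (Complex.I / (ε : ℂ) * dtPhase κ S Θx x t z)) * gaussTransform ε Θy φ z *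
        kernel ε (κ t) (S t) (Θx t) x z =
    ∫ z, (v0 κ S u t z + (ε : ℂ) * v1 κ Θx Θy u t z + (ε : ℂ) ^ 2 * v2 κ Θx Θy u t z) *
      gaussTransform ε Θy φ z * kernel ε (κ t) (S t) (Θx t) x z := by
  have hε0 : (ε : ℂ) ≠ 0 := by exact_mod_cast hε.ne'
  have hW := rapidDecay_gaussTransform h.width_right hε φ
  set K : Phase d → ℂ := fun z => gaussTransform ε Θy φ z * kernel ε (κ t) (S t) (Θx t) x z with hK
  have hint : ∀ {a : ℝ → Phase d → ℂ}, PolySymb a → Integrable fun z => a t z * K z := by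
    intro a ha
    simp only [hK, ← mul_assoc]
    exact h.integrable hε ha hW t x
  have hdot : ∀ {a : Fin d → ℝ → Phase d → ℂ}, (∀ l, PolySymb (a l)) →
      ∫ z, (∑ l, a l t z * toC (x - (κ t z).1) l) * K z = -(ε : ℂ) * ∫ z, zdiv Θy
        (fun z' => Matrix.vecMul (fun l => a l t z') (Zmat (Θx t) Θy (κ t) z')⁻¹) z * K z := by
    intro a ha
    simpa only [hK, ← mul_assoc] using h.integral_dotProduct hε ha φ t x
  -- Coefficients to be paired with x-X: `a₁` from the linear term, `a₂` from the quadratic term and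
  -- itself linear in x-X, `a₃` from what stays linear after the first integration by parts of the
  -- quadratic term.
  set a₁ : Fin d → ℝ → Phase d → ℂ := fun l t z => u t z *
    (toC (dtXi κ t z) - Complex.I • (Θx t).mulVec (toC (dtX κ t z))) l with ha₁
  set a₂ : Fin d → ℝ → Phase d → ℂ := fun m t z => u t z *
    ∑ l, toC (x - (κ t z).1) l * dtMat Θx t l m with ha₂
  set a₃ : Fin d → Fin d → ℝ → Phase d → ℂ := fun k l t z => dz Θy k
    (fun z' => (dtMat Θx t * (Zmat (Θx t) Θy (κ t) z')⁻¹) l k * u t z') z with ha₃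
  have p₁ : ∀ l, PolySymb (a₁ l) := fun l => hu.mul (h.velocity_polySymb l)
  have p₂ : ∀ m, PolySymb (a₂ m) := fun m => hu.mul (PolySymb.sum fun l _ =>
    (h.position_polySymb x l).mul (h.dtMat_polySymb l m))
  have p₃ : ∀ k l, PolySymb (a₃ k l) := fun k l => (h.dtMat_Zinv_polySymb hu l k).dz Θy k
  have q : ∀ {a : Fin d → ℝ → Phase d → ℂ}, (∀ l, PolySymb (a l)) →
      PolySymb fun t z => ∑ l, a l t z * toC (x - (κ t z).1) l := fun ha =>
    PolySymb.sum fun l _ => (ha l).mul (h.position_polySymb x l)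
  have qd : ∀ {a : Fin d → ℝ → Phase d → ℂ}, (∀ l, PolySymb (a l)) → PolySymb fun t z => zdiv Θy
      (fun z' => Matrix.vecMul (fun l => a l t z') (Zmat (Θx t) Θy (κ t) z')⁻¹) z := fun ha => by
    simp only [zdiv, Matrix.vecMul, dotProduct]
    exact PolySymb.sum fun k _ => (PolySymb.sum fun l _ => (ha l).mul (h.Zinv_polySymb l k)).dz Θy k
  have qt : PolySymb fun t z => u t z *
      ((Zmat (Θx t) Θy (κ t) z)⁻¹ * Xz Θy (κ t) z * dtMat Θx t).trace := by
    simp only [Matrix.trace, Matrix.diag, Matrix.mul_apply]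
    exact hu.mul (PolySymb.sum fun i _ => PolySymb.sum fun j _ => (PolySymb.sum fun k _ =>
      (h.Zinv_polySymb i k).mul (Xz_timeFam h.classB 1 Θy k j).polySymb_of_one).mul
        (h.dtMat_polySymb j i))
  have qv := h.v0_polySymb hu
  have e0 : ∀ z, Complex.I * (ε : ℂ) * ((deriv (fun s => u s z) t +
      u t z * (Complex.I / (ε : ℂ) * dtPhase κ S Θx x t z)) * K z) =
      v0 κ S u t z * K z + Complex.I * (ε : ℂ) * (deriv (fun s => u s z) t * K z) -
      (∑ l, a₁ l t z * toC (x - (κ t z).1) l) * K z -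
      Complex.I / 2 * ((∑ m, a₂ m t z * toC (x - (κ t z).1) m) * K z) := by
    intro z
    have s1 : ∑ l, a₁ l t z * toC (x - (κ t z).1) l = u t z * ∑ l, (toC (dtXi κ t z) -
        Complex.I • (Θx t).mulVec (toC (dtX κ t z))) l * toC (x - (κ t z).1) l := by
      rw [Finset.mul_sum]
      exact Finset.sum_congr rfl fun l _ => by rw [ha₁, mul_assoc]
    have s2 : ∑ m, a₂ m t z * toC (x - (κ t z).1) m = u t z *
        ∑ m, (∑ l, toC (x - (κ t z).1) l * dtMat Θx t l m) * toC (x - (κ t z).1) m := by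
      rw [Finset.mul_sum]
      exact Finset.sum_congr rfl fun l _ => by rw [ha₂, mul_assoc]
    -- The prefactor iε meets the i/ε of the exponent; hence the signs in v₀ and in front of the
    -- terms with `a₁` and `a₂`.
    have s3 : Complex.I * (ε : ℂ) * (Complex.I / (ε : ℂ)) = -1 := by
      field_simp
      exact Complex.I_sq
    rw [s1, s2, v0, dtPhase]
    linear_combination (u t z * (((deriv (fun s => S s z) t : ℝ) : ℂ) -
      toC (dtX κ t z) ⬝ᵥ toC (κ t z).2 +
      (∑ l, (toC (dtXi κ t z) - Complex.I • (Θx t).mulVec (toC (dtX κ t z))) l *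
        toC (x - (κ t z).1) l) +
      Complex.I / 2 * ∑ m, (∑ l, toC (x - (κ t z).1) l * dtMat Θx t l m) *
        toC (x - (κ t z).1) m) * K z) * s3
  have d₁ := hdot p₁
  have d₂ := hdot p₂
  have d₃ := fun k => hdot (p₃ k)
  have e2 : ∀ z, zdiv Θy (fun z' => Matrix.vecMul (fun l => a₂ l t z')
      (Zmat (Θx t) Θy (κ t) z')⁻¹) z * K z =
      -(u t z * ((Zmat (Θx t) Θy (κ t) z)⁻¹ * Xz Θy (κ t) z * dtMat Θx t).trace * K z) +
      ∑ k, (∑ l, a₃ k l t z * toC (x - (κ t z).1) l) * K z := by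
    intro z
    rw [h.zdiv_quadratic hu, add_mul, neg_mul, Finset.sum_mul]
  have e1 : ∀ z, zdiv Θy (fun z' => Matrix.vecMul (fun l => a₁ l t z')
      (Zmat (Θx t) Θy (κ t) z')⁻¹) z = zdiv Θy (fun z' => u t z' •
        Matrix.vecMul (toC (dtXi κ t z') - Complex.I • (Θx t).mulVec (toC (dtX κ t z')))
          (Zmat (Θx t) Θy (κ t) z')⁻¹) z := by
    intro z
    congr 1
    funext z'
    rw [← Matrix.smul_vecMul]
    rfl
  have e3 : ∀ z, (v0 κ S u t z + (ε : ℂ) * v1 κ Θx Θy u t z + (ε : ℂ) ^ 2 * v2 κ Θx Θy u t z) *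
      K z = v0 κ S u t z * K z + Complex.I * (ε : ℂ) * (deriv (fun s => u s z) t * K z) +
      (ε : ℂ) * (zdiv Θy (fun z' => Matrix.vecMul (fun l => a₁ l t z')
        (Zmat (Θx t) Θy (κ t) z')⁻¹) z * K z) -
      Complex.I / 2 * (ε : ℂ) * (u t z * ((Zmat (Θx t) Θy (κ t) z)⁻¹ * Xz Θy (κ t) z *
        dtMat Θx t).trace * K z) -
      Complex.I / 2 * (ε : ℂ) ^ 2 * ∑ k, zdiv Θy (fun z' => Matrix.vecMul (fun l => a₃ k l t z')
        (Zmat (Θx t) Θy (κ t) z')⁻¹) z * K z := by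
    intro z
    rw [e1, ← Finset.sum_mul, v1, v2]
    ring
  have i₀ := hint qv
  have i₁ := hint hu'
  have j₁ := hint (q p₁)
  have j₂ := hint (q p₂)
  have j₃ := fun k => hint (q (p₃ k))
  have k₁ := hint (qd p₁)
  have k₃ := fun k => hint (qd (p₃ k))
  have iT := hint qt
  have iTn : Integrable fun z => -(u t z * ((Zmat (Θx t) Θy (κ t) z)⁻¹ * Xz Θy (κ t) z *
      dtMat Θx t).trace * K z) := iT.neg
  have s₁ : Integrable fun z => v0 κ S u t z * K z +
      Complex.I * (ε : ℂ) * (deriv (fun s => u s z) t * K z) := i₀.add (i₁.const_mul _)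
  have s₂ : Integrable fun z => v0 κ S u t z * K z +
      Complex.I * (ε : ℂ) * (deriv (fun s => u s z) t * K z) -
      (∑ l, a₁ l t z * toC (x - (κ t z).1) l) * K z := s₁.sub j₁
  have s₃ : Integrable fun z => v0 κ S u t z * K z +
      Complex.I * (ε : ℂ) * (deriv (fun s => u s z) t * K z) +
      (ε : ℂ) * (zdiv Θy (fun z' => Matrix.vecMul (fun l => a₁ l t z')
        (Zmat (Θx t) Θy (κ t) z')⁻¹) z * K z) := s₁.add (k₁.const_mul _)
  have s₄ : Integrable fun z => v0 κ S u t z * K z +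
      Complex.I * (ε : ℂ) * (deriv (fun s => u s z) t * K z) +
      (ε : ℂ) * (zdiv Θy (fun z' => Matrix.vecMul (fun l => a₁ l t z')
        (Zmat (Θx t) Θy (κ t) z')⁻¹) z * K z) -
      Complex.I / 2 * (ε : ℂ) * (u t z * ((Zmat (Θx t) Θy (κ t) z)⁻¹ * Xz Θy (κ t) z *
        dtMat Θx t).trace * K z) := s₃.sub (iT.const_mul _)
  -- The second integration by parts, applied to the part of the divergence that is still linear in
  -- x-X; the trace part is final.
  have f2 : ∫ z, zdiv Θy (fun z' => Matrix.vecMul (fun l => a₂ l t z')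
      (Zmat (Θx t) Θy (κ t) z')⁻¹) z * K z =
      -(∫ z, u t z * ((Zmat (Θx t) Θy (κ t) z)⁻¹ * Xz Θy (κ t) z * dtMat Θx t).trace * K z) -
      (ε : ℂ) * ∑ k, ∫ z, zdiv Θy (fun z' => Matrix.vecMul (fun l => a₃ k l t z')
        (Zmat (Θx t) Θy (κ t) z')⁻¹) z * K z := by
    simp only [e2]
    rw [integral_add iTn (integrable_finsetSum _ fun k _ => j₃ k), integral_neg,
      integral_finsetSum _ fun k _ => j₃ k, Finset.sum_congr rfl fun k _ => d₃ k,
      ← Finset.mul_sum]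
    ring
  have lhs : Complex.I * (ε : ℂ) * ∫ z, (deriv (fun s => u s z) t +
      u t z * (Complex.I / (ε : ℂ) * dtPhase κ S Θx x t z)) * K z =
      (∫ z, v0 κ S u t z * K z) + Complex.I * (ε : ℂ) * (∫ z, deriv (fun s => u s z) t * K z) -
      (∫ z, (∑ l, a₁ l t z * toC (x - (κ t z).1) l) * K z) -
      Complex.I / 2 * ∫ z, (∑ m, a₂ m t z * toC (x - (κ t z).1) m) * K z := by
    rw [← integral_const_mul]
    simp only [e0]
    rw [integral_sub s₂ (j₂.const_mul _), integral_sub s₁ j₁, integral_add i₀ (i₁.const_mul _),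
      integral_const_mul, integral_const_mul]
  have rhs : ∫ z, (v0 κ S u t z + (ε : ℂ) * v1 κ Θx Θy u t z + (ε : ℂ) ^ 2 * v2 κ Θx Θy u t z) *
      K z = (∫ z, v0 κ S u t z * K z) +
      Complex.I * (ε : ℂ) * (∫ z, deriv (fun s => u s z) t * K z) +
      (ε : ℂ) * (∫ z, zdiv Θy (fun z' => Matrix.vecMul (fun l => a₁ l t z')
        (Zmat (Θx t) Θy (κ t) z')⁻¹) z * K z) -
      Complex.I / 2 * (ε : ℂ) * (∫ z, u t z * ((Zmat (Θx t) Θy (κ t) z)⁻¹ * Xz Θy (κ t) z *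
        dtMat Θx t).trace * K z) -
      Complex.I / 2 * (ε : ℂ) ^ 2 * ∑ k, ∫ z, zdiv Θy (fun z' => Matrix.vecMul
        (fun l => a₃ k l t z') (Zmat (Θx t) Θy (κ t) z')⁻¹) z * K z := by
    simp only [e3]
    rw [integral_sub s₄ ((integrable_finsetSum _ fun k _ => k₃ k).const_mul _),
      integral_sub s₃ (iT.const_mul _), integral_add s₁ (k₁.const_mul _),
      integral_add i₀ (i₁.const_mul _),
      integral_const_mul, integral_const_mul, integral_const_mul, integral_const_mul,
      integral_finsetSum _ fun k _ => k₃ k]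
  have assoc : ∀ f : Phase d → ℂ, ∫ z, f z * gaussTransform ε Θy φ z *
      kernel ε (κ t) (S t) (Θx t) x z = ∫ z, f z * K z := fun f => by
    simp only [hK, mul_assoc]
  rw [assoc, assoc, lhs, rhs, d₁, d₂, f2]
  ring

end EvolutionData

end TimeDerivative

/-! ### Orders in p and admissible regularisations -/

section Orders

variable {d : ℕ}

theorem one_add_sq_rpow_le {s : ℝ} (hs : 0 ≤ s) {r : ℝ} {M : ℕ} (hr : |r| ≤ M) :
    (1 + s ^ 2) ^ (r / 2) ≤ (1 + s) ^ M := by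
  have h1 : (1 + s ^ 2) ^ (r / 2) ≤ (1 + s ^ 2) ^ ((M : ℝ) / 2) :=
    Real.rpow_le_rpow_of_exponent_le (by nlinarith) (by linarith [le_abs_self r])
  have h2 : (1 + s ^ 2) ^ ((M : ℝ) / 2) ≤ ((1 + s) ^ (2 : ℝ)) ^ ((M : ℝ) / 2) := by
    refine Real.rpow_le_rpow (by positivity) ?_ (by positivity)
    rw [Real.rpow_two]
    nlinarith
  rw [← Real.rpow_mul (by positivity), mul_div_cancel₀ _ two_ne_zero, Real.rpow_natCast] at h2
  exact h1.trans h2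

theorem orderFun_le (mq mp : ℝ) : ∃ m : ℕ, ∀ z : Phase d, orderFun mq mp z ≤ 1 * (1 + ‖z‖) ^ m := by
  refine ⟨⌈|mq|⌉₊ + ⌈|mp|⌉₊, fun z => ?_⟩
  rw [one_mul, pow_add, orderFun]
  have h1 := one_add_sq_rpow_le (norm_nonneg z.1) (Nat.le_ceil |mq|)
  have h2 := one_add_sq_rpow_le (norm_nonneg z.2) (Nat.le_ceil |mp|)
  have h3 := norm_fst_le z
  have h4 := norm_snd_le z
  refine mul_le_mul (h1.trans ?_) (h2.trans ?_) (by positivity) (by positivity)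
  · exact pow_le_pow_left₀ (by positivity) (by linarith) _
  · exact pow_le_pow_left₀ (by positivity) (by linarith) _

theorem TimeFam.polySymb_of_orderFun {a : ℝ → Phase d → ℂ} {mq mp : ℝ}
    (h : TimeFam 1 (orderFun mq mp) fun _ => a) : PolySymb a := by
  obtain ⟨m, hm⟩ := orderFun_le (d := d) mq mp
  exact ⟨m, h.mono (continuous_one_add_norm_pow m) (one_add_norm_pow_pos m) 1 zero_le_one hm⟩

theorem hasOrder_of_norm_le {a : Phase d → ℂ} {mq mp C : ℝ} (hC : 0 ≤ C)
    (h : ∀ z, ‖a z‖ ≤ C * orderFun mq mp z) : HasOrder mp a := by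
  refine ⟨C, ⌈|mq|⌉₊, hC, fun z => (h z).trans ?_⟩
  have h1 := one_add_sq_rpow_le (norm_nonneg z.1) (Nat.le_ceil |mq|)
  rw [orderFun]
  gcongr

/-- Since (1+‖z‖)² ≤ 2(1+|q|)²(1+|p|²), two powers of growth in z raise the order in p by two,
whence the condition n > m_p + 2 + d. The growth in q is unrestricted. -/
theorem hasOrder_of_norm_le_mul {a : Phase d → ℂ} {mq mp C : ℝ} (hC : 0 ≤ C)
    (h : ∀ z, ‖a z‖ ≤ C * (orderFun mq mp z * (1 + ‖z‖) ^ 2)) : HasOrder (mp + 2) a := by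
  refine ⟨2 * C, ⌈|mq|⌉₊ + 2, by positivity, fun z => (h z).trans ?_⟩
  have h1 := one_add_sq_rpow_le (norm_nonneg z.1) (Nat.le_ceil |mq|)
  have h0 : 0 < 1 + ‖z.2‖ ^ 2 := by positivity
  have h2 : (1 + ‖z.2‖ ^ 2) ^ ((mp + 2) / 2) =
      (1 + ‖z.2‖ ^ 2) ^ (mp / 2) * (1 + ‖z.2‖ ^ 2) := by
    rw [add_div, div_self two_ne_zero, Real.rpow_add h0, Real.rpow_one]
  have h3 : 1 + ‖z‖ ≤ (1 + ‖z.1‖) * (1 + ‖z.2‖) := by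
    rw [Prod.norm_def]
    have := mul_nonneg (norm_nonneg z.1) (norm_nonneg z.2)
    have := max_le_add_of_nonneg (norm_nonneg z.1) (norm_nonneg z.2)
    nlinarith
  have h4 : (1 + ‖z‖) ^ 2 ≤ 2 * ((1 + ‖z.1‖) ^ 2 * (1 + ‖z.2‖ ^ 2)) := by
    refine (pow_le_pow_left₀ (by positivity) h3 2).trans ?_
    rw [mul_pow]
    have h5 : (1 + ‖z.2‖) ^ 2 ≤ 2 * (1 + ‖z.2‖ ^ 2) := by nlinarith [sq_nonneg (1 - ‖z.2‖)]
    calc _ ≤ (1 + ‖z.1‖) ^ 2 * (2 * (1 + ‖z.2‖ ^ 2)) :=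
          mul_le_mul_of_nonneg_left h5 (by positivity)
      _ = _ := by ring
  rw [h2, orderFun]
  calc _ ≤ C * ((1 + ‖z.1‖) ^ ⌈|mq|⌉₊ * (1 + ‖z.2‖ ^ 2) ^ (mp / 2) *
        (2 * ((1 + ‖z.1‖) ^ 2 * (1 + ‖z.2‖ ^ 2)))) := by
        refine mul_le_mul_of_nonneg_left (mul_le_mul ?_ h4 (by positivity) (by positivity)) hC
        exact mul_le_mul_of_nonneg_right h1 (by positivity)
    _ = _ := by ring

end Orders

/-! ### The evolution equation in Schwartz space -/

namespace EvolutionData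

variable {d : ℕ} {κ : ℝ → Phase d → Phase d} {S : ℝ → Phase d → ℝ}
  {Θx : ℝ → Matrix (Fin d) (Fin d) ℂ} {Θy : Matrix (Fin d) (Fin d) ℂ}

theorem integrable_fio (h : EvolutionData κ S Θx Θy) {ε : ℝ} (hε : 0 < ε) {a : ℝ → Phase d → ℂ}
    (ha : PolySymb a) {μ : ℝ} (t : ℝ) (hord : HasOrder μ (a t)) {n : ℕ} (hn : μ + d < n)
    (φ : 𝓢(Conf d, ℂ)) (x : Conf d) :
    Integrable (fioIntegrand n ε (κ t) (S t) (lift (a t)) (Θx t) Θy φ x) := by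
  have hk : Continuous (kernel ε (κ t) (S t) (Θx t) x) :=
    (h.kernelFamily.continuous_kernel ε x).comp (Continuous.prodMk_right t)
  have hc : Continuous (a t) := ha.polyFamily.continuous.comp (Continuous.prodMk_right t)
  exact integrable_fioIntegrand h.width_right hε hk
    (fun z => h.kernelFamily.norm_kernel_le_one hε t x z) hc hord hn φ

/-- The evolution equation for the operators, up to the normalising constant. -/
theorem exists_schwartz_evolution (h : EvolutionData κ S Θx Θy) {ε : ℝ} (hε : 0 < ε)
    {u : ℝ → Phase d → ℂ} (hu : PolySymb u)
    (hu' : PolySymb fun t z => deriv (fun s => u s z) t)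
    (hd : ∀ z, Differentiable ℝ fun t => u t z) (φ : 𝓢(Conf d, ℂ)) :
    ∃ A B : ℝ → 𝓢(Conf d, ℂ),
      (∀ t x, A t x = ∫ z, u t z * gaussTransform ε Θy φ z *
        kernel ε (κ t) (S t) (Θx t) x z) ∧
      (∀ t x, B t x = ∫ z, (v0 κ S u t z + (ε : ℂ) * v1 κ Θx Θy u t z +
        (ε : ℂ) ^ 2 * v2 κ Θx Θy u t z) * gaussTransform ε Θy φ z *
          kernel ε (κ t) (S t) (Θx t) x z) ∧
      ∀ t, Tendsto (fun r : ℝ => (Complex.I * (ε : ℂ)) • r⁻¹ • (A (t + r) - A t))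
        (𝓝[≠] 0) (𝓝 (B t)) := by
  have hW := rapidDecay_gaussTransform h.width_right hε φ
  have hv : PolySymb fun t z => v0 κ S u t z + (ε : ℂ) * v1 κ Θx Θy u t z +
      (ε : ℂ) ^ 2 * v2 κ Θx Θy u t z :=
    ((h.v0_polySymb hu).add ((h.v1_polySymb hu hu').const_mul _)).add
      ((h.v2_polySymb hu).const_mul _)
  obtain ⟨A, hA, -⟩ := h.kernelFamily.exists_schwartz hε hu.polyFamily hW
  obtain ⟨B, hB, hBb⟩ := h.kernelFamily.exists_schwartz hε hv.polyFamily hW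
  refine ⟨A, B, hA, hB, fun t => ?_⟩
  have hc : Complex.I * (ε : ℂ) ≠ 0 :=
    mul_ne_zero Complex.I_ne_zero (by exact_mod_cast hε.ne')
  -- The derivative of A is (iε)⁻¹B, whose seminorms are locally bounded in time because those of B
  -- are.
  have key := tendsto_schwartz_slope (A := A) (B := fun t => (Complex.I * (ε : ℂ))⁻¹ • B t)
    (fun x t => ?_) (fun k n T => ?_) (fun x => ?_) t
  · have := key.const_smul (Complex.I * (ε : ℂ))
    rwa [smul_inv_smul₀ hc] at this
  · simp only [hA]
    refine (h.hasDerivAt_integral hε hu hu' hd hW x t).congr_deriv ?_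
    rw [smul_apply, hB, ← h.integral_dtSymbol hε hu hu' φ t x, smul_eq_mul,
      inv_mul_cancel_left₀ hc]
  · obtain ⟨C, hC⟩ := hBb k n T
    refine ⟨‖(Complex.I * (ε : ℂ))⁻¹‖ * C, fun t ht x => ?_⟩
    have e : iteratedFDeriv ℝ n (⇑((Complex.I * (ε : ℂ))⁻¹ • B t)) x =
        (Complex.I * (ε : ℂ))⁻¹ • iteratedFDeriv ℝ n (B t) x :=
      iteratedFDeriv_const_smul_apply ((B t).smooth n).contDiffAt
    rw [e, norm_smul, mul_left_comm]
    exact mul_le_mul_of_nonneg_left (hC t ht x) (norm_nonneg _)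
  · simp only [smul_apply, hB, smul_eq_mul]
    exact continuous_const.mul (h.kernelFamily.continuous_integral hε hv.polyFamily hW x)

end EvolutionData

end HermanKluk

/-! ### The proposition -/

theorem proposition3p2 {d : ℕ} (mq mp ε₀ : ℝ) (hε₀ : 0 < ε₀)
    (u : ℝ → ℝ → HermanKluk.Phase d → ℂ)
    (hu : HermanKluk.IsSymbolFamily ε₀ (HermanKluk.orderFun mq mp) u)
    (hu_C1 : ∀ ε ∈ Set.Ioc 0 ε₀, ∀ z, ContDiff ℝ 1 (fun t => u ε t z))
    (hu_deriv : HermanKluk.IsSymbolFamily ε₀ (HermanKluk.orderFun mq mp)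
      (fun ε t z => deriv (fun s => u ε s z) t))
    (κ : ℝ → HermanKluk.Phase d → HermanKluk.Phase d)
    (hκ : HermanKluk.IsClassBFamily κ)
    (S : ℝ → HermanKluk.Phase d → ℝ)
    (hS : ∀ t, HermanKluk.IsAction (κ t) (S t))
    (hS_C1 : ∀ z, ContDiff ℝ 1 (fun t => S t z))
    (Θx : ℝ → Matrix (Fin d) (Fin d) ℂ)
    (hΘx : ∀ t, HermanKluk.IsWidth (Θx t))
    (hΘx_C1 : ∀ i j, ContDiff ℝ 1 (fun t => Θx t i j))
    (Θy : Matrix (Fin d) (Fin d) ℂ)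
    (hΘy : HermanKluk.IsWidth Θy) :
    -- the matrix `𝒵(t, q, p)` is invertible
    (∀ t z, IsUnit (HermanKluk.Zmat (Θx t) Θy (κ t) z).det) ∧
    -- the symbol classes of `v₀`, `v₁`, `v₂`
    HermanKluk.IsSymbolFamily ε₀
      (fun z => HermanKluk.phaseBracket z ^ 2 * HermanKluk.orderFun mq mp z)
      (fun ε => HermanKluk.v0 κ S (u ε)) ∧
    HermanKluk.IsSymbolFamily ε₀
      (fun z => HermanKluk.phaseBracket z * HermanKluk.orderFun mq mp z)
      (fun ε => HermanKluk.v1 κ Θx Θy (u ε)) ∧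
    HermanKluk.IsSymbolFamily ε₀ (HermanKluk.orderFun mq mp)
      (fun ε => HermanKluk.v2 κ Θx Θy (u ε)) ∧
    -- `A t` and `B t` are the operators with symbols `u` and `v₀ + ε v₁ + ε² v₂` on Schwartz space,
    -- given by absolutely convergent integrals for every admissible `n`, and `i ε d/dt A = B`
    ∀ ε ∈ Set.Ioc 0 ε₀,
      ∃ A B : ℝ → 𝓢(HermanKluk.Conf d, ℂ) → 𝓢(HermanKluk.Conf d, ℂ),
        (∀ n : ℕ, mp + d < n → ∀ (t : ℝ) (φ : 𝓢(HermanKluk.Conf d, ℂ)) (x : HermanKluk.Conf d),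
          Integrable (HermanKluk.fioIntegrand n ε (κ t) (S t) (HermanKluk.lift (u ε t))
            (Θx t) Θy φ x) ∧
          A t φ x = HermanKluk.fio n ε (κ t) (S t) (HermanKluk.lift (u ε t)) (Θx t) Θy φ x) ∧
        (∀ n : ℕ, mp + 2 + d < n → ∀ (t : ℝ) (φ : 𝓢(HermanKluk.Conf d, ℂ)) (x : HermanKluk.Conf d),
          Integrable (HermanKluk.fioIntegrand n ε (κ t) (S t)
            (HermanKluk.lift fun z => HermanKluk.v0 κ S (u ε) t z
              + (ε : ℂ) * HermanKluk.v1 κ Θx Θy (u ε) t z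
              + (ε : ℂ) ^ 2 * HermanKluk.v2 κ Θx Θy (u ε) t z)
            (Θx t) Θy φ x) ∧
          B t φ x = HermanKluk.fio n ε (κ t) (S t)
            (HermanKluk.lift fun z => HermanKluk.v0 κ S (u ε) t z
              + (ε : ℂ) * HermanKluk.v1 κ Θx Θy (u ε) t z
              + (ε : ℂ) ^ 2 * HermanKluk.v2 κ Θx Θy (u ε) t z)
            (Θx t) Θy φ x) ∧
        ∀ (φ : 𝓢(HermanKluk.Conf d, ℂ)) (t : ℝ),
          Tendsto (fun h : ℝ => (Complex.I * (ε : ℂ)) • h⁻¹ • (A (t + h) φ - A t φ))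
            (𝓝[≠] 0) (𝓝 (B t φ)) := by
  have hE : HermanKluk.EvolutionData κ S Θx Θy := ⟨hκ, hS, hS_C1, hΘx, hΘx_C1, hΘy⟩
  have hwc := HermanKluk.continuous_orderFun (d := d) mq mp
  have hwp := HermanKluk.orderFun_pos (d := d) mq mp
  have fu := HermanKluk.TimeFam.of_isSymbolFamily hwc hwp hu
  have fu' := HermanKluk.TimeFam.of_isSymbolFamily hwc hwp hu_deriv
  have f0 := HermanKluk.v0_timeFam hκ hS hS_C1 fu
  have f1 := HermanKluk.v1_timeFam hκ hΘx hΘx_C1 hΘy fu fu'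
  have f2 := HermanKluk.v2_timeFam hκ hΘx hΘx_C1 hΘy fu
  refine ⟨fun t z => HermanKluk.isUnit_det_Zmat (hκ.canonical t) (hΘx t) hΘy z,
    (f0.mono_phaseBracket hwc hwp).isSymbolFamily, ?_, f2.isSymbolFamily, fun ε hε => ?_⟩
  · simpa only [pow_one] using (f1.mono_phaseBracket hwc hwp).isSymbolFamily
  have pu : HermanKluk.PolySymb (u ε) := (fu.fix ⟨ε, hε⟩ 1).polySymb_of_orderFun
  have pu' : HermanKluk.PolySymb fun t z => deriv (fun s => u ε s z) t :=
    (fu'.fix ⟨ε, hε⟩ 1).polySymb_of_orderFun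
  have pv : HermanKluk.PolySymb fun t z => HermanKluk.v0 κ S (u ε) t z
      + (ε : ℂ) * HermanKluk.v1 κ Θx Θy (u ε) t z
      + (ε : ℂ) ^ 2 * HermanKluk.v2 κ Θx Θy (u ε) t z :=
    ((hE.v0_polySymb pu).add ((hE.v1_polySymb pu pu').const_mul _)).add
      ((hE.v2_polySymb pu).const_mul _)
  have ou : ∀ t, HermanKluk.HasOrder mp (u ε t) := fun t => by
    obtain ⟨C, hC, hb⟩ := fu.norm_le (|t| + 1)
    exact HermanKluk.hasOrder_of_norm_le hC (hb ⟨ε, hε⟩ t (HermanKluk.mem_Icc_abs t))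
  have ov : ∀ t, HermanKluk.HasOrder (mp + 2) fun z => HermanKluk.v0 κ S (u ε) t z
      + (ε : ℂ) * HermanKluk.v1 κ Θx Θy (u ε) t z
      + (ε : ℂ) ^ 2 * HermanKluk.v2 κ Θx Θy (u ε) t z := fun t => by
    obtain ⟨C₀, hC₀, b₀⟩ := f0.norm_le (|t| + 1)
    obtain ⟨C₁, hC₁, b₁⟩ := f1.norm_le (|t| + 1)
    obtain ⟨C₂, hC₂, b₂⟩ := f2.norm_le (|t| + 1)
    have ht := HermanKluk.mem_Icc_abs t
    have hε0 : ‖(ε : ℂ)‖ = ε := Complex.norm_of_nonneg hε.1.le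
    have hε1 := hε.1
    -- The three symbols grow like the powers 2, 1 and 0 of 1+‖z‖ relative to the order function;
    -- all are majorised by the square.
    refine HermanKluk.hasOrder_of_norm_le_mul (mq := mq) (C := C₀ + ε * C₁ + ε ^ 2 * C₂)
      (by positivity) fun z => (norm_add₃_le).trans ?_
    have hz : 1 ≤ 1 + ‖z‖ := by linarith [norm_nonneg z]
    have l₁ : (1 + ‖z‖) ^ 1 ≤ (1 + ‖z‖) ^ 2 := pow_le_pow_right₀ hz one_le_two
    have l₂ : (1 : ℝ) ≤ (1 + ‖z‖) ^ 2 := one_le_pow₀ hz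
    have w0 := (hwp z).le
    rw [norm_mul, norm_mul, norm_pow, hε0, add_mul, add_mul, mul_assoc ε, mul_assoc (ε ^ 2)]
    refine add_le_add (add_le_add (b₀ ⟨ε, hε⟩ t ht z)
      (mul_le_mul_of_nonneg_left ((b₁ ⟨ε, hε⟩ t ht z).trans ?_) hε1.le))
      (mul_le_mul_of_nonneg_left ((b₂ ⟨ε, hε⟩ t ht z).trans ?_) (by positivity))
    · exact mul_le_mul_of_nonneg_left (mul_le_mul_of_nonneg_left l₁ w0) hC₁
    · exact mul_le_mul_of_nonneg_left (le_mul_of_one_le_right w0 l₂) hC₂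
  choose A B hA hB hAB using fun φ => hE.exists_schwartz_evolution hε.1 pu pu'
    (fun z => (hu_C1 ε hε z).differentiable one_ne_zero) φ
  -- The normalising constant does not depend on t and passes through the limit.
  set c : ℂ := (((2 * Real.pi * ε) ^ (3 * (d : ℝ) / 2) : ℝ) : ℂ)⁻¹ with hc
  refine ⟨fun t φ => c • A φ t, fun t φ => c • B φ t, fun n hn t φ x => ?_, fun n hn t φ x => ?_,
    fun φ t => ?_⟩
  · have hint := hE.integrable_fio hε.1 pu t (ou t) hn φ x
    exact ⟨hint, by rw [HermanKluk.fio_lift_eq hΘy hε.1 hint, smul_apply, hA]; rfl⟩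
  · have hint := hE.integrable_fio hε.1 pv t (ov t) hn φ x
    exact ⟨hint, by rw [HermanKluk.fio_lift_eq hΘy hε.1 hint, smul_apply, hB]; rfl⟩
  · refine ((hAB φ t).const_smul c).congr fun r => ?_
    rw [← smul_sub, smul_comm r⁻¹ c, smul_comm c]
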